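/- For complex $\nu$ and $z\neq 0$ let $J_\nu(z)$, $Y_\nu(z)$ and $K_\nu(z)$ denote the principal branches of the Bessel functions of the first and second kind and of the modified Bessel function of the second kind, let primes denote differentiation with respect to the argument, and put $\omega=z-\frac{\pi}{2}\nu-\frac{\pi}{4}$. Let $b_0(\nu)=1$ and, for $n\ge 1$, $$b_n(\nu)=\frac{\big((4\nu^2-1^2)(4\nu^2-3^2)\cdots(4\nu^2-(2n-3)^2)\big)(4\nu^2+4n^2-1)}{8^n\,n!}$$ (the empty product being $1$). For non-negative integers $N$, the remainders $R_N^{(K')}(z,\nu)$ are defined for $|\arg z|<\pi$ by $$K'_\nu(z)=-\Big(\frac{\pi}{2z}\Big)^{1/2}e^{-z}\Big(\sum_{n=0}^{N-1}\frac{b_n(\nu)}{z^n}+R_N^{(K')}(z,\nu)\Big),$$ and the remainders $R_N^{(J')}(z,\nu)$ are defined for $|\arg z|<\pi$ by the pair of equations, for all non-negative integers $N,M$, $$J'_\nu(z)=-\Big(\frac{2}{\pi z}\Big)^{1/2}\Big(\sin\omega\Big(\sum_{n=0}^{N-1}(-1)^n\frac{b_{2n}(\nu)}{z^{2n}}+R_{2N}^{(J')}(z,\nu)\Big)+\cos\omega\Big(\sum_{m=0}^{M-1}(-1)^m\frac{b_{2m+1}(\nu)}{z^{2m+1}}-R_{2M+1}^{(J')}(z,\nu)\Big)\Big),$$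 $$Y'_\nu(z)=\Big(\frac{2}{\pi z}\Big)^{1/2}\Big(\cos\omega\Big(\sum_{n=0}^{N-1}(-1)^n\frac{b_{2n}(\nu)}{z^{2n}}+R_{2N}^{(J')}(z,\nu)\Big)-\sin\omega\Big(\sum_{m=0}^{M-1}(-1)^m\frac{b_{2m+1}(\nu)}{z^{2m+1}}-R_{2M+1}^{(J')}(z,\nu)\Big)\Big),$$ with principal square roots. Theorem. Let $N$ be a positive integer and let $\nu$ be a complex number with $|\Re(\nu)|<N-\frac12$. Then $$R_N^{(K')}(z,\nu)=(-1)^N\Big(\frac{2}{\pi}\Big)^{1/2}\frac{\cos(\pi\nu)}{\pi}\frac{1}{z^N}\int_0^{+\infty}\frac{t^{N-\frac12}e^{-t}}{1+t/z}K'_\nu(t)\,dt$$ for all $z\ne0$ with $|\arg z|<\pi$, and $$R_N^{(J')}(z,\nu)=(-1)^{\lfloor N/2\rfloor}\Big(\frac{2}{\pi}\Big)^{1/2}\frac{\cos(\pi\nu)}{\pi}\frac{1}{z^N}\int_0^{+\infty}\frac{t^{N-\frac12}e^{-t}}{1+(t/z)^2}K'_\nu(t)\,dt$$ for all $z\ne0$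 with $|\arg z|<\frac{\pi}{2}$; both integrals converge absolutely. -/

import Mathlib

noncomputable section

/-- The modified Bessel function of the first kind `I_ν(z)` (principal branch): power series.
`Complex.Gamma` vanishes at its poles in Mathlib, so `(Γ s)⁻¹` is the entire function `1/Γ`. -/
def besselI (ν z : ℂ) : ℂ :=
  (z / 2) ^ ν * ∑' k : ℕ,
    (z ^ 2 / 4) ^ k * (Complex.Gamma (ν + (k : ℂ) + 1))⁻¹ / (k.factorial : ℂ)

/-- The Bessel function of the first kind `J_ν(z)` (principal branch): power series. -/
def besselJ (ν z : ℂ) : ℂ :=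
  (z / 2) ^ ν * ∑' k : ℕ,
    (-(z ^ 2 / 4)) ^ k * (Complex.Gamma (ν + (k : ℂ) + 1))⁻¹ / (k.factorial : ℂ)

open Classical in
/-- The modified Bessel function of the second kind
`K_ν(z) = (π / 2) (I_{-ν}(z) - I_ν(z)) / sin (π ν)`, the limit in the order being taken when `ν` is
an integer. -/
def besselK (ν z : ℂ) : ℂ :=
  if ∃ n : ℤ, ν = (n : ℂ) then
    Filter.limUnder (nhdsWithin ν {ν}ᶜ) fun μ : ℂ =>
      (Real.pi : ℂ) / 2 * (besselI (-μ) z - besselI μ z) / Complex.sin (Real.pi * μ)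
  else
    (Real.pi : ℂ) / 2 * (besselI (-ν) z - besselI ν z) / Complex.sin (Real.pi * ν)

open Classical in
/-- The Bessel function of the second kind
`Y_ν(z) = (J_ν(z) cos (π ν) - J_{-ν}(z)) / sin (π ν)`, the limit in the order being taken when `ν` is
an integer. -/
def besselY (ν z : ℂ) : ℂ :=
  if ∃ n : ℤ, ν = (n : ℂ) then
    Filter.limUnder (nhdsWithin ν {ν}ᶜ) fun μ : ℂ =>
      (besselJ μ z * Complex.cos (Real.pi * μ) - besselJ (-μ) z) / Complex.sin (Real.pi * μ)
  else
    (besselJ ν z * Complex.cos (Real.pi * ν) - besselJ (-ν) z) / Complex.sin (Real.pi * ν)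

/-- The derivative `K'_ν(z)` with respect to the argument `z`. -/
def besselK' (ν z : ℂ) : ℂ := deriv (besselK ν) z

/-- The derivative `J'_ν(z)` with respect to the argument `z`. -/
def besselJ' (ν z : ℂ) : ℂ := deriv (besselJ ν) z

/-- The derivative `Y'_ν(z)` with respect to the argument `z`. -/
def besselY' (ν z : ℂ) : ℂ := deriv (besselY ν) z

/-- The coefficients `b_n(ν)`: `b_0(ν) = 1` and, for `n ≥ 1`,
`b_n(ν) = (4ν² - 1²)(4ν² - 3²) ⋯ (4ν² - (2n-3)²) (4ν² + 4n² - 1) / (8ⁿ n!)`. -/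
def besselB : ℕ → ℂ → ℂ
  | 0, _ => 1
  | n + 1, ν =>
      (∏ k ∈ Finset.range n, (4 * ν ^ 2 - (2 * (k : ℂ) + 1) ^ 2)) *
        (4 * ν ^ 2 + 4 * ((n : ℂ) + 1) ^ 2 - 1) / (8 ^ (n + 1) * ((n + 1).factorial : ℂ))

/-- The remainder `R_N^{(K')}(z, ν)`, i.e. the solution of
`K'_ν(z) = -(π / (2z))^{1/2} e^{-z} (∑_{n < N} b_n(ν) / zⁿ + R_N^{(K')}(z, ν))`. -/
def remK' (N : ℕ) (z ν : ℂ) : ℂ :=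
  -(besselK' ν z / (((Real.pi : ℂ) / (2 * z)) ^ (1 / 2 : ℂ) * Complex.exp (-z))) -
    ∑ n ∈ Finset.range N, besselB n ν / z ^ n

/-- The phase `ω = z - π ν / 2 - π / 4`. -/
def besselOmega (z ν : ℂ) : ℂ := z - (Real.pi : ℂ) / 2 * ν - (Real.pi : ℂ) / 4

/-- The factor `(2 / (π z))^{1/2}`. -/
def besselAmp (z : ℂ) : ℂ := (2 / ((Real.pi : ℂ) * z)) ^ (1 / 2 : ℂ)

/-- The remainders `R_N^{(J')}(z, ν)`. Those with `N` even and those with `N` odd are the unique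
solution of the system formed by the truncated expansions of `J'_ν` and of `Y'_ν`, which share their
remainders: see `besselJ'_expansion` and `besselY'_expansion`. -/
def remJ' (N : ℕ) (z ν : ℂ) : ℂ :=
  if Even N then
    -(Complex.sin (besselOmega z ν) * besselJ' ν z -
        Complex.cos (besselOmega z ν) * besselY' ν z) / besselAmp z -
      ∑ n ∈ Finset.range (N / 2), (-1) ^ n * besselB (2 * n) ν / z ^ (2 * n)
  else
    (Complex.cos (besselOmega z ν) * besselJ' ν z +
        Complex.sin (besselOmega z ν) * besselY' ν z) / besselAmp z +
      ∑ m ∈ Finset.range (N / 2), (-1) ^ m * besselB (2 * m + 1) ν / z ^ (2 * m + 1)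

theorem besselAmp_ne_zero {z : ℂ} (hz : z ≠ 0) : besselAmp z ≠ 0 := by
  have h : (Real.pi : ℂ) ≠ 0 := by exact_mod_cast Real.pi_ne_zero
  simp [besselAmp, Complex.cpow_eq_zero_iff, hz, h]

/-- The defining equation of the remainders `R_N^{(K')}`. -/
theorem besselK'_expansion (N : ℕ) {z : ℂ} (hz : z ≠ 0) (ν : ℂ) :
    besselK' ν z = -((Real.pi : ℂ) / (2 * z)) ^ (1 / 2 : ℂ) * Complex.exp (-z) *
      (∑ n ∈ Finset.range N, besselB n ν / z ^ n + remK' N z ν) := by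
  have h : (Real.pi : ℂ) ≠ 0 := by exact_mod_cast Real.pi_ne_zero
  have h1 : ((Real.pi : ℂ) / (2 * z)) ^ (1 / 2 : ℂ) ≠ 0 := by
    simp [Complex.cpow_eq_zero_iff, hz, h]
  have h2 := Complex.exp_ne_zero (-z)
  unfold remK'
  generalize ((Real.pi : ℂ) / (2 * z)) ^ (1 / 2 : ℂ) = c at *
  generalize Complex.exp (-z) = e at *
  generalize ∑ n ∈ Finset.range N, besselB n ν / z ^ n = s at *
  field_simp
  ring

/-- The truncated expansion of `J'_ν` that introduces the remainders `R_N^{(J')}`. -/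
theorem besselJ'_expansion (N M : ℕ) {z : ℂ} (hz : z ≠ 0) (ν : ℂ) :
    besselJ' ν z = -besselAmp z *
      (Complex.sin (besselOmega z ν) *
          (∑ n ∈ Finset.range N, (-1) ^ n * besselB (2 * n) ν / z ^ (2 * n) +
            remJ' (2 * N) z ν) +
        Complex.cos (besselOmega z ν) *
          (∑ m ∈ Finset.range M, (-1) ^ m * besselB (2 * m + 1) ν / z ^ (2 * m + 1) -
            remJ' (2 * M + 1) z ν)) := by
  have hA := besselAmp_ne_zero hz
  have e1 : 2 * N / 2 = N := by omega
  have e2 : (2 * M + 1) / 2 = M := by omega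
  have e3 : ¬ Even (2 * M + 1) := by simp
  have hsc := Complex.sin_sq_add_cos_sq (besselOmega z ν)
  simp only [remJ', even_two_mul, if_true, if_neg e3, e1, e2]
  field_simp
  linear_combination (-(besselJ' ν z)) * hsc

/-- The companion truncated expansion of `Y'_ν`, with the same remainders. -/
theorem besselY'_expansion (N M : ℕ) {z : ℂ} (hz : z ≠ 0) (ν : ℂ) :
    besselY' ν z = besselAmp z *
      (Complex.cos (besselOmega z ν) *
          (∑ n ∈ Finset.range N, (-1) ^ n * besselB (2 * n) ν / z ^ (2 * n) +
            remJ' (2 * N) z ν) -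
        Complex.sin (besselOmega z ν) *
          (∑ m ∈ Finset.range M, (-1) ^ m * besselB (2 * m + 1) ν / z ^ (2 * m + 1) -
            remJ' (2 * M + 1) z ν)) := by
  have hA := besselAmp_ne_zero hz
  have e1 : 2 * N / 2 = N := by omega
  have e2 : (2 * M + 1) / 2 = M := by omega
  have e3 : ¬ Even (2 * M + 1) := by simp
  have hsc := Complex.sin_sq_add_cos_sq (besselOmega z ν)
  simp only [remJ', even_two_mul, if_true, if_neg e3, e1, e2]
  field_simp
  linear_combination (-(besselY' ν z)) * hsc

end

/-!
Everything is derived from a Stieltjes representation of the Macdonald function. For `t > 0` let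
`K_ν(t) = ½ ∫ exp (-t cosh u + ν u) du` over the real line; the Wronskians of this function with the
series `I_{±ν}`, evaluated at the origin, identify it with the `K_ν` defined by the series
(`sin_mul_macdonald`).

For real `|ν| < 1/2` put `h(t) = t^{-1/2} e^{-t} K_ν(t)`. Integration by parts against Bessel's
equation (`integral_stieltjesDensity_mul_adjoint`) shows that `z ↦ ∫ h(t) / (1 + t/z) dt` solves the
second-order equation of `√z e^z K_ν(z)`. Both functions stay bounded at infinity, whereas the
Wronskian of two solutions is a multiple of `e^{2z}`; so they are proportional, with the constant
given by the zeroth moment `∫ h = √(π/2) π / cos πν` (`sqrt_mul_exp_mul_macdonald_eq`). Expanding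
`1 / (1 + t/z)` in a finite geometric series produces the large-argument expansion of `K_ν`, because
the moments of `h` obey the recursion of the coefficients, and its remainder is the integral
`∫ t^{N-1/2} e^{-t} K_ν(t) / (1 + t/z) dt` up to a factor. This integral converges for
`|Re ν| < N + 1/2` and `z` in the cut plane, so analytic continuation in `ν` (along the positive
axis) and then in `z` gives the expansion in that generality (`besselK_eq_expansion`).

Since `K'_ν = -(K_{ν-1} + K_{ν+1}) / 2` and `b_n(ν)` is the mean of the coefficients for the orders
`ν ± 1`, the formula for `R_N^{(K')}` is the mean of the two remainder formulas; the condition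
`|Re ν| < N - 1/2` puts `ν ± 1` in the admissible strip (`remK'_eq`).

In the right half-plane `J_ν ± i Y_ν` are multiples of `K_ν(∓i z)` (`besselY_eq`). Hence
`R_N^{(J')}(z)` is half the sum of `R_N^{(K')}(i z)` and `R_N^{(K')}(-i z)` for even `N`, and `-i/2`
times their difference for odd `N`; in both cases the partial fractions
`½ (1 / (1 + t/(iz)) + 1 / (1 - t/(iz))) = 1 / (1 + (t/z)²)` lead to the second formula
(`remJ'_eq`).
-/

section

open Complex Filter Topology MeasureTheory Set

/-! ### Holomorphic functions and parameter integrals -/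

/-- Two holomorphic functions on a preconnected open set that agree along a nondegenerate real
interval inside the set agree everywhere on it. -/
theorem eqOn_of_eq_on_real_interval {U : Set ℂ} (hU : IsOpen U) (hc : IsPreconnected U)
    {f g : ℂ → ℂ} (hf : DifferentiableOn ℂ f U) (hg : DifferentiableOn ℂ g U)
    {a b : ℝ} (hab : a < b) (hsub : ∀ x : ℝ, x ∈ Ioo a b → (x : ℂ) ∈ U)
    (h : ∀ x : ℝ, x ∈ Ioo a b → f x = g x) : EqOn f g U := by
  obtain ⟨c, hac, hcb⟩ := exists_between hab
  refine (hf.analyticOnNhd hU).eqOn_of_preconnected_of_frequently_eq (hg.analyticOnNhd hU) hc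
    (hsub c ⟨hac, hcb⟩) ?_
  have h1 : Tendsto (fun x : ℝ => (x : ℂ)) (𝓝[≠] c) (𝓝[≠] (c : ℂ)) := by
    refine tendsto_nhdsWithin_iff.2 ⟨(continuous_ofReal.tendsto c).mono_left nhdsWithin_le_nhds, ?_⟩
    filter_upwards [self_mem_nhdsWithin] with x hx
    simpa using hx
  refine h1.frequently (Eventually.frequently ?_)
  filter_upwards [nhdsWithin_le_nhds (Ioo_mem_nhds hac hcb)] with x hx using h x hx

theorem isPreconnected_slitPlane : IsPreconnected slitPlane :=
  (starConvex_one_slitPlane.isPathConnected one_mem_slitPlane).isConnected.isPreconnected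

/-- An integral depending holomorphically on a parameter is holomorphic as soon as the integrand is
locally uniformly dominated: Cauchy's estimate supplies the domination of the derivative. -/
theorem differentiableOn_integral_of_dominated {α : Type*} [MeasurableSpace α] {μ : Measure α}
    {U : Set ℂ} {F : ℂ → α → ℂ}
    (hmeas : ∀ w ∈ U, AEStronglyMeasurable (F w) μ)
    (hdiff : ∀ᵐ a ∂μ, DifferentiableOn ℂ (fun w => F w a) U)
    (hbound : ∀ w₀ ∈ U, ∃ r > 0, Metric.closedBall w₀ r ⊆ U ∧ ∃ bound : α → ℝ, Integrable bound μ ∧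
      ∀ᵐ a ∂μ, ∀ w ∈ Metric.closedBall w₀ r, ‖F w a‖ ≤ bound a) :
    DifferentiableOn ℂ (fun w => ∫ a, F w a ∂μ) U := by
  intro w₀ hw₀
  obtain ⟨r, hr, hrU, bound, hbi, hb⟩ := hbound w₀ hw₀
  have hballU : Metric.ball w₀ r ⊆ U := Metric.ball_subset_closedBall.trans hrU
  have hder : ∀ᵐ a ∂μ, ∀ w ∈ Metric.ball w₀ r, HasDerivAt (fun w => F w a)
      (deriv (fun w => F w a) w) w := by
    filter_upwards [hdiff] with a ha w hw
    exact ((ha.mono hballU).differentiableAt (Metric.isOpen_ball.mem_nhds hw)).hasDerivAt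
  have hmeas' : AEStronglyMeasurable (fun a => deriv (fun w => F w a) w₀) μ := by
    -- the derivative is an a.e. limit of difference quotients along `w₀ + r / (n + 2)`
    have hlim : Tendsto (fun n : ℕ => w₀ + ((r / ((n : ℝ) + 2) : ℝ) : ℂ)) atTop (𝓝[≠] w₀) := by
      refine tendsto_nhdsWithin_iff.2 ⟨?_, Eventually.of_forall fun n => ?_⟩
      · have : Tendsto (fun n : ℕ => r / ((n : ℝ) + 2)) atTop (𝓝 0) :=
          tendsto_const_nhds.div_atTop
            (tendsto_atTop_add_const_right _ _ tendsto_natCast_atTop_atTop)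
        simpa using (tendsto_const_nhds (x := w₀)).add ((continuous_ofReal.tendsto 0).comp this)
      · have : (0 : ℝ) < r / ((n : ℝ) + 2) := by positivity
        simp only [mem_compl_iff, mem_singleton_iff, add_eq_left, ofReal_eq_zero]
        exact this.ne'
    refine aestronglyMeasurable_of_tendsto_ae (u := atTop)
      (f := fun (n : ℕ) a => slope (fun w => F w a) w₀ (w₀ + ((r / ((n : ℝ) + 2) : ℝ) : ℂ)))
      (fun n => ?_) ?_
    · have hmem : w₀ + ((r / ((n : ℝ) + 2) : ℝ) : ℂ) ∈ Metric.closedBall w₀ r := by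
        have h0 : (0 : ℝ) ≤ r / ((n : ℝ) + 2) := by positivity
        simp only [Metric.mem_closedBall, dist_self_add_left, Complex.norm_real, Real.norm_eq_abs,
          abs_of_nonneg h0]
        exact div_le_self hr.le (by linarith [(Nat.cast_nonneg n : (0 : ℝ) ≤ n)])
      simp only [slope_def_field, div_eq_mul_inv]
      exact ((hmeas _ (hrU hmem)).sub (hmeas _ hw₀)).mul_const _
    · filter_upwards [hder] with a ha
      exact ((hasDerivAt_iff_tendsto_slope.1 (ha w₀ (Metric.mem_ball_self hr))).comp hlim)
  have key := hasDerivAt_integral_of_dominated_loc_of_deriv_le (μ := μ) (F := F) (x₀ := w₀)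
    (F' := fun w a => deriv (fun w => F w a) w) (bound := fun a => bound a / (r / 2))
    (s := Metric.ball w₀ (r / 2)) (Metric.ball_mem_nhds _ (by positivity)) ?_ ?_ hmeas' ?_ ?_ ?_
  · exact key.2.differentiableAt.differentiableWithinAt
  · filter_upwards [Metric.ball_mem_nhds w₀ hr] with w hw using hmeas w (hballU hw)
  · refine hbi.mono' (hmeas w₀ hw₀) ?_
    filter_upwards [hb] with a ha using ha w₀ (Metric.mem_closedBall_self hr.le)
  · filter_upwards [hb, hdiff] with a ha hda w hw
    have hsub : Metric.closedBall w (r / 2) ⊆ Metric.closedBall w₀ r := by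
      apply Metric.closedBall_subset_closedBall'
      have := Metric.mem_ball.1 hw
      linarith
    refine Complex.norm_deriv_le_of_forall_mem_sphere_norm_le (by positivity) ?_
      fun z hz => ha z (hsub (Metric.sphere_subset_closedBall hz))
    refine DifferentiableOn.diffContOnCl ?_
    exact hda.mono ((Metric.closure_ball_subset_closedBall.trans hsub).trans hrU)
  · exact hbi.div_const _
  · filter_upwards [hder] with a ha w hw using ha w (Metric.ball_subset_ball (by linarith) hw)

theorem eq_of_hasDerivAt_zero_Ioi {f : ℝ → ℂ} (h : ∀ t : ℝ, 0 < t → HasDerivAt f 0 t)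
    {l : Filter ℝ} [NeBot l] (hl : ∀ᶠ t in l, 0 < t) {c : ℂ} (hlim : Tendsto f l (𝓝 c))
    {t : ℝ} (ht : 0 < t) : f t = c := by
  have hconst : ∀ s : ℝ, 0 < s → f s = f t := fun s hs =>
    isOpen_Ioi.is_const_of_deriv_eq_zero isPreconnected_Ioi
      (fun x hx => (h x hx).differentiableAt.differentiableWithinAt)
      (fun x hx => (h x hx).deriv) (mem_Ioi.2 hs) (mem_Ioi.2 ht)
  refine tendsto_nhds_unique (tendsto_const_nhds.congr' ?_) hlim
  filter_upwards [hl] with s hs using (hconst s hs).symm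

theorem one_add_sq_div_two_le_cosh (u : ℝ) : 1 + u ^ 2 / 2 ≤ Real.cosh u := by
  have h1 : Real.cosh u = 1 + 2 * Real.sinh (u / 2) ^ 2 := by
    have := Real.cosh_two_mul (u / 2)
    rw [Real.cosh_sq, mul_div_cancel₀ u (two_ne_zero)] at this
    linarith
  have h2 : (u / 2) ^ 2 ≤ Real.sinh (u / 2) ^ 2 := by
    rw [← sq_abs, ← sq_abs (Real.sinh _), Real.abs_sinh]
    gcongr
    exact Real.self_le_sinh_iff.2 (abs_nonneg _)
  rw [h1]; linarith

theorem integrable_exp_neg_mul_cosh {t : ℝ} (ht : 0 < t) (σ : ℝ) :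
    Integrable (fun u : ℝ => Real.exp (-(t * Real.cosh u) + σ * u)) := by
  have h := (integrable_cexp_quadratic (b := (t / 2 : ℝ)) (by simpa using by positivity) (σ : ℂ)
    (-t : ℝ)).norm
  refine h.mono' (by fun_prop) (Eventually.of_forall fun u => ?_)
  rw [Real.norm_eq_abs, abs_of_pos (Real.exp_pos _), Complex.norm_exp]
  apply Real.exp_le_exp.2
  have h1 := mul_le_mul_of_nonneg_left (one_add_sq_div_two_le_cosh u) ht.le
  have h2 : (-((t / 2 : ℝ) : ℂ) * (u : ℂ) ^ 2 + (σ : ℂ) * u + ((-t : ℝ) : ℂ)).re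
      = -(t / 2) * u ^ 2 + σ * u + -t := by
    norm_cast
  rw [h2]; linarith

/-! ### The Macdonald function on the positive axis -/

/-- The Macdonald function `K_ν(t)`, for `t > 0`, through its integral representation
`½ ∫ exp (-t cosh u + ν u) du` over the real line. -/
noncomputable def macdonald (ν : ℂ) (t : ℝ) : ℂ :=
  (1 / 2) * ∫ u : ℝ, cexp (((-(t * Real.cosh u) : ℝ) : ℂ) + ν * u)

theorem norm_macdonald_integrand (ν : ℂ) (t u : ℝ) :
    ‖cexp (((-(t * Real.cosh u) : ℝ) : ℂ) + ν * u)‖ =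
      Real.exp (-(t * Real.cosh u) + ν.re * u) := by
  rw [Complex.norm_exp]
  congr 1
  simp [mul_re]

theorem integrable_macdonald_integrand (ν : ℂ) {t : ℝ} (ht : 0 < t) :
    Integrable (fun u : ℝ => cexp (((-(t * Real.cosh u) : ℝ) : ℂ) + ν * u)) := by
  refine (integrable_exp_neg_mul_cosh ht ν.re).mono' (by fun_prop)
    (Eventually.of_forall fun u => (norm_macdonald_integrand ν t u).le)

theorem cosh_mul_macdonald_integrand (ν : ℂ) (t u : ℝ) :
    (Real.cosh u : ℂ) * cexp (((-(t * Real.cosh u) : ℝ) : ℂ) + ν * u) =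
      (1 / 2) * (cexp (((-(t * Real.cosh u) : ℝ) : ℂ) + (ν - 1) * u) +
        cexp (((-(t * Real.cosh u) : ℝ) : ℂ) + (ν + 1) * u)) := by
  have h1 : (((-(t * Real.cosh u) : ℝ) : ℂ) + (ν - 1) * u) =
    (((-(t * Real.cosh u) : ℝ) : ℂ) + ν * u) + -u := by ring
  have h2 : (((-(t * Real.cosh u) : ℝ) : ℂ) + (ν + 1) * u) =
    (((-(t * Real.cosh u) : ℝ) : ℂ) + ν * u) + u := by ring
  rw [h1, h2, Complex.exp_add _ (-(u : ℂ)), Complex.exp_add _ (u : ℂ), ofReal_cosh, Complex.cosh]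
  ring

theorem sinh_mul_macdonald_integrand (ν : ℂ) (t u : ℝ) :
    (Real.sinh u : ℂ) * cexp (((-(t * Real.cosh u) : ℝ) : ℂ) + ν * u) =
      (1 / 2) * (cexp (((-(t * Real.cosh u) : ℝ) : ℂ) + (ν + 1) * u) -
        cexp (((-(t * Real.cosh u) : ℝ) : ℂ) + (ν - 1) * u)) := by
  have h1 : (((-(t * Real.cosh u) : ℝ) : ℂ) + (ν - 1) * u) =
    (((-(t * Real.cosh u) : ℝ) : ℂ) + ν * u) + -u := by ring
  have h2 : (((-(t * Real.cosh u) : ℝ) : ℂ) + (ν + 1) * u) =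
    (((-(t * Real.cosh u) : ℝ) : ℂ) + ν * u) + u := by ring
  rw [h1, h2, Complex.exp_add _ (-(u : ℂ)), Complex.exp_add _ (u : ℂ), ofReal_sinh, Complex.sinh]
  ring

/-- `K'_ν = -(K_{ν-1} + K_{ν+1}) / 2`. -/
theorem hasDerivAt_macdonald (ν : ℂ) {t : ℝ} (ht : 0 < t) :
    HasDerivAt (macdonald ν) (-(macdonald (ν - 1) t + macdonald (ν + 1) t) / 2) t := by
  have hi := fun μ : ℂ => integrable_macdonald_integrand μ ht
  have key := hasDerivAt_integral_of_dominated_loc_of_deriv_le (μ := volume) (x₀ := t)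
    (F := fun (t u : ℝ) => cexp (((-(t * Real.cosh u) : ℝ) : ℂ) + ν * u))
    (F' := fun (t u : ℝ) => -((Real.cosh u : ℂ) * cexp (((-(t * Real.cosh u) : ℝ) : ℂ) + ν * u)))
    (s := Ioi (t / 2)) (Ioi_mem_nhds (by linarith))
    (bound := fun u => ‖(Real.cosh u : ℂ) * cexp (((-(t / 2 * Real.cosh u) : ℝ) : ℂ) + ν * u)‖)
    (Eventually.of_forall fun s => (by fun_prop)) (hi ν) (by fun_prop) ?_ ?_ ?_
  · have h2 := key.2.const_mul (1 / 2 : ℂ)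
    have h3 : ∫ u : ℝ, -((Real.cosh u : ℂ) * cexp (((-(t * Real.cosh u) : ℝ) : ℂ) + ν * u)) =
        -(macdonald (ν - 1) t + macdonald (ν + 1) t) := by
      rw [integral_neg, integral_congr_ae
        (Eventually.of_forall fun u => cosh_mul_macdonald_integrand ν t u),
        integral_const_mul, integral_add (hi _) (hi _)]
      simp only [macdonald]
      ring
    rw [h3] at h2
    exact h2.congr_deriv (by ring)
  · refine Eventually.of_forall fun u s hs => ?_
    rw [norm_neg, norm_mul, norm_mul, norm_macdonald_integrand, norm_macdonald_integrand]
    have : (0 : ℝ) < Real.cosh u := Real.cosh_pos u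
    have hs' : t / 2 ≤ s := le_of_lt hs
    gcongr
  · simp_rw [cosh_mul_macdonald_integrand]
    have h := fun μ : ℂ => integrable_macdonald_integrand μ (half_pos ht)
    exact (((h _).add (h _)).const_mul _).norm
  · refine Eventually.of_forall fun u s _ => ?_
    have h1 : HasDerivAt (fun s : ℝ => ((-(s * Real.cosh u) : ℝ) : ℂ) + ν * u)
        ((-(Real.cosh u) : ℝ) : ℂ) s := by
      have := (((hasDerivAt_id s).mul_const (Real.cosh u)).neg.ofReal_comp).add_const (ν * u : ℂ)
      simpa using this
    refine h1.cexp.congr_deriv ?_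
    push_cast
    ring

/-- `K_{ν+1} - K_{ν-1} = (2ν / t) K_ν`, by integration by parts. -/
theorem macdonald_recurrence (ν : ℂ) {t : ℝ} (ht : 0 < t) :
    macdonald (ν + 1) t - macdonald (ν - 1) t = 2 * ν / t * macdonald ν t := by
  have hi := fun μ : ℂ => integrable_macdonald_integrand μ ht
  have hder : ∀ u : ℝ, HasDerivAt
      (fun u : ℝ => cexp (((-(t * Real.cosh u) : ℝ) : ℂ) + ν * u))
      (ν * cexp (((-(t * Real.cosh u) : ℝ) : ℂ) + ν * u) - t * ((1 / 2) *
        (cexp (((-(t * Real.cosh u) : ℝ) : ℂ) + (ν + 1) * u) -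
        cexp (((-(t * Real.cosh u) : ℝ) : ℂ) + (ν - 1) * u)))) u := by
    intro u
    rw [← sinh_mul_macdonald_integrand]
    have h1 : HasDerivAt (fun u : ℝ => ((-(t * Real.cosh u) : ℝ) : ℂ) + ν * u)
        (((-(t * Real.sinh u) : ℝ) : ℂ) + ν * 1) u := by
      have h2 := ((Real.hasDerivAt_cosh u).const_mul t).neg.ofReal_comp
      have h3 := ((hasDerivAt_id u).ofReal_comp).const_mul ν
      exact h2.add (by simpa using h3)
    refine h1.cexp.congr_deriv ?_
    push_cast
    ring
  have hI : Integrable (fun u : ℝ => ν * cexp (((-(t * Real.cosh u) : ℝ) : ℂ) + ν * u) -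
      t * ((1 / 2) * (cexp (((-(t * Real.cosh u) : ℝ) : ℂ) + (ν + 1) * u) -
        cexp (((-(t * Real.cosh u) : ℝ) : ℂ) + (ν - 1) * u)))) :=
    ((hi ν).const_mul _).sub ((((hi _).sub (hi _)).const_mul _).const_mul _)
  have h0 := integral_eq_zero_of_hasDerivAt_of_integrable hder hI (hi ν)
  have hd : Integrable (fun u : ℝ => cexp (((-(t * Real.cosh u) : ℝ) : ℂ) + (ν + 1) * u) -
      cexp (((-(t * Real.cosh u) : ℝ) : ℂ) + (ν - 1) * u)) := (hi _).sub (hi _)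
  rw [integral_sub ((hi ν).const_mul _) ((hd.const_mul _).const_mul _),
    integral_const_mul, integral_const_mul, integral_const_mul, integral_sub (hi _) (hi _)] at h0
  have ht' : (t : ℂ) ≠ 0 := by exact_mod_cast ht.ne'
  simp only [macdonald]
  field_simp
  linear_combination (-2) * h0

theorem macdonald_neg (ν : ℂ) (t : ℝ) : macdonald (-ν) t = macdonald ν t := by
  simp only [macdonald]
  rw [← integral_neg_eq_self]
  simp

/-- For real order the Macdonald function is a positive real number. -/
theorem macdonald_ne_zero_of_real (ν : ℝ) {t : ℝ} (ht : 0 < t) : macdonald (ν : ℂ) t ≠ 0 := by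
  have h : ∀ u : ℝ, cexp (((-(t * Real.cosh u) : ℝ) : ℂ) + (ν : ℂ) * u) =
      ((Real.exp (-(t * Real.cosh u) + ν * u) : ℝ) : ℂ) := fun u => by push_cast; rfl
  simp only [macdonald, h]
  rw [integral_complex_ofReal]
  have hpos : 0 < ∫ u : ℝ, Real.exp (-(t * Real.cosh u) + ν * u) :=
    integral_exp_pos (integrable_exp_neg_mul_cosh ht ν)
  exact mul_ne_zero (by norm_num) (by exact_mod_cast hpos.ne')

/-- The Macdonald function is entire in the order. -/
theorem differentiable_macdonald {t : ℝ} (ht : 0 < t) :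
    Differentiable ℂ (fun ν => macdonald ν t) := by
  rw [← differentiableOn_univ]
  refine DifferentiableOn.const_mul (differentiableOn_integral_of_dominated
    (fun w _ => by fun_prop) (Eventually.of_forall fun u => by fun_prop) fun w₀ _ => ?_) _
  set R : ℝ := ‖w₀‖ + 1
  refine ⟨1, one_pos, subset_univ _, fun u => Real.exp (-(t * Real.cosh u) + R * u) +
    Real.exp (-(t * Real.cosh u) + (-R) * u),
    (integrable_exp_neg_mul_cosh ht _).add (integrable_exp_neg_mul_cosh ht _),
    Eventually.of_forall fun u w hw => ?_⟩
  rw [norm_macdonald_integrand]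
  have hR : |w.re| ≤ R := by
    have h1 := Complex.abs_re_le_norm w
    have h2 := norm_sub_norm_le w w₀
    have h3 : ‖w - w₀‖ ≤ 1 := by simpa [dist_eq_norm] using hw
    simp only [R]; linarith
  rcases le_total 0 u with hu | hu
  · refine le_trans (Real.exp_le_exp.2 ?_) (le_add_of_nonneg_right (Real.exp_pos _).le)
    have := mul_le_mul_of_nonneg_right (abs_le.1 hR).2 hu
    linarith
  · refine le_trans (Real.exp_le_exp.2 ?_) (le_add_of_nonneg_left (Real.exp_pos _).le)
    have := mul_le_mul_of_nonpos_right (abs_le.1 hR).1 hu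
    linarith

/-! ### Growth and limits of the Macdonald function -/

theorem integrable_exp_neg_mul_abs {c : ℝ} (hc : 0 < c) :
    Integrable (fun u : ℝ => Real.exp (-(c * |u|))) := by
  rw [← integrableOn_univ, ← Iic_union_Ioi (a := (0 : ℝ)), integrableOn_union]
  constructor
  · refine (integrableOn_exp_mul_Iic hc 0).congr_fun (fun u hu => ?_) measurableSet_Iic
    simp [abs_of_nonpos (mem_Iic.1 hu)]
  · refine (integrableOn_exp_mul_Ioi (neg_lt_zero.2 hc) 0).congr_fun (fun u hu => ?_)
      measurableSet_Ioi
    simp [abs_of_pos (mem_Ioi.1 hu)]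

theorem exp_neg_le_rpow {s x : ℝ} (hs : 0 < s) (hx : 0 < x) :
    Real.exp (-x) ≤ s ^ s * x ^ (-s) := by
  have h1 : x / s ≤ Real.exp (x / s) := by linarith [Real.add_one_le_exp (x / s)]
  have h2 : (x / s) ^ s ≤ Real.exp x := by
    refine (Real.rpow_le_rpow (by positivity) h1 hs.le).trans_eq ?_
    rw [← Real.exp_mul, div_mul_cancel₀ _ hs.ne']
  rw [Real.div_rpow hx.le hs.le, div_le_iff₀ (by positivity)] at h2
  rw [Real.exp_neg, Real.rpow_neg hx.le, inv_le_iff_one_le_mul₀ (Real.exp_pos x), ← div_eq_mul_inv,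
    div_mul_eq_mul_div, le_div_iff₀ (by positivity)]
  linarith

/-- The Macdonald function is `O (t ^ (-s))` on the whole half-line when `|Re ν| < s`, uniformly for
`|Re ν| ≤ σ < s`. The estimate is crude at infinity, where the weight `exp (-t)` of the integrals in
question compensates. -/
theorem norm_macdonald_le {σ s : ℝ} (hσ : 0 ≤ σ) (hs : σ < s) :
    ∃ C : ℝ, ∀ ν : ℂ, |ν.re| ≤ σ → ∀ t : ℝ, 0 < t → ‖macdonald ν t‖ ≤ C * t ^ (-s) := by
  have hs0 : 0 < s := hσ.trans_lt hs
  refine ⟨1 / 2 * (s ^ s * 2 ^ s * ∫ u : ℝ, Real.exp (-((s - σ) * |u|))), fun ν hν t ht => ?_⟩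
  have hpt : ∀ u : ℝ, ‖cexp (((-(t * Real.cosh u) : ℝ) : ℂ) + ν * u)‖ ≤
      (s ^ s * 2 ^ s * t ^ (-s)) * Real.exp (-((s - σ) * |u|)) := by
    intro u
    rw [norm_macdonald_integrand, Real.exp_add]
    have h1 : Real.exp |u| / 2 ≤ Real.cosh u := by
      rw [← Real.cosh_abs, Real.cosh_eq]
      linarith [Real.exp_pos (-|u|)]
    have h2 : Real.exp (-(t * Real.cosh u)) ≤ s ^ s * (t * (Real.exp |u| / 2)) ^ (-s) := by
      refine le_trans (Real.exp_le_exp.2 ?_) (exp_neg_le_rpow hs0 (by positivity))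
      exact neg_le_neg (mul_le_mul_of_nonneg_left h1 ht.le)
    have h3 : (t * (Real.exp |u| / 2)) ^ (-s) = 2 ^ s * t ^ (-s) * Real.exp (-(s * |u|)) := by
      rw [Real.mul_rpow ht.le (by positivity), Real.div_rpow (Real.exp_pos _).le (by norm_num),
        ← Real.exp_mul, Real.rpow_neg (by norm_num : (0 : ℝ) ≤ 2)]
      rw [show |u| * -s = -(s * |u|) by ring]
      field_simp
    have h4 : Real.exp (ν.re * u) ≤ Real.exp (σ * |u|) := by
      apply Real.exp_le_exp.2
      refine (le_abs_self _).trans ?_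
      rw [abs_mul]
      gcongr
    calc _ ≤ s ^ s * (2 ^ s * t ^ (-s) * Real.exp (-(s * |u|))) * Real.exp (σ * |u|) := by
          rw [← h3]; gcongr
      _ = (s ^ s * 2 ^ s * t ^ (-s)) * (Real.exp (-(s * |u|)) * Real.exp (σ * |u|)) := by ring
      _ = _ := by rw [← Real.exp_add]; ring_nf
  rw [macdonald, norm_mul]
  have h5 := norm_integral_le_of_norm_le
    ((integrable_exp_neg_mul_abs (sub_pos.2 hs)).const_mul _) (Eventually.of_forall hpt)
  rw [integral_const_mul] at h5
  calc _ ≤ ‖(1 / 2 : ℂ)‖ * _ := mul_le_mul_of_nonneg_left h5 (norm_nonneg _)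
    _ = _ := by
      rw [show ‖(1 / 2 : ℂ)‖ = 1 / 2 by norm_num]
      ring

theorem continuousOn_macdonald (ν : ℂ) : ContinuousOn (macdonald ν) (Ioi 0) := fun _ ht =>
  (hasDerivAt_macdonald ν ht).continuousAt.continuousWithinAt

/-- Euler's integral in logarithmic coordinates. -/
theorem Gamma_eq_integral_exp {ν : ℂ} (hν : 0 < ν.re) :
    Integrable (fun v : ℝ => cexp (-(Real.exp v : ℝ) + ν * v)) ∧
      ∫ v : ℝ, cexp (-(Real.exp v : ℝ) + ν * v) = Complex.Gamma ν := by
  have himg : Real.exp '' univ = Ioi 0 := by rw [image_univ, Real.range_exp]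
  have hd : ∀ x ∈ univ, HasDerivWithinAt Real.exp (Real.exp x) univ x :=
    fun x _ => (Real.hasDerivAt_exp x).hasDerivWithinAt
  have hpt : ∀ v : ℝ, |Real.exp v| • ((-Real.exp v).exp * (Real.exp v : ℂ) ^ (ν - 1)) =
      cexp (-(Real.exp v : ℝ) + ν * v) := by
    intro v
    rw [abs_of_pos (Real.exp_pos v), real_smul, ofReal_exp v, ← Complex.ofReal_exp v,
      Complex.cpow_def_of_ne_zero (by exact_mod_cast (Real.exp_pos v).ne'),
      ← Complex.ofReal_log (Real.exp_pos v).le, Real.log_exp]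
    push_cast
    rw [← Complex.exp_add, ← Complex.exp_add]
    ring_nf
  have h1 := integral_image_eq_integral_abs_deriv_smul MeasurableSet.univ hd
    Real.exp_injective.injOn (fun x : ℝ => ((-x).exp : ℂ) * (x : ℂ) ^ (ν - 1))
  have h2 := integrableOn_image_iff_integrableOn_abs_deriv_smul MeasurableSet.univ hd
    Real.exp_injective.injOn (fun x : ℝ => ((-x).exp : ℂ) * (x : ℂ) ^ (ν - 1))
  rw [himg] at h1 h2
  simp only [hpt, integrableOn_univ, setIntegral_univ] at h1 h2
  refine ⟨h2.1 (Complex.GammaIntegral_convergent hν), ?_⟩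
  rw [← h1, Complex.Gamma_eq_integral hν, Complex.GammaIntegral]

/-- The leading behaviour of the Macdonald function at the origin. -/
theorem tendsto_cpow_mul_macdonald {ν : ℂ} (hν : 0 < ν.re) :
    Tendsto (fun t : ℝ => (t : ℂ) ^ ν * macdonald ν t) (𝓝[>] 0)
      (𝓝 ((1 / 2) * (2 : ℂ) ^ ν * Complex.Gamma ν)) := by
  obtain ⟨hGi, hG⟩ := Gamma_eq_integral_exp hν
  -- translating the variable by `log (2 / t)` makes the integrand converge
  have hshift : ∀ t : ℝ, 0 < t → (t : ℂ) ^ ν * macdonald ν t = (1 / 2) * (2 : ℂ) ^ ν *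
      ∫ v : ℝ, cexp (((-(Real.exp v + t ^ 2 / 4 * Real.exp (-v)) : ℝ) : ℂ) + ν * v) := by
    intro t ht
    have htc : (t : ℂ) ≠ 0 := by exact_mod_cast ht.ne'
    have hpow : (2 : ℂ) ^ ν = (t : ℂ) ^ ν * cexp (ν * (Real.log (2 / t) : ℝ)) := by
      rw [Real.log_div (by norm_num) ht.ne', Complex.cpow_def_of_ne_zero htc,
        Complex.cpow_def_of_ne_zero two_ne_zero, ← Complex.exp_add, ← Complex.ofReal_log ht.le,
        show (2 : ℂ) = ((2 : ℝ) : ℂ) by norm_num, ← Complex.ofReal_log (by norm_num)]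
      push_cast
      ring_nf
    rw [macdonald, ← integral_add_right_eq_self _ (Real.log (2 / t)), hpow]
    have : ∀ v : ℝ, cexp (((-(t * Real.cosh (v + Real.log (2 / t))) : ℝ) : ℂ) +
        ν * ((v + Real.log (2 / t) : ℝ) : ℂ)) = cexp (ν * (Real.log (2 / t) : ℝ)) *
        cexp (((-(Real.exp v + t ^ 2 / 4 * Real.exp (-v)) : ℝ) : ℂ) + ν * v) := by
      intro v
      have h1 : t * Real.cosh (v + Real.log (2 / t)) =
          Real.exp v + t ^ 2 / 4 * Real.exp (-v) := by
        rw [Real.cosh_eq, neg_add, Real.exp_add, Real.exp_add, Real.exp_neg (Real.log _),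
          Real.exp_log (by positivity)]
        field_simp
        ring
      rw [h1, ← Complex.exp_add]
      push_cast
      ring_nf
    simp only [this, integral_const_mul]
    ring
  have hlim : Tendsto (fun t : ℝ =>
      ∫ v : ℝ, cexp (((-(Real.exp v + t ^ 2 / 4 * Real.exp (-v)) : ℝ) : ℂ) + ν * v)) (𝓝[>] 0)
      (𝓝 (∫ v : ℝ, cexp (-(Real.exp v : ℝ) + ν * v))) := by
    refine tendsto_integral_filter_of_dominated_convergence
      (fun v => ‖cexp (-(Real.exp v : ℝ) + ν * v)‖) (Eventually.of_forall fun t => by fun_prop)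
      (Eventually.of_forall fun t => Eventually.of_forall fun v => ?_) hGi.norm
      (Eventually.of_forall fun v => ?_)
    · rw [Complex.norm_exp, Complex.norm_exp]
      apply Real.exp_le_exp.2
      simp only [add_re, ofReal_re, neg_re]
      have : 0 ≤ t ^ 2 / 4 * Real.exp (-v) := by positivity
      linarith
    · have hc : Continuous (fun t : ℝ =>
          cexp (((-(Real.exp v + t ^ 2 / 4 * Real.exp (-v)) : ℝ) : ℂ) + ν * v)) := by fun_prop
      have := (hc.tendsto 0).mono_left (nhdsWithin_le_nhds (s := Ioi 0))
      simpa using this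
  rw [hG] at hlim
  refine (hlim.const_mul ((1 / 2) * (2 : ℂ) ^ ν)).congr' ?_
  filter_upwards [self_mem_nhdsWithin] with t ht using (hshift t ht).symm

/-- Laplace's method: the leading behaviour of the Macdonald function at infinity. -/
theorem tendsto_sqrt_mul_exp_mul_macdonald (ν : ℂ) :
    Tendsto (fun t : ℝ => ((Real.sqrt t * Real.exp t : ℝ) : ℂ) * macdonald ν t) atTop
      (𝓝 (Real.sqrt (Real.pi / 2) : ℂ)) := by
  -- with `u = v / √t` the exponent becomes `-2 (√t sinh (v / (2 √t)))²`
  have hscale : ∀ t : ℝ, 0 < t → ((Real.sqrt t * Real.exp t : ℝ) : ℂ) * macdonald ν t =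
      (1 / 2) * ∫ v : ℝ, cexp (((-(2 * (Real.sqrt t * Real.sinh ((Real.sqrt t)⁻¹ * (v / 2))) ^ 2) :
        ℝ) : ℂ) + ν * (((Real.sqrt t)⁻¹ * v : ℝ) : ℂ)) := by
    intro t ht
    have hst : 0 < Real.sqrt t := Real.sqrt_pos.2 ht
    have h1 := Measure.integral_comp_mul_left
      (fun u : ℝ => cexp (((-(t * Real.cosh u) : ℝ) : ℂ) + ν * u)) (Real.sqrt t)⁻¹
    rw [inv_inv, abs_of_pos hst] at h1
    have h2 : ∀ v : ℝ, cexp (((-(2 * (Real.sqrt t * Real.sinh ((Real.sqrt t)⁻¹ * (v / 2))) ^ 2) :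
        ℝ) : ℂ) + ν * (((Real.sqrt t)⁻¹ * v : ℝ) : ℂ)) = (Real.exp t : ℝ) *
        cexp (((-(t * Real.cosh ((Real.sqrt t)⁻¹ * v)) : ℝ) : ℂ) +
          ν * (((Real.sqrt t)⁻¹ * v : ℝ) : ℂ)) := by
      intro v
      have h3 := Real.cosh_two_mul ((Real.sqrt t)⁻¹ * (v / 2))
      rw [Real.cosh_sq, show 2 * ((Real.sqrt t)⁻¹ * (v / 2)) = (Real.sqrt t)⁻¹ * v by ring] at h3
      rw [h3, ofReal_exp, ← Complex.exp_add, mul_pow, Real.sq_sqrt ht.le]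
      push_cast
      ring_nf
    simp only [h2, integral_const_mul, h1, macdonald, real_smul]
    push_cast
    ring
  have hint : ∀ c : ℝ, Integrable (fun v : ℝ => Real.exp (-(v ^ 2 / 2) + c * v)) := by
    intro c
    have h := (integrable_cexp_quadratic (b := (1 / 2 : ℝ)) (by norm_num) (c : ℂ) 0).norm
    refine h.congr (Eventually.of_forall fun v => ?_)
    simp only [Complex.norm_exp]
    congr 1
    have : (-((1 / 2 : ℝ) : ℂ) * (v : ℂ) ^ 2 + (c : ℂ) * v + 0) =
      ((-(v ^ 2 / 2) + c * v : ℝ) : ℂ) := by push_cast; ring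
    rw [this, ofReal_re]
  have hlim : Tendsto (fun t : ℝ => ∫ v : ℝ,
      cexp (((-(2 * (Real.sqrt t * Real.sinh ((Real.sqrt t)⁻¹ * (v / 2))) ^ 2) :
        ℝ) : ℂ) + ν * (((Real.sqrt t)⁻¹ * v : ℝ) : ℂ))) atTop
      (𝓝 (∫ v : ℝ, cexp (((-(1 / 2) * v ^ 2 : ℝ) : ℂ)))) := by
    refine tendsto_integral_filter_of_dominated_convergence
      (fun v => Real.exp (-(v ^ 2 / 2) + |ν.re| * v) + Real.exp (-(v ^ 2 / 2) + -|ν.re| * v))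
      (Eventually.of_forall fun t => by fun_prop) ?_ ((hint _).add (hint _))
      (Eventually.of_forall fun v => ?_)
    · filter_upwards [eventually_ge_atTop 1] with t ht
      refine Eventually.of_forall fun v => ?_
      have hst : 1 ≤ Real.sqrt t := Real.one_le_sqrt.2 ht
      have hst0 : 0 < Real.sqrt t := by linarith
      have h1 : (v / 2) ^ 2 ≤ (Real.sqrt t * Real.sinh ((Real.sqrt t)⁻¹ * (v / 2))) ^ 2 := by
        rw [← sq_abs, ← sq_abs (_ * _), abs_mul, Real.abs_sinh, abs_of_pos hst0]
        have := Real.self_le_sinh_iff.2 (abs_nonneg ((Real.sqrt t)⁻¹ * (v / 2)))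
        have h2 := mul_le_mul_of_nonneg_left this hst0.le
        rw [abs_mul, abs_of_pos (inv_pos.2 hst0), ← mul_assoc, mul_inv_cancel₀ hst0.ne',
          one_mul] at h2
        rw [abs_mul, abs_of_pos (inv_pos.2 hst0)]
        gcongr
      have h3 : |ν.re * ((Real.sqrt t)⁻¹ * v)| ≤ |ν.re| * |v| := by
        rw [abs_mul, abs_mul, abs_of_pos (inv_pos.2 hst0)]
        have : (Real.sqrt t)⁻¹ ≤ 1 := inv_le_one_of_one_le₀ hst
        gcongr
        nlinarith [abs_nonneg v]
      have h4 := (le_abs_self _).trans h3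
      rw [Complex.norm_exp, add_re, ofReal_re, re_mul_ofReal]
      rcases abs_cases v with ⟨hv, _⟩ | ⟨hv, _⟩
      · rw [hv] at h4
        refine le_trans (Real.exp_le_exp.2 ?_) (le_add_of_nonneg_right (Real.exp_pos _).le)
        linarith
      · rw [hv] at h4
        refine le_trans (Real.exp_le_exp.2 ?_) (le_add_of_nonneg_left (Real.exp_pos _).le)
        linarith
    · have hinv : Tendsto (fun t : ℝ => (Real.sqrt t)⁻¹) atTop (𝓝[≠] 0) := by
        refine tendsto_nhdsWithin_iff.2 ⟨tendsto_inv_atTop_zero.comp Real.tendsto_sqrt_atTop, ?_⟩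
        filter_upwards [eventually_gt_atTop 0] with t ht
        exact (inv_pos.2 (Real.sqrt_pos.2 ht)).ne'
      have hder : HasDerivAt (fun x : ℝ => Real.sinh (x * (v / 2))) (v / 2) 0 := by
        have := ((hasDerivAt_id (0 : ℝ)).mul_const (v / 2)).sinh
        simpa using this
      have hs := (hasDerivAt_iff_tendsto_slope.1 hder).comp hinv
      have hs' : Tendsto (fun t : ℝ => Real.sqrt t * Real.sinh ((Real.sqrt t)⁻¹ * (v / 2))) atTop
          (𝓝 (v / 2)) := by
        refine hs.congr fun t => ?_
        simp [slope_def_field, mul_comm, div_eq_mul_inv]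
      have h0 : Tendsto (fun t : ℝ => (Real.sqrt t)⁻¹ * v) atTop (𝓝 0) := by
        simpa using (hinv.mono_right nhdsWithin_le_nhds).mul_const v
      have h5 := (continuous_ofReal.tendsto _).comp (((hs'.pow 2).const_mul 2).neg)
      have h6 := ((continuous_ofReal.tendsto _).comp h0).const_mul ν
      have h7 := (Complex.continuous_exp.tendsto _).comp (h5.add h6)
      have e : ((-(2 * (v / 2) ^ 2) : ℝ) : ℂ) + ν * ((0 : ℝ) : ℂ) =
          ((-(1 / 2) * v ^ 2 : ℝ) : ℂ) := by
        push_cast; ring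
      rw [e] at h7
      exact h7
  have hg : (1 / 2 : ℂ) * ∫ v : ℝ, cexp (((-(1 / 2) * v ^ 2 : ℝ) : ℂ)) =
      (Real.sqrt (Real.pi / 2) : ℂ) := by
    have h1 : ∀ v : ℝ, cexp (((-(1 / 2) * v ^ 2 : ℝ) : ℂ)) =
      ((Real.exp (-(1 / 2) * v ^ 2) : ℝ) : ℂ) := fun v => (ofReal_exp _).symm
    simp only [h1]
    rw [integral_complex_ofReal, integral_gaussian]
    have : Real.sqrt (Real.pi / (1 / 2)) = 2 * Real.sqrt (Real.pi / 2) := by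
      rw [show Real.pi / (1 / 2) = 2 ^ 2 * (Real.pi / 2) by ring,
        Real.sqrt_mul (by norm_num), Real.sqrt_sq (by norm_num)]
    rw [this]
    push_cast
    ring
  rw [← hg]
  refine (hlim.const_mul (1 / 2 : ℂ)).congr' ?_
  filter_upwards [eventually_gt_atTop 0] with t ht using (hscale t ht).symm

/-! ### The zeroth moment of the Stieltjes density -/

/-- A single integrable function dominates `t ^ r e^{-t} K_ν(t)` for all orders in a vertical strip
`|Re ν| ≤ σ < r + 1`. -/
theorem exists_bound_rpow_exp_macdonald {σ r : ℝ} (hσ : 0 ≤ σ) (hr : σ < r + 1) :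
    ∃ B : ℝ → ℝ, IntegrableOn B (Ioi 0) ∧ ∀ ν : ℂ, |ν.re| ≤ σ → ∀ t : ℝ, 0 < t →
      ‖((t ^ r * Real.exp (-t) : ℝ) : ℂ) * macdonald ν t‖ ≤ B t := by
  obtain ⟨s, hs1, hs2⟩ := exists_between hr
  obtain ⟨C, hC⟩ := norm_macdonald_le hσ hs1
  refine ⟨fun t => C * (Real.exp (-t) * t ^ ((r + 1 - s) - 1)),
    (Real.GammaIntegral_convergent (by linarith)).const_mul C, fun ν hν t ht => ?_⟩
  rw [norm_mul, norm_real, Real.norm_eq_abs, abs_of_nonneg (by positivity)]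
  calc _ ≤ t ^ r * Real.exp (-t) * (C * t ^ (-s)) := by gcongr; exact hC ν hν t ht
    _ = C * (Real.exp (-t) * (t ^ r * t ^ (-s))) := by ring
    _ = _ := by rw [← Real.rpow_add ht]; ring_nf

theorem continuousOn_rpow_exp_macdonald (r : ℝ) (ν : ℂ) :
    ContinuousOn (fun t : ℝ => ((t ^ r * Real.exp (-t) : ℝ) : ℂ) * macdonald ν t) (Ioi 0) := by
  refine ContinuousOn.mul (continuous_ofReal.comp_continuousOn (ContinuousOn.mul
    (fun t ht => (Real.continuousAt_rpow_const t r (Or.inl (ne_of_gt ht))).continuousWithinAt)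
    (by fun_prop))) (continuousOn_macdonald ν)

theorem integrableOn_rpow_exp_macdonald {r : ℝ} {ν : ℂ} (hν : |ν.re| < r + 1) :
    IntegrableOn (fun t : ℝ => ((t ^ r * Real.exp (-t) : ℝ) : ℂ) * macdonald ν t) (Ioi 0) := by
  obtain ⟨B, hB, hle⟩ := exists_bound_rpow_exp_macdonald (abs_nonneg _) hν
  refine hB.mono' ((continuousOn_rpow_exp_macdonald r ν).aestronglyMeasurable measurableSet_Ioi) ?_
  filter_upwards [ae_restrict_mem measurableSet_Ioi] with t ht using hle ν le_rfl t ht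

/-- Euler's reflection formula as an integral over the real line, by way of the beta integral and
the logistic substitution `x = 1 / (1 + e^{-u})`. -/
theorem integral_exp_mul_div_one_add_exp {a : ℂ} (h0 : 0 < a.re) (h1 : a.re < 1) :
    Integrable (fun u : ℝ => cexp (a * u) / (1 + cexp u)) ∧
      ∫ u : ℝ, cexp (a * u) / (1 + cexp u) = Real.pi / Complex.sin (Real.pi * a) := by
  have hb : 0 < (1 - a).re := by simp; linarith
  have himg : Real.sigmoid '' univ = Ioo 0 1 := by rw [image_univ, Real.range_sigmoid]
  have hd : ∀ x ∈ univ, HasDerivWithinAt Real.sigmoid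
      (Real.sigmoid x * (1 - Real.sigmoid x)) univ x :=
    fun x _ => (Real.hasDerivAt_sigmoid x).hasDerivWithinAt
  have hpt : ∀ u : ℝ, |Real.sigmoid u * (1 - Real.sigmoid u)| •
      (((Real.sigmoid u : ℝ) : ℂ) ^ (a - 1) * (1 - (Real.sigmoid u : ℝ) : ℂ) ^ ((1 - a) - 1)) =
      cexp (a * u) / (1 + cexp u) := by
    intro u
    have hx : 0 < Real.sigmoid u := Real.sigmoid_pos u
    have hy : 0 < 1 - Real.sigmoid u := sub_pos.2 (Real.sigmoid_lt_one u)
    have hyc : (1 - (Real.sigmoid u : ℝ) : ℂ) = ((1 - Real.sigmoid u : ℝ) : ℂ) := by push_cast; rfl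
    have hratio : Real.sigmoid u = Real.exp u * (1 - Real.sigmoid u) := by
      rw [Real.sigmoid_def, Real.exp_neg]
      have := Real.exp_pos u
      field_simp
      ring
    have hy' : 1 - Real.sigmoid u = 1 / (1 + Real.exp u) := by
      rw [eq_div_iff (by positivity)]
      linarith
    rw [abs_of_pos (mul_pos hx hy), hyc, real_smul,
      Complex.cpow_def_of_ne_zero (by exact_mod_cast hx.ne'),
      Complex.cpow_def_of_ne_zero (by exact_mod_cast hy.ne'),
      ← Complex.ofReal_log hx.le, ← Complex.ofReal_log hy.le]
    have hlog : Real.log (Real.sigmoid u) = u + Real.log (1 - Real.sigmoid u) := by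
      conv_lhs => rw [hratio]
      rw [Real.log_mul (Real.exp_pos u).ne' hy.ne', Real.log_exp]
    have hX : ((Real.sigmoid u : ℝ) : ℂ) = cexp (u + (Real.log (1 - Real.sigmoid u) : ℝ)) := by
      rw [← ofReal_add, ← hlog, ← ofReal_exp, Real.exp_log hx]
    have hY : ((1 - Real.sigmoid u : ℝ) : ℂ) = cexp ((Real.log (1 - Real.sigmoid u) : ℝ)) := by
      rw [← ofReal_exp, Real.exp_log hy]
    rw [ofReal_mul, hX, hlog]
    have hfin : cexp (a * u) / (1 + cexp u) = cexp (a * u) * ((1 - Real.sigmoid u : ℝ) : ℂ) := by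
      rw [hy']; push_cast; ring
    rw [hfin, hY]
    push_cast
    rw [← Complex.exp_add, ← Complex.exp_add, ← Complex.exp_add, ← Complex.exp_add]
    ring_nf
  have e1 := integral_image_eq_integral_abs_deriv_smul MeasurableSet.univ hd
    Real.sigmoid_injective.injOn
    (fun x : ℝ => (x : ℂ) ^ (a - 1) * (1 - (x : ℂ)) ^ ((1 - a) - 1))
  have e2 := integrableOn_image_iff_integrableOn_abs_deriv_smul MeasurableSet.univ hd
    Real.sigmoid_injective.injOn
    (fun x : ℝ => (x : ℂ) ^ (a - 1) * (1 - (x : ℂ)) ^ ((1 - a) - 1))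
  rw [himg] at e1 e2
  simp only [hpt, integrableOn_univ, setIntegral_univ] at e1 e2
  have hconv := Complex.betaIntegral_convergent h0 hb
  rw [intervalIntegrable_iff_integrableOn_Ioo_of_le zero_le_one] at hconv
  refine ⟨e2.1 hconv, ?_⟩
  have hbeta := Complex.Gamma_mul_Gamma_eq_betaIntegral h0 hb
  rw [add_sub_cancel, Complex.Gamma_one, one_mul, Complex.Gamma_mul_Gamma_one_sub,
    Complex.betaIntegral, intervalIntegral.integral_of_le zero_le_one,
    integral_Ioc_eq_integral_Ioo] at hbeta
  rw [← e1, hbeta]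

/-- The zeroth moment of `t^{-1/2} e^{-t} K_ν(t)`. -/
theorem integral_rpow_neg_half_exp_macdonald {ν : ℂ} (hν : |ν.re| < 1 / 2) :
    ∫ t in Ioi (0 : ℝ), ((t ^ (-(1 / 2) : ℝ) * Real.exp (-t) : ℝ) : ℂ) * macdonald ν t =
      (Real.sqrt (Real.pi / 2) : ℂ) * (Real.pi / Complex.cos (Real.pi * ν)) := by
  set F : ℝ × ℝ → ℂ := fun p => ((p.1 ^ (-(1 / 2) : ℝ) * Real.exp (-p.1) : ℝ) : ℂ) *
    cexp (((-(p.1 * Real.cosh p.2) : ℝ) : ℂ) + ν * p.2) with hF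
  have hFeq : ∀ u t : ℝ, F (t, u) =
      ((t ^ ((1 / 2 : ℝ) - 1) * Real.exp (-((1 + Real.cosh u) * t)) : ℝ) : ℂ) * cexp (ν * u) := by
    intro u t
    simp only [hF]
    rw [Complex.exp_add, ← ofReal_exp, ← mul_assoc, ← ofReal_mul, mul_assoc (t ^ _),
      ← Real.exp_add]
    norm_num
    ring_nf
    tauto
  have hcosh : ∀ u : ℝ, 0 < 1 + Real.cosh u := fun u => by linarith [Real.cosh_pos u]
  have hcosh2 : ∀ u : ℝ, (1 / (1 + Real.cosh u)) ^ (1 / 2 : ℝ) =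
      (Real.sqrt 2)⁻¹ * (Real.cosh (u / 2))⁻¹ := by
    intro u
    have h := Real.cosh_sq' (u / 2)
    have h2 := Real.cosh_two_mul (u / 2)
    rw [mul_div_cancel₀ u two_ne_zero] at h2
    have : 1 + Real.cosh u = 2 * Real.cosh (u / 2) ^ 2 := by linarith
    rw [← Real.sqrt_eq_rpow, this, one_div, Real.sqrt_inv, Real.sqrt_mul (by norm_num),
      Real.sqrt_sq (Real.cosh_pos _).le, mul_inv]
  have hreal : ∀ u : ℝ, ∫ t in Ioi (0 : ℝ),
      t ^ ((1 / 2 : ℝ) - 1) * Real.exp (-((1 + Real.cosh u) * t)) =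
      Real.sqrt (Real.pi / 2) * (Real.cosh (u / 2))⁻¹ := by
    intro u
    rw [Real.integral_rpow_mul_exp_neg_mul_Ioi (by norm_num) (hcosh u), hcosh2,
      Real.Gamma_one_half_eq, Real.sqrt_div Real.pi_pos.le]
    ring
  have hinnerI : ∀ u : ℝ, IntegrableOn
      (fun t : ℝ => t ^ ((1 / 2 : ℝ) - 1) * Real.exp (-((1 + Real.cosh u) * t))) (Ioi 0) := by
    intro u
    by_contra hcon
    have h1 := hreal u
    rw [integral_undef hcon] at h1
    have h2 : 0 < Real.sqrt (Real.pi / 2) * (Real.cosh (u / 2))⁻¹ := by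
      have := Real.cosh_pos (u / 2)
      have := Real.pi_pos
      positivity
    linarith
  -- `1 / cosh (u / 2)` against an exponential is the integrand of the reflection formula
  have hout : ∀ μ : ℂ, ∀ u : ℝ, (((Real.cosh (u / 2))⁻¹ : ℝ) : ℂ) * cexp (μ * u) =
      2 * (cexp ((μ + 1 / 2) * u) / (1 + cexp u)) := by
    intro μ u
    have h1 : (1 + cexp u) = 2 * Real.cosh (u / 2) * cexp (u / 2) := by
      rw [ofReal_cosh, Complex.cosh]
      push_cast
      rw [mul_div_cancel₀ _ two_ne_zero, add_mul, ← Complex.exp_add, ← Complex.exp_add]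
      simp [add_comm]
    have h2 : cexp ((μ + 1 / 2) * u) = cexp (μ * u) * cexp (u / 2) := by
      rw [← Complex.exp_add]; ring_nf
    have h3 : ((Real.cosh (u / 2) : ℝ) : ℂ) ≠ 0 := by exact_mod_cast (Real.cosh_pos _).ne'
    have h4 := Complex.exp_ne_zero ((u : ℂ) / 2)
    rw [h1, h2, ofReal_inv]
    field_simp
  have hbd := abs_lt.1 hν
  have hmem : 0 < (ν + 1 / 2).re ∧ (ν + 1 / 2).re < 1 := by
    have : (ν + 1 / 2).re = ν.re + 1 / 2 := by
      rw [add_re, show (1 / 2 : ℂ) = ((1 / 2 : ℝ) : ℂ) by push_cast; rfl, ofReal_re]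
    rw [this]; constructor <;> linarith
  obtain ⟨hI1, hI2⟩ := integral_exp_mul_div_one_add_exp hmem.1 hmem.2
  have hFint : Integrable F ((volume.restrict (Ioi 0)).prod volume) := by
    have hm : AEStronglyMeasurable F ((volume.restrict (Ioi 0)).prod volume) := by
      apply Measurable.aestronglyMeasurable
      fun_prop
    rw [integrable_prod_iff' hm]
    refine ⟨Eventually.of_forall fun u => ?_, ?_⟩
    · simp only [hFeq]
      exact (hinnerI u).ofReal.mul_const _
    · have h1 : ∀ u : ℝ, ∫ t in Ioi (0 : ℝ), ‖F (t, u)‖ =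
          Real.sqrt (Real.pi / 2) * ‖(((Real.cosh (u / 2))⁻¹ : ℝ) : ℂ) * cexp (ν * u)‖ := by
        intro u
        have h2 : ∀ t ∈ Ioi (0 : ℝ), ‖F (t, u)‖ =
            t ^ ((1 / 2 : ℝ) - 1) * Real.exp (-((1 + Real.cosh u) * t)) * ‖cexp (ν * u)‖ := by
          intro t ht
          have ht' : (0 : ℝ) < t := ht
          rw [hFeq, norm_mul, norm_real, Real.norm_eq_abs, abs_of_nonneg (by positivity)]
        rw [setIntegral_congr_fun measurableSet_Ioi h2, integral_mul_const, hreal, norm_mul,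
          norm_real, Real.norm_eq_abs, abs_of_pos (inv_pos.2 (Real.cosh_pos _))]
        ring
      simp only [h1, hout]
      exact ((hI1.const_mul 2).norm).const_mul _
  have hswap := integral_integral_swap (f := fun t u => F (t, u)) hFint
  have hleft : ∫ t in Ioi (0 : ℝ), ((t ^ (-(1 / 2) : ℝ) * Real.exp (-t) : ℝ) : ℂ) *
      macdonald ν t = (1 / 2) * ∫ t in Ioi (0 : ℝ), ∫ u : ℝ, F (t, u) := by
    rw [← integral_const_mul]
    congr 1
    ext t
    simp only [hF, integral_const_mul, macdonald]
    ring
  have hright : ∀ u : ℝ, ∫ t in Ioi (0 : ℝ), F (t, u) =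
      (Real.sqrt (Real.pi / 2) : ℂ) * (2 * (cexp ((ν + 1 / 2) * u) / (1 + cexp u))) := by
    intro u
    simp only [hFeq]
    rw [integral_mul_const, integral_complex_ofReal, hreal, ← hout]
    push_cast
    ring
  rw [hleft, hswap]
  simp only [hright, integral_const_mul, hI2]
  have : Complex.sin (Real.pi * (ν + 1 / 2)) = Complex.cos (Real.pi * ν) := by
    rw [← Complex.sin_add_pi_div_two]; ring_nf
  rw [this]
  ring

/-! ### The Bessel series -/

/-- The entire series `∑ xᵏ / (k! Γ(ν + k + 1))`, which is `(z / 2) ^ (-ν) I_ν(z)` at `x = z² / 4`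
and `(z / 2) ^ (-ν) J_ν(z)` at `x = -z² / 4`. -/
noncomputable def besselSeries (ν x : ℂ) : ℂ :=
  ∑' k : ℕ, x ^ k * (Complex.Gamma (ν + (k : ℂ) + 1))⁻¹ / (k.factorial : ℂ)

theorem besselI_eq_besselSeries (ν z : ℂ) :
    besselI ν z = (z / 2) ^ ν * besselSeries ν (z ^ 2 / 4) := rfl

theorem besselJ_eq_besselSeries (ν z : ℂ) :
    besselJ ν z = (z / 2) ^ ν * besselSeries ν (-(z ^ 2 / 4)) := rfl

/-- `1 / Γ(ν + k + 1)` is bounded uniformly in `k` and in `ν` from a disc: from some `k` on each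
further factor `1 / (ν + k + 1)` has modulus at most one. -/
theorem exists_bound_inv_Gamma (R : ℝ) :
    ∃ C : ℝ, ∀ ν : ℂ, ‖ν‖ ≤ R → ∀ k : ℕ, ‖(Complex.Gamma (ν + (k : ℂ) + 1))⁻¹‖ ≤ C := by
  obtain ⟨m, hm⟩ := exists_nat_ge R
  have hbdd : ∀ k : ℕ, ∃ C : ℝ, ∀ ν ∈ Metric.closedBall (0 : ℂ) R,
      ‖(Complex.Gamma (ν + (k : ℂ) + 1))⁻¹‖ ≤ C := fun k => by
    refine (isCompact_closedBall (0 : ℂ) R).exists_bound_of_continuousOn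
      (Continuous.continuousOn ?_)
    exact Complex.differentiable_one_div_Gamma.continuous.comp
      (by fun_prop : Continuous fun ν : ℂ => ν + (k : ℂ) + 1)
  choose C hC using hbdd
  have hC' : ∀ ν : ℂ, ‖ν‖ ≤ R → ∀ k : ℕ, ‖(Complex.Gamma (ν + (k : ℂ) + 1))⁻¹‖ ≤ C k :=
    fun ν hν k => hC k ν (by simpa using hν)
  refine ⟨∑ k ∈ Finset.range (m + 1), |C k|, fun ν hν k => ?_⟩
  have hlow : ∀ k ≤ m, ‖(Complex.Gamma (ν + (k : ℂ) + 1))⁻¹‖ ≤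
      ∑ k ∈ Finset.range (m + 1), |C k| := fun k hk =>
    ((hC' ν hν k).trans (le_abs_self _)).trans
      (Finset.single_le_sum (f := fun k => |C k|) (fun _ _ => abs_nonneg _)
        (Finset.mem_range.2 (by omega)))
  rcases le_total k m with hk | hk
  · exact hlow k hk
  · induction k, hk using Nat.le_induction with
    | base => exact hlow m le_rfl
    | succ k hk ih =>
      have hre : 1 ≤ ‖ν + (k : ℂ) + 1‖ := by
        have h1 : -R ≤ ν.re := (abs_le.1 ((Complex.abs_re_le_norm ν).trans hν)).1
        have h2 : (m : ℝ) ≤ k := by exact_mod_cast hk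
        have h3 := Complex.re_le_norm (ν + (k : ℂ) + 1)
        simp only [add_re, natCast_re, one_re] at h3
        linarith
      have hne : ν + (k : ℂ) + 1 ≠ 0 := fun h => by rw [h] at hre; norm_num at hre
      have hG : Complex.Gamma (ν + ((k + 1 : ℕ) : ℂ) + 1) =
          (ν + (k : ℂ) + 1) * Complex.Gamma (ν + (k : ℂ) + 1) := by
        rw [← Complex.Gamma_add_one _ hne]; push_cast; ring_nf
      rw [hG, mul_inv, norm_mul, norm_inv]
      exact (mul_le_of_le_one_left (norm_nonneg _) (inv_le_one_of_one_le₀ hre)).trans ih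

theorem exists_summable_besselSeries_bound (R r : ℝ) :
    ∃ b : ℕ → ℝ, Summable b ∧ ∀ ν x : ℂ, ‖ν‖ ≤ R → ‖x‖ ≤ r → ∀ k : ℕ,
      ‖x ^ k * (Complex.Gamma (ν + (k : ℂ) + 1))⁻¹ / (k.factorial : ℂ)‖ ≤ b k := by
  obtain ⟨C, hC⟩ := exists_bound_inv_Gamma R
  refine ⟨fun k => r ^ k / (k.factorial : ℝ) * C, (Real.summable_pow_div_factorial r).mul_right C,
    fun ν x hν hx k => ?_⟩
  rw [norm_div, norm_mul, norm_pow, Complex.norm_natCast, mul_div_right_comm]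
  have hr : 0 ≤ r := (norm_nonneg x).trans hx
  exact mul_le_mul (by gcongr) (hC ν hν k) (norm_nonneg _) (by positivity)

theorem summable_besselSeries (ν x : ℂ) :
    Summable fun k : ℕ => x ^ k * (Complex.Gamma (ν + (k : ℂ) + 1))⁻¹ / (k.factorial : ℂ) := by
  obtain ⟨b, hb, hle⟩ := exists_summable_besselSeries_bound ‖ν‖ ‖x‖
  exact Summable.of_norm_bounded hb (hle ν x le_rfl le_rfl)

theorem differentiable_besselSeries_order (x : ℂ) :
    Differentiable ℂ (fun ν => besselSeries ν x) := by
  intro ν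
  obtain ⟨b, hb, hle⟩ := exists_summable_besselSeries_bound (‖ν‖ + 1) ‖x‖
  have h := differentiableOn_tsum_of_summable_norm (U := Metric.ball (0 : ℂ) (‖ν‖ + 1))
    (F := fun (k : ℕ) (ν : ℂ) =>
      x ^ k * (Complex.Gamma (ν + (k : ℂ) + 1))⁻¹ / (k.factorial : ℂ)) hb
    (fun k => Differentiable.differentiableOn (((Complex.differentiable_one_div_Gamma.comp
      (by fun_prop : Differentiable ℂ fun ν : ℂ => ν + (k : ℂ) + 1)).const_mul _).div_const _))
    Metric.isOpen_ball (fun k w hw => hle w x (mem_ball_zero_iff.1 hw).le le_rfl k)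
  exact h.differentiableAt (Metric.isOpen_ball.mem_nhds (by simp))

theorem hasDerivAt_besselSeries (ν x : ℂ) :
    HasDerivAt (besselSeries ν) (besselSeries (ν + 1) x) x := by
  obtain ⟨b, hb, hle⟩ := exists_summable_besselSeries_bound ‖ν‖ (‖x‖ + 1)
  have hd : ∀ k : ℕ, DifferentiableOn ℂ (fun x : ℂ =>
      x ^ k * (Complex.Gamma (ν + (k : ℂ) + 1))⁻¹ / (k.factorial : ℂ))
      (Metric.ball (0 : ℂ) (‖x‖ + 1)) := fun k => by fun_prop
  have hbd : ∀ (k : ℕ) (w : ℂ), w ∈ Metric.ball (0 : ℂ) (‖x‖ + 1) →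
      ‖w ^ k * (Complex.Gamma (ν + (k : ℂ) + 1))⁻¹ / (k.factorial : ℂ)‖ ≤ b k :=
    fun k w hw => hle ν w le_rfl (mem_ball_zero_iff.1 hw).le k
  have hx : x ∈ Metric.ball (0 : ℂ) (‖x‖ + 1) := by simp
  have h1 := (differentiableOn_tsum_of_summable_norm hb hd Metric.isOpen_ball hbd).differentiableAt
    (Metric.isOpen_ball.mem_nhds hx)
  have h2 := hasSum_deriv_of_summable_norm hb hd Metric.isOpen_ball hbd hx
  refine h1.hasDerivAt.congr_deriv ?_
  have h3 : ∀ k : ℕ, deriv (fun x : ℂ =>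
      x ^ k * (Complex.Gamma (ν + (k : ℂ) + 1))⁻¹ / (k.factorial : ℂ)) x =
      (k * x ^ (k - 1)) * (Complex.Gamma (ν + (k : ℂ) + 1))⁻¹ / (k.factorial : ℂ) := fun k =>
    (((hasDerivAt_pow k x).mul_const _).div_const _).deriv
  simp only [h3] at h2
  rw [← h2.tsum_eq, h2.summable.tsum_eq_zero_add, besselSeries]
  simp only [Nat.cast_zero, zero_mul, zero_div, zero_add]
  refine tsum_congr fun k => ?_
  have hk : ((k : ℂ) + 1) ≠ 0 := by exact_mod_cast Nat.succ_ne_zero k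
  have hf : (k.factorial : ℂ) ≠ 0 := by exact_mod_cast k.factorial_ne_zero
  have e : ν + 1 + (k : ℂ) + 1 = ν + (k + 1) + 1 := by ring
  rw [Nat.factorial_succ, Nat.add_sub_cancel, e]
  push_cast
  field_simp

/-- The contiguity relation of the series, from `1 / Γ(s) = s / Γ(s + 1)`. -/
theorem besselSeries_eq (ν x : ℂ) :
    besselSeries ν x = (ν + 1) * besselSeries (ν + 1) x + x * besselSeries (ν + 2) x := by
  have h1 := (summable_besselSeries (ν + 1) x).mul_left (ν + 1)
  have h2 := (summable_besselSeries (ν + 2) x).mul_left x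
  have h3 : ∀ k : ℕ, x * (x ^ k * (Complex.Gamma (ν + 2 + (k : ℂ) + 1))⁻¹ / (k.factorial : ℂ)) =
      ((k + 1 : ℕ) : ℂ) * (x ^ (k + 1) *
        (Complex.Gamma (ν + 1 + ((k + 1 : ℕ) : ℂ) + 1))⁻¹ / ((k + 1).factorial : ℂ)) := by
    intro k
    have hk : ((k : ℂ) + 1) ≠ 0 := by exact_mod_cast Nat.succ_ne_zero k
    have hf : (k.factorial : ℂ) ≠ 0 := by exact_mod_cast k.factorial_ne_zero
    have e : ν + 2 + (k : ℂ) + 1 = ν + 1 + (k + 1) + 1 := by ring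
    rw [Nat.factorial_succ, e]
    push_cast
    field_simp
    ring
  simp only [h3] at h2
  have h4 : Summable fun k : ℕ => (k : ℂ) * (x ^ k *
      (Complex.Gamma (ν + 1 + (k : ℂ) + 1))⁻¹ / (k.factorial : ℂ)) :=
    (summable_nat_add_iff 1).1 h2
  simp only [besselSeries]
  rw [← tsum_mul_left, ← tsum_mul_left]
  simp only [h3]
  have h5 := h4.tsum_eq_zero_add
  simp only [Nat.cast_zero, zero_mul, zero_add] at h5
  rw [← h5, ← h1.tsum_add h4]
  refine tsum_congr fun k => ?_
  rw [Complex.one_div_Gamma_eq_self_mul_one_div_Gamma_add_one (ν + (k : ℂ) + 1),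
    show ν + 1 + (k : ℂ) + 1 = ν + k + 1 + 1 by ring]
  ring

theorem besselSeries_zero (ν : ℂ) : besselSeries ν 0 = (Complex.Gamma (ν + 1))⁻¹ := by
  rw [besselSeries, tsum_eq_single 0 (fun k hk => by simp [hk])]
  simp

theorem continuous_besselSeries (ν : ℂ) : Continuous (besselSeries ν) :=
  continuous_iff_continuousAt.2 fun x => (hasDerivAt_besselSeries ν x).continuousAt

theorem differentiable_besselI_order {z : ℂ} (hz : z ≠ 0) :
    Differentiable ℂ (fun ν => besselI ν z) := by
  have h2 : z / 2 ≠ 0 := div_ne_zero hz two_ne_zero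
  simp only [besselI_eq_besselSeries]
  exact (differentiable_id.const_cpow (Or.inl h2)).mul (differentiable_besselSeries_order _)

theorem differentiable_besselJ_order {z : ℂ} (hz : z ≠ 0) :
    Differentiable ℂ (fun ν => besselJ ν z) := by
  have h2 : z / 2 ≠ 0 := div_ne_zero hz two_ne_zero
  simp only [besselJ_eq_besselSeries]
  exact (differentiable_id.const_cpow (Or.inl h2)).mul (differentiable_besselSeries_order _)

theorem div_two_mem_slitPlane {z : ℂ} (hz : z ∈ slitPlane) : z / 2 ∈ slitPlane := by
  rw [mem_slitPlane_iff] at *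
  have h1 : (z / 2).re = z.re / 2 := by simp
  have h2 : (z / 2).im = z.im / 2 := by simp
  rw [h1, h2]
  rcases hz with h | h
  · exact Or.inl (by linarith)
  · exact Or.inr (by simpa using h)

/-- `I'_ν(z) = I_{ν+1}(z) + (ν / z) I_ν(z)`. -/
theorem hasDerivAt_besselI (ν : ℂ) {z : ℂ} (hz : z ∈ slitPlane) :
    HasDerivAt (besselI ν) (besselI (ν + 1) z + ν / z * besselI ν z) z := by
  have hz0 : z ≠ 0 := slitPlane_ne_zero hz
  have h2 : z / 2 ≠ 0 := div_ne_zero hz0 two_ne_zero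
  have h3 := ((hasDerivAt_id z).div_const 2).cpow_const (c := ν) (div_two_mem_slitPlane hz)
  have h4 := (hasDerivAt_besselSeries ν (z ^ 2 / 4)).comp z ((hasDerivAt_pow 2 z).div_const 4)
  refine (h3.mul h4).congr_deriv ?_
  simp only [besselI_eq_besselSeries, id, Function.comp]
  rw [Complex.cpow_sub _ _ h2, Complex.cpow_add _ _ h2, Complex.cpow_one]
  push_cast
  field_simp
  ring

/-- `I_ν(z) = I_{ν+2}(z) + (2 (ν + 1) / z) I_{ν+1}(z)`. -/
theorem besselI_recurrence (ν : ℂ) {z : ℂ} (hz : z ≠ 0) :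
    besselI ν z = besselI (ν + 2) z + 2 * (ν + 1) / z * besselI (ν + 1) z := by
  have h2 : z / 2 ≠ 0 := div_ne_zero hz two_ne_zero
  simp only [besselI_eq_besselSeries]
  rw [besselSeries_eq, Complex.cpow_add _ _ h2, Complex.cpow_add _ _ h2, Complex.cpow_one,
    Complex.cpow_ofNat]
  field_simp
  ring

/-! ### Wronskians and the connection formula -/

theorem hasDerivAt_macdonald_up (ν : ℂ) {t : ℝ} (ht : 0 < t) :
    HasDerivAt (macdonald ν) (-macdonald (ν + 1) t + ν / t * macdonald ν t) t := by
  refine (hasDerivAt_macdonald ν ht).congr_deriv ?_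
  linear_combination (1 / 2 : ℂ) * macdonald_recurrence ν ht

theorem hasDerivAt_macdonald_down (ν : ℂ) {t : ℝ} (ht : 0 < t) :
    HasDerivAt (macdonald (ν + 1)) (-macdonald ν t - (ν + 1) / t * macdonald (ν + 1) t) t := by
  refine (hasDerivAt_macdonald (ν + 1) ht).congr_deriv ?_
  have h := macdonald_recurrence (ν + 1) ht
  rw [add_sub_cancel_right] at *
  linear_combination (-1 / 2 : ℂ) * h

theorem hasDerivAt_besselI_down (ν : ℂ) {z : ℂ} (hz : z ∈ slitPlane) :
    HasDerivAt (besselI (ν + 1)) (besselI ν z - (ν + 1) / z * besselI (ν + 1) z) z := by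
  refine (hasDerivAt_besselI (ν + 1) hz).congr_deriv ?_
  have h := besselI_recurrence ν (slitPlane_ne_zero hz)
  rw [show ν + 1 + 1 = ν + 2 by ring]
  linear_combination -h

theorem div_two_cpow (ν : ℂ) {t : ℝ} (ht : 0 < t) :
    ((t : ℂ) / 2) ^ ν = (t : ℂ) ^ ν * ((2 : ℂ) ^ ν)⁻¹ := by
  have h := Complex.mul_cpow_ofReal_nonneg (a := t / 2) (b := 2) (by positivity) (by norm_num) ν
  have h2 : (2 : ℂ) ^ ν ≠ 0 := by simp [Complex.cpow_eq_zero_iff]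
  rw [eq_mul_inv_iff_mul_eq₀ h2]
  push_cast at h
  rw [← h, div_mul_cancel₀ _ two_ne_zero]

theorem tendsto_besselSeries_sq_zero (ν : ℂ) :
    Tendsto (fun t : ℝ => besselSeries ν ((t : ℂ) ^ 2 / 4)) (𝓝[>] 0)
      (𝓝 (Complex.Gamma (ν + 1))⁻¹) := by
  have hc : Continuous fun t : ℝ => besselSeries ν ((t : ℂ) ^ 2 / 4) :=
    (continuous_besselSeries ν).comp (by fun_prop)
  have := (hc.tendsto 0).mono_left (nhdsWithin_le_nhds (s := Ioi 0))
  simpa [besselSeries_zero] using this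

/-- The Wronskian of `K_μ` and `I_μ` is `1 / t`: the product with `t` is constant, and its value is
read off at the origin. -/
theorem macdonald_besselI_wronskian {μ : ℂ} (hμ : -1 < μ.re) {t : ℝ} (ht : 0 < t) :
    (t : ℂ) * (macdonald μ t * besselI (μ + 1) t + macdonald (μ + 1) t * besselI μ t) = 1 := by
  have hμ1 : 0 < (μ + 1).re := by simp; linarith
  refine eq_of_hasDerivAt_zero_Ioi (l := 𝓝[>] (0 : ℝ)) (f := fun t : ℝ => (t : ℂ) *
    (macdonald μ t * besselI (μ + 1) t + macdonald (μ + 1) t * besselI μ t)) (fun t ht => ?_)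
    self_mem_nhdsWithin ?_ ht
  · have hts : (t : ℂ) ∈ slitPlane := ofReal_mem_slitPlane.2 ht
    have ht0 : (t : ℂ) ≠ 0 := slitPlane_ne_zero hts
    have h := (hasDerivAt_id t).ofReal_comp.mul
      (((hasDerivAt_macdonald_up μ ht).mul (hasDerivAt_besselI_down μ hts).comp_ofReal).add
      ((hasDerivAt_macdonald_down μ ht).mul (hasDerivAt_besselI μ hts).comp_ofReal))
    refine h.congr_deriv ?_
    simp only [id, ofReal_one, Pi.mul_apply, Pi.add_apply]
    field_simp
    ring
  · have hpow : ∀ t : ℝ, 0 < t → (t : ℂ) * (macdonald μ t * besselI (μ + 1) t +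
        macdonald (μ + 1) t * besselI μ t) =
        ((t : ℂ) * (t : ℂ) ^ (μ + 1) * macdonald μ t) * (((2 : ℂ) ^ (μ + 1))⁻¹ *
          besselSeries (μ + 1) ((t : ℂ) ^ 2 / 4)) +
        ((t : ℂ) ^ (μ + 1) * macdonald (μ + 1) t) * (((2 : ℂ) ^ μ)⁻¹ *
          besselSeries μ ((t : ℂ) ^ 2 / 4)) := by
      intro t ht
      rw [besselI_eq_besselSeries, besselI_eq_besselSeries, div_two_cpow _ ht, div_two_cpow _ ht,
        Complex.cpow_add μ 1 (by exact_mod_cast ht.ne' : (t : ℂ) ≠ 0), Complex.cpow_one]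
      ring
    have h1 : Tendsto (fun t : ℝ => (t : ℂ) * (t : ℂ) ^ (μ + 1) * macdonald μ t) (𝓝[>] 0)
        (𝓝 0) := by
      have habs : |μ.re| < 2 + μ.re := by
        rw [abs_lt]; constructor <;> linarith
      obtain ⟨s, hs1, hs2⟩ := exists_between habs
      obtain ⟨C, hC⟩ := norm_macdonald_le (abs_nonneg μ.re) hs1
      have hlim : Tendsto (fun t : ℝ => C * t ^ (2 + μ.re - s)) (𝓝[>] 0) (𝓝 0) := by
        have h := (Real.continuousAt_rpow_const 0 (2 + μ.re - s) (Or.inr (by linarith))).tendsto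
        rw [Real.zero_rpow (by linarith)] at h
        simpa using (h.mono_left (nhdsWithin_le_nhds (s := Ioi 0))).const_mul C
      refine squeeze_zero_norm' ?_ hlim
      filter_upwards [self_mem_nhdsWithin] with t ht
      have ht' : (0 : ℝ) < t := ht
      rw [norm_mul, norm_mul, norm_real, Real.norm_of_nonneg ht'.le,
        norm_cpow_eq_rpow_re_of_pos ht', add_re, one_re]
      calc t * t ^ (μ.re + 1) * ‖macdonald μ t‖ ≤ t * t ^ (μ.re + 1) * (C * t ^ (-s)) := by
            gcongr; exact hC μ le_rfl t ht'
        _ = C * (t ^ (1 : ℝ) * t ^ (μ.re + 1) * t ^ (-s)) := by rw [Real.rpow_one]; ring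
        _ = _ := by rw [← Real.rpow_add ht', ← Real.rpow_add ht']; ring_nf
    have h2 := (h1.mul ((tendsto_besselSeries_sq_zero (μ + 1)).const_mul
      ((2 : ℂ) ^ (μ + 1))⁻¹)).add ((tendsto_cpow_mul_macdonald hμ1).mul
      ((tendsto_besselSeries_sq_zero μ).const_mul ((2 : ℂ) ^ μ)⁻¹))
    have h3 : Complex.Gamma (μ + 1) ≠ 0 := Complex.Gamma_ne_zero_of_re_pos hμ1
    have h4 : (2 : ℂ) ^ μ ≠ 0 := by simp [Complex.cpow_eq_zero_iff]
    have e : (0 : ℂ) * (((2 : ℂ) ^ (μ + 1))⁻¹ * (Complex.Gamma (μ + 1 + 1))⁻¹) +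
        (1 / 2) * (2 : ℂ) ^ (μ + 1) * Complex.Gamma (μ + 1) *
          (((2 : ℂ) ^ μ)⁻¹ * (Complex.Gamma (μ + 1))⁻¹) = 1 := by
      rw [zero_mul, zero_add, Complex.cpow_add _ _ two_ne_zero, Complex.cpow_one]
      field_simp
    rw [e] at h2
    refine h2.congr' ?_
    filter_upwards [self_mem_nhdsWithin] with t ht using (hpow t ht).symm

/-- The Wronskian of `I_ν` and `I_{-ν}`. -/
theorem besselI_wronskian (ν : ℂ) (hν : ν ≠ 0) {t : ℝ} (ht : 0 < t) :
    (t : ℂ) * (besselI (ν + 1) t * besselI (-ν) t - besselI (-ν + 1) t * besselI ν t) +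
      2 * ν * (besselI ν t * besselI (-ν) t) = 2 * Complex.sin (Real.pi * ν) / Real.pi := by
  refine eq_of_hasDerivAt_zero_Ioi (l := 𝓝[>] (0 : ℝ)) (f := fun t : ℝ =>
    (t : ℂ) * (besselI (ν + 1) t * besselI (-ν) t - besselI (-ν + 1) t * besselI ν t) +
      2 * ν * (besselI ν t * besselI (-ν) t)) (fun t ht => ?_) self_mem_nhdsWithin ?_ ht
  · have hts : (t : ℂ) ∈ slitPlane := ofReal_mem_slitPlane.2 ht
    have ht0 : (t : ℂ) ≠ 0 := slitPlane_ne_zero hts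
    have hA := (hasDerivAt_besselI ν hts).comp_ofReal
    have hB := (hasDerivAt_besselI (-ν) hts).comp_ofReal
    have hP := (hasDerivAt_besselI_down ν hts).comp_ofReal
    have hQ := (hasDerivAt_besselI_down (-ν) hts).comp_ofReal
    have h := ((hasDerivAt_id t).ofReal_comp.mul ((hP.mul hB).sub (hQ.mul hA))).add
      ((hA.mul hB).const_mul (2 * ν))
    refine h.congr_deriv ?_
    simp only [id, ofReal_one, Pi.mul_apply, Pi.sub_apply]
    field_simp
    ring
  · have hpow : ∀ t : ℝ, 0 < t →
        (t : ℂ) * (besselI (ν + 1) t * besselI (-ν) t - besselI (-ν + 1) t * besselI ν t) +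
          2 * ν * (besselI ν t * besselI (-ν) t) =
        (t : ℂ) * (t / 2) * (besselSeries (ν + 1) ((t : ℂ) ^ 2 / 4) *
          besselSeries (-ν) ((t : ℂ) ^ 2 / 4) - besselSeries (-ν + 1) ((t : ℂ) ^ 2 / 4) *
          besselSeries ν ((t : ℂ) ^ 2 / 4)) + 2 * ν * (besselSeries ν ((t : ℂ) ^ 2 / 4) *
          besselSeries (-ν) ((t : ℂ) ^ 2 / 4)) := by
      intro t ht
      have h2 : ((t : ℂ) / 2) ≠ 0 := div_ne_zero (by exact_mod_cast ht.ne') two_ne_zero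
      have h3 : ((t : ℂ) / 2) ^ ν ≠ 0 := by simp [Complex.cpow_eq_zero_iff, ht.ne']
      simp only [besselI_eq_besselSeries]
      rw [Complex.cpow_add _ _ h2, Complex.cpow_add _ _ h2, Complex.cpow_neg, Complex.cpow_one]
      field_simp
    have hid : Tendsto (fun t : ℝ => (t : ℂ) * (t / 2)) (𝓝[>] 0) (𝓝 0) := by
      have hc : Continuous fun t : ℝ => (t : ℂ) * (t / 2) := by fun_prop
      simpa using (hc.tendsto 0).mono_left (nhdsWithin_le_nhds (s := Ioi 0))
    have hS := tendsto_besselSeries_sq_zero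
    have h1 := (hid.mul (((hS (ν + 1)).mul (hS (-ν))).sub ((hS (-ν + 1)).mul (hS ν)))).add
      (((hS ν).mul (hS (-ν))).const_mul (2 * ν))
    have e : 2 * ν * ((Complex.Gamma (ν + 1))⁻¹ * (Complex.Gamma (-ν + 1))⁻¹) =
        2 * Complex.sin (Real.pi * ν) / Real.pi := by
      have h4 := Complex.Gamma_mul_Gamma_one_sub ν
      rw [Complex.Gamma_add_one ν hν, neg_add_eq_sub, ← mul_inv, mul_assoc ν, h4, mul_inv, inv_div]
      field_simp
    rw [zero_mul, zero_add, e] at h1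
    refine h1.congr' ?_
    filter_upwards [self_mem_nhdsWithin] with t ht using (hpow t ht).symm

/-- The connection formula between the integral and the series. For `0 < ν < 1` it is linear algebra
on the three Wronskians of `K_ν`, `I_ν`, `I_{-ν}`; both sides are entire in the order. -/
theorem sin_mul_macdonald (ν : ℂ) {t : ℝ} (ht : 0 < t) :
    Complex.sin (Real.pi * ν) * macdonald ν t =
      Real.pi / 2 * (besselI (-ν) t - besselI ν t) := by
  have ht0 : (t : ℂ) ≠ 0 := by exact_mod_cast ht.ne'
  have hpi : (Real.pi : ℂ) ≠ 0 := by exact_mod_cast Real.pi_ne_zero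
  have hI := differentiable_besselI_order ht0
  refine eqOn_of_eq_on_real_interval isOpen_univ isPreconnected_univ
    (f := fun ν : ℂ => Complex.sin (Real.pi * ν) * macdonald ν t)
    (g := fun ν : ℂ => (Real.pi : ℂ) / 2 * (besselI (-ν) t - besselI ν t))
    (((by fun_prop : Differentiable ℂ fun ν : ℂ => Complex.sin (Real.pi * ν)).mul
      (differentiable_macdonald ht)).differentiableOn)
    (((hI.comp differentiable_neg).sub hI).const_mul _).differentiableOn
    (zero_lt_one' ℝ) (fun _ _ => mem_univ _) (fun x hx => ?_) (mem_univ ν)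
  have h1 := macdonald_besselI_wronskian (μ := x) (by simp; linarith [hx.1]) ht
  have h2 := macdonald_besselI_wronskian (μ := -x) (by simp; linarith [hx.2]) ht
  have h3 := besselI_wronskian x (by exact_mod_cast hx.1.ne') ht
  have h4 := macdonald_recurrence x ht
  rw [macdonald_neg, show -(x : ℂ) + 1 = -(x - 1) by ring, macdonald_neg] at h2
  rw [show -(x : ℂ) + 1 = -(x - 1) by ring] at h3
  have h5 : (t : ℂ) * macdonald (x + 1) t = t * macdonald (x - 1) t + 2 * x * macdonald x t := by
    field_simp at h4
    linear_combination h4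
  have h3' : 2 * Complex.sin (Real.pi * x) = Real.pi * ((t : ℂ) * (besselI (x + 1) t *
      besselI (-x) t - besselI (-(x - 1)) t * besselI x t) +
      2 * x * (besselI x t * besselI (-x) t)) := by
    rw [h3]; field_simp
  linear_combination (macdonald x t / 2) * h3' + (Real.pi / 2 * besselI (-x) t) * h1 -
    (Real.pi / 2 * besselI x t) * h2 - (Real.pi / 2 * besselI x t * besselI (-x) t) * h5

/-! ### Integration by parts against Bessel's equation -/

/-- The density `t^{-1/2} e^{-t} K_ν(t)` of the Stieltjes representation. -/
noncomputable def stieltjesDensity (ν : ℂ) (t : ℝ) : ℂ :=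
  ((t ^ (-(1 / 2) : ℝ) * Real.exp (-t) : ℝ) : ℂ) * macdonald ν t

theorem stieltjesDensity_mul_pow (ν : ℂ) (n : ℕ) {t : ℝ} (ht : 0 < t) :
    stieltjesDensity ν t * (t : ℂ) ^ n =
      ((t ^ ((n : ℝ) - 1 / 2) * Real.exp (-t) : ℝ) : ℂ) * macdonald ν t := by
  rw [stieltjesDensity, show (n : ℝ) - 1 / 2 = -(1 / 2) + n by ring, Real.rpow_add ht,
    Real.rpow_natCast]
  push_cast
  ring

theorem integrableOn_stieltjesDensity_mul_pow {ν : ℂ} {n : ℕ} (hν : |ν.re| < n + 1 / 2) :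
    IntegrableOn (fun t : ℝ => stieltjesDensity ν t * (t : ℂ) ^ n) (Ioi 0) :=
  (integrableOn_rpow_exp_macdonald (r := (n : ℝ) - 1 / 2) (by linarith)).congr_fun
    (fun _ ht => (stieltjesDensity_mul_pow ν n ht).symm) measurableSet_Ioi

theorem continuousOn_stieltjesDensity (ν : ℂ) : ContinuousOn (stieltjesDensity ν) (Ioi 0) :=
  continuousOn_rpow_exp_macdonald _ ν

/-- The derivative of the Macdonald function in its argument, written through `K_{ν+1}` and `K_ν` so
that differentiating once more stays within the contiguous orders. -/
noncomputable def macdonaldDeriv (ν : ℂ) (t : ℝ) : ℂ :=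
  -macdonald (ν + 1) t + ν / t * macdonald ν t

/-- Bessel's equation `K'' = (1 + ν² / t²) K - K' / t`. -/
theorem hasDerivAt_macdonaldDeriv (ν : ℂ) {t : ℝ} (ht : 0 < t) :
    HasDerivAt (macdonaldDeriv ν)
      ((1 + ν ^ 2 / t ^ 2) * macdonald ν t - macdonaldDeriv ν t / t) t := by
  have ht0 : (t : ℂ) ≠ 0 := by exact_mod_cast ht.ne'
  have hinv : HasDerivAt (fun t : ℝ => ν / (t : ℂ)) (-ν / (t : ℂ) ^ 2) t := by
    have h := ((hasDerivAt_inv ht0).const_mul ν).comp_ofReal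
    refine (h.congr_deriv (by ring)).congr_of_eventuallyEq (Eventually.of_forall fun x => ?_)
    simp [div_eq_mul_inv]
  refine ((hasDerivAt_macdonald_down ν ht).neg.add
    (hinv.mul (hasDerivAt_macdonald_up ν ht))).congr_deriv ?_
  simp only [macdonaldDeriv]
  field_simp
  ring

theorem macdonaldDeriv_eq (ν : ℂ) {t : ℝ} (ht : 0 < t) :
    macdonaldDeriv ν t = -(macdonald (ν - 1) t + macdonald (ν + 1) t) / 2 := by
  have h := macdonald_recurrence ν ht
  simp only [macdonaldDeriv]
  linear_combination (-1 / 2 : ℂ) * h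

/-- Integration by parts against Bessel's equation: with `p = √t e^{-t} K_ν` one has
`p'' + 2 p' = (ν² - 1/4) p / t²`, so that pairing with a test function `φ` vanishing at the origin
gives `∫ (ν² - 1/4) p φ / t² = ∫ p (φ'' - 2 φ')`. -/
theorem integral_stieltjesDensity_mul_adjoint {ν : ℂ} (hν : |ν.re| < 1 / 2) {φ φ₁ φ₂ : ℝ → ℂ}
    (hφ : ∀ t : ℝ, 0 < t → HasDerivAt φ (φ₁ t) t) (hφ₁ : ∀ t : ℝ, 0 < t → HasDerivAt φ₁ (φ₂ t) t)
    (hφ₂ : ContinuousOn φ₂ (Ioi 0)) {M : ℝ} {m : ℕ}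
    (b0 : ∀ t : ℝ, 0 < t → ‖φ t‖ ≤ M * (t * (1 + t ^ m)))
    (b1 : ∀ t : ℝ, 0 < t → ‖φ₁ t‖ ≤ M * (1 + t ^ m))
    (b2 : ∀ t : ℝ, 0 < t → ‖φ₂ t‖ ≤ M * (1 + t ^ m)) :
    ∫ t in Ioi (0 : ℝ), stieltjesDensity ν t *
      ((ν ^ 2 - 1 / 4) * φ t / t - t * φ₂ t + 2 * t * φ₁ t) = 0 := by
  obtain ⟨s, hs1, hs2⟩ := exists_between hν
  obtain ⟨C, hC⟩ := norm_macdonald_le (abs_nonneg ν.re) hs1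
  obtain ⟨C₁, hC₁⟩ := norm_macdonald_le (σ := |ν.re| + 1) (s := s + 1)
    (by positivity) (by linarith)
  have hM : 0 ≤ M := by
    have h := (norm_nonneg _).trans (b1 1 one_pos)
    simp only [one_pow] at h
    linarith
  have hC0 : 0 ≤ C := by
    have h := (norm_nonneg _).trans (hC ν le_rfl 1 one_pos)
    simpa using h
  have hre : |(ν + 1).re| ≤ |ν.re| + 1 := by
    rw [add_re, one_re]; exact (abs_add_le _ _).trans (by simp)
  have hC10 : 0 ≤ C₁ := by
    have h := (norm_nonneg _).trans (hC₁ (ν + 1) hre 1 one_pos)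
    simpa using h
  set Q : ℝ → ℂ := fun t => ((t ^ (1 / 2 : ℝ) * Real.exp (-t) : ℝ) : ℂ) *
    ((1 / (2 * t) + 1) * macdonald ν t * φ t + macdonaldDeriv ν t * φ t - macdonald ν t * φ₁ t)
    with hQ
  set A : ℝ := M * (2 * C + C₁ + ‖ν‖ * C) with hA
  -- the boundary terms are controlled by `t^{1/2 - s} e^{-t}` times a polynomial
  have hQbound : ∀ t : ℝ, 0 < t → ‖Q t‖ ≤
      A * (t ^ (1 / 2 - s) * Real.exp (-t) * ((1 + t ^ m) * (1 + t))) := by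
    intro t ht
    have hk := hC ν le_rfl t ht
    have hk1 := hC₁ (ν + 1) hre t ht
    have hts : t ^ (-(s + 1)) = t ^ (-s) * t⁻¹ := by
      rw [neg_add, Real.rpow_add ht, Real.rpow_neg_one]
    have hD : ‖macdonaldDeriv ν t‖ ≤ (C₁ + ‖ν‖ * C) * (t ^ (-s) * t⁻¹) := by
      rw [macdonaldDeriv]
      refine (norm_add_le _ _).trans ?_
      rw [norm_neg, norm_mul, norm_div, norm_real, Real.norm_of_nonneg ht.le]
      calc _ ≤ C₁ * (t ^ (-s) * t⁻¹) + ‖ν‖ / t * (C * t ^ (-s)) := by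
            rw [← hts]; gcongr
        _ = _ := by ring
    have hsplit : t ^ (1 / 2 - s) = t ^ (1 / 2 : ℝ) * t ^ (-s) := by
      rw [sub_eq_add_neg, Real.rpow_add ht]
    have hcoef : ‖((1 / (2 * t) + 1 : ℂ))‖ ≤ 1 / (2 * t) + 1 := by
      refine (norm_add_le _ _).trans ?_
      simp [abs_of_pos ht]
    have hin : ‖(1 / (2 * t) + 1) * macdonald ν t * φ t + macdonaldDeriv ν t * φ t -
        macdonald ν t * φ₁ t‖ ≤ A * (t ^ (-s) * ((1 + t ^ m) * (1 + t))) := by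
      refine (norm_sub_le _ _).trans ((add_le_add_left (norm_add_le _ _) _).trans ?_)
      rw [norm_mul, norm_mul, norm_mul, norm_mul]
      have hp : 0 ≤ t ^ (-s) := by positivity
      calc _ ≤ (1 / (2 * t) + 1) * (C * t ^ (-s)) * (M * (t * (1 + t ^ m))) +
            (C₁ + ‖ν‖ * C) * (t ^ (-s) * t⁻¹) * (M * (t * (1 + t ^ m))) +
            C * t ^ (-s) * (M * (1 + t ^ m)) := by
            gcongr
            · exact b0 t ht
            · exact b0 t ht
            · exact b1 t ht
        _ = M * t ^ (-s) * (1 + t ^ m) * (C * (3 / 2 + t) + (C₁ + ‖ν‖ * C)) := by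
            field_simp
            ring
        _ ≤ M * t ^ (-s) * (1 + t ^ m) * ((2 * C + C₁ + ‖ν‖ * C) * (1 + t)) := by
            gcongr
            nlinarith [mul_nonneg hC0 ht.le, mul_nonneg hC10 ht.le,
              mul_nonneg (mul_nonneg (norm_nonneg ν) hC0) ht.le]
        _ = _ := by rw [hA]; ring
    rw [hQ]
    simp only
    rw [norm_mul, norm_real, Real.norm_of_nonneg (by positivity), hsplit]
    calc _ ≤ t ^ (1 / 2 : ℝ) * Real.exp (-t) * (A * (t ^ (-s) * ((1 + t ^ m) * (1 + t)))) := by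
          gcongr
      _ = _ := by ring
  have hQ0 : Tendsto Q (𝓝[>] 0) (𝓝 0) := by
    have hlim : Tendsto (fun t : ℝ => A * (t ^ (1 / 2 - s) * Real.exp (-t) *
        ((1 + t ^ m) * (1 + t)))) (𝓝[>] 0) (𝓝 0) := by
      have h1 := (Real.continuousAt_rpow_const 0 (1 / 2 - s) (Or.inr (by linarith))).tendsto
      rw [Real.zero_rpow (by linarith)] at h1
      have h2 : Tendsto (fun t : ℝ => Real.exp (-t) * ((1 + t ^ m) * (1 + t))) (𝓝 0)
          (𝓝 (Real.exp (-0) * ((1 + 0 ^ m) * (1 + 0)))) :=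
        (by fun_prop : Continuous fun t : ℝ => Real.exp (-t) * ((1 + t ^ m) * (1 + t))).tendsto 0
      have h3 := ((h1.mul h2).const_mul A).mono_left (nhdsWithin_le_nhds (s := Ioi 0))
      simpa only [zero_mul, mul_zero, mul_assoc] using h3
    refine squeeze_zero_norm' ?_ hlim
    filter_upwards [self_mem_nhdsWithin] with t ht using hQbound t ht
  have hQi : Tendsto Q atTop (𝓝 0) := by
    have hlim : Tendsto (fun t : ℝ => A * (t ^ (1 / 2 - s) * Real.exp (-t) *
        ((1 + t ^ m) * (1 + t)))) atTop (𝓝 0) := by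
      have e := fun r : ℝ => tendsto_rpow_mul_exp_neg_mul_atTop_nhds_zero r 1 one_pos
      have h := ((((e (1 / 2 - s)).add (e (1 / 2 - s + 1))).add (e (1 / 2 - s + m))).add
        (e (1 / 2 - s + m + 1))).const_mul A
      simp only [add_zero, mul_zero] at h
      refine h.congr' ?_
      filter_upwards [eventually_gt_atTop 0] with t ht
      rw [Real.rpow_add_one ht.ne', Real.rpow_add_one ht.ne', Real.rpow_add ht, Real.rpow_natCast]
      ring_nf
    refine squeeze_zero_norm' ?_ hlim
    filter_upwards [eventually_gt_atTop 0] with t ht using hQbound t ht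
  have hQder : ∀ t ∈ Ioi (0 : ℝ), HasDerivAt Q (stieltjesDensity ν t *
      ((ν ^ 2 - 1 / 4) * φ t / t - t * φ₂ t + 2 * t * φ₁ t)) t := by
    intro t ht
    have ht' : (0 : ℝ) < t := ht
    have ht0 : (t : ℂ) ≠ 0 := by exact_mod_cast ht'.ne'
    have hw := (((Real.hasDerivAt_rpow_const (p := 1 / 2) (Or.inl ht'.ne')).mul
      (hasDerivAt_neg t).exp)).ofReal_comp
    have hinv : HasDerivAt (fun t : ℝ => (1 / (2 * (t : ℂ)) + 1)) (-1 / (2 * (t : ℂ) ^ 2)) t := by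
      have h := (((hasDerivAt_inv ht0).const_mul (1 / 2 : ℂ)).add_const 1).comp_ofReal
      refine (h.congr_deriv (by ring)).congr_of_eventuallyEq (Eventually.of_forall fun x => ?_)
      simp [mul_comm]
    have hk := hasDerivAt_macdonald_up ν ht'
    have hk' : HasDerivAt (macdonald ν) (macdonaldDeriv ν t) t := hk
    have h := hw.mul ((((hinv.mul hk').mul (hφ t ht')).add
      ((hasDerivAt_macdonaldDeriv ν ht').mul (hφ t ht'))).sub (hk'.mul (hφ₁ t ht')))
    refine h.congr_deriv ?_
    have hr1 : t ^ (1 / 2 - 1 : ℝ) = t ^ (-(1 / 2) : ℝ) := by norm_num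
    have hr2 : t ^ (1 / 2 : ℝ) = t * t ^ (-(1 / 2) : ℝ) := by
      rw [mul_comm, ← Real.rpow_add_one ht'.ne']; norm_num
    simp only [stieltjesDensity, Pi.mul_apply, Pi.add_apply, Pi.sub_apply, hr1, hr2]
    generalize t ^ (-(1 / 2) : ℝ) = w
    generalize Real.exp (-t) = e
    push_cast
    field_simp
    ring
  have hint : IntegrableOn (fun t : ℝ => stieltjesDensity ν t *
      ((ν ^ 2 - 1 / 4) * φ t / t - t * φ₂ t + 2 * t * φ₁ t)) (Ioi 0) := by
    have hn : ∀ n : ℕ, IntegrableOn (fun t : ℝ => ‖stieltjesDensity ν t * (t : ℂ) ^ n‖) (Ioi 0) :=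
      fun n => (integrableOn_stieltjesDensity_mul_pow (by
        have : (0 : ℝ) ≤ n := n.cast_nonneg
        linarith)).norm
    have hb := ((((hn 0).add (hn 1)).add (hn m)).add (hn (m + 1))).const_mul
      (M * (‖ν ^ 2 - 1 / 4‖ + 3))
    refine hb.mono' (ContinuousOn.aestronglyMeasurable ?_ measurableSet_Ioi) ?_
    · have c0 : ContinuousOn φ (Ioi 0) := fun t ht => (hφ t ht).continuousAt.continuousWithinAt
      have c1 : ContinuousOn φ₁ (Ioi 0) := fun t ht => (hφ₁ t ht).continuousAt.continuousWithinAt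
      have ct : ContinuousOn (fun t : ℝ => (t : ℂ)) (Ioi 0) := continuous_ofReal.continuousOn
      refine (continuousOn_stieltjesDensity ν).mul ((((continuousOn_const.mul c0).div ct
        fun t ht => ?_).sub (ct.mul hφ₂)).add ((continuousOn_const.mul ct).mul c1))
      exact_mod_cast (ne_of_gt ht)
    · filter_upwards [ae_restrict_mem measurableSet_Ioi] with t ht
      have ht' : (0 : ℝ) < t := ht
      simp only [norm_mul, norm_pow, norm_real, Real.norm_of_nonneg ht'.le, Pi.add_apply]
      have h1 : ‖(ν ^ 2 - 1 / 4) * φ t / t - t * φ₂ t + 2 * t * φ₁ t‖ ≤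
          M * (‖ν ^ 2 - 1 / 4‖ + 3) * ((1 + t ^ m) * (1 + t)) := by
        refine (norm_add_le _ _).trans ((add_le_add_left (norm_sub_le _ _) _).trans ?_)
        rw [norm_div, norm_mul, norm_mul, norm_mul, norm_mul, norm_real,
          Real.norm_of_nonneg ht'.le, Complex.norm_two]
        calc _ ≤ ‖ν ^ 2 - 1 / 4‖ * (M * (t * (1 + t ^ m))) / t + t * (M * (1 + t ^ m)) +
              2 * t * (M * (1 + t ^ m)) := by
              gcongr
              · exact b0 t ht'
              · exact b2 t ht'
              · exact b1 t ht'
          _ = M * (1 + t ^ m) * (‖ν ^ 2 - 1 / 4‖ + 3 * t) := by field_simp; ring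
          _ ≤ M * (1 + t ^ m) * ((‖ν ^ 2 - 1 / 4‖ + 3) * (1 + t)) := by
              gcongr
              nlinarith [mul_nonneg (norm_nonneg (ν ^ 2 - 1 / 4)) ht'.le]
          _ = _ := by ring
      calc _ ≤ ‖stieltjesDensity ν t‖ * (M * (‖ν ^ 2 - 1 / 4‖ + 3) * ((1 + t ^ m) * (1 + t))) := by
            gcongr
        _ = _ := by ring
  have hcont : ContinuousWithinAt Q (Ici 0) 0 := by
    have hz : Q 0 = 0 := by simp [hQ]
    rw [← continuousWithinAt_Ioi_iff_Ici, ContinuousWithinAt, hz]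
    exact hQ0
  rw [integral_Ioi_of_hasDerivAt_of_tendsto hcont hQder hint hQi]
  simp [hQ]

/-! ### The Stieltjes representation for small real orders -/

/-- The moments `∫ tⁿ t^{-1/2} e^{-t} K_ν(t) dt` of the Stieltjes density. -/
noncomputable def stieltjesMoment (ν : ℂ) (n : ℕ) : ℂ :=
  ∫ t in Ioi (0 : ℝ), stieltjesDensity ν t * (t : ℂ) ^ n

theorem stieltjesMoment_zero {ν : ℂ} (hν : |ν.re| < 1 / 2) :
    stieltjesMoment ν 0 =
      (Real.sqrt (Real.pi / 2) : ℂ) * (Real.pi / Complex.cos (Real.pi * ν)) := by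
  simp only [stieltjesMoment, pow_zero, mul_one, stieltjesDensity]
  exact integral_rpow_neg_half_exp_macdonald hν

theorem integrableOn_stieltjesDensity_mul_pow_of_lt {ν : ℂ} (hν : |ν.re| < 1 / 2) (n : ℕ) :
    IntegrableOn (fun t : ℝ => stieltjesDensity ν t * (t : ℂ) ^ n) (Ioi 0) :=
  integrableOn_stieltjesDensity_mul_pow (by
    have : (0 : ℝ) ≤ n := n.cast_nonneg
    linarith)

/-- The recursion of the moments: the adjoint identity for the test function `t ^ (n + 1)`. -/
theorem stieltjesMoment_succ {ν : ℂ} (hν : |ν.re| < 1 / 2) (n : ℕ) :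
    2 * ((n : ℂ) + 1) * stieltjesMoment ν (n + 1) =
      (((n : ℂ) + 1 / 2) ^ 2 - ν ^ 2) * stieltjesMoment ν n := by
  have h := integral_stieltjesDensity_mul_adjoint hν (φ := fun t => (t : ℂ) ^ (n + 1))
    (φ₁ := fun t => ((n : ℂ) + 1) * (t : ℂ) ^ n)
    (φ₂ := fun t => ((n : ℂ) + 1) * ((n : ℂ) * (t : ℂ) ^ (n - 1)))
    (M := ((n : ℝ) + 1) * ((n : ℝ) + 1)) (m := n)
    (fun t _ => by simpa using (hasDerivAt_pow (n + 1) (t : ℂ)).comp_ofReal)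
    (fun t _ => ((hasDerivAt_pow n (t : ℂ)).const_mul _).comp_ofReal)
    (by fun_prop) (fun t ht => ?_) (fun t ht => ?_) (fun t ht => ?_)
  · have e : ∀ t ∈ Ioi (0 : ℝ), stieltjesDensity ν t * ((ν ^ 2 - 1 / 4) * (t : ℂ) ^ (n + 1) / t -
        t * (((n : ℂ) + 1) * ((n : ℂ) * (t : ℂ) ^ (n - 1))) +
        2 * t * (((n : ℂ) + 1) * (t : ℂ) ^ n)) =
        (ν ^ 2 - ((n : ℂ) + 1 / 2) ^ 2) * (stieltjesDensity ν t * (t : ℂ) ^ n) +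
        2 * ((n : ℂ) + 1) * (stieltjesDensity ν t * (t : ℂ) ^ (n + 1)) := by
      intro t ht
      have ht0 : (t : ℂ) ≠ 0 := by exact_mod_cast (ne_of_gt ht : t ≠ 0)
      have h1 : (t : ℂ) * ((n : ℂ) * (t : ℂ) ^ (n - 1)) = n * (t : ℂ) ^ n := by
        rcases n with _ | n
        · simp
        · rw [Nat.add_sub_cancel, pow_succ]; ring
      have h2 : (ν ^ 2 - 1 / 4) * (t : ℂ) ^ (n + 1) / t = (ν ^ 2 - 1 / 4) * (t : ℂ) ^ n := by
        rw [pow_succ (t : ℂ) n, ← mul_assoc, mul_div_cancel_right₀ _ ht0]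
      rw [h2, pow_succ (t : ℂ) n]
      linear_combination (-(stieltjesDensity ν t) * ((n : ℂ) + 1)) * h1
    rw [setIntegral_congr_fun measurableSet_Ioi e, integral_add
      ((integrableOn_stieltjesDensity_mul_pow_of_lt hν n).const_mul _)
      ((integrableOn_stieltjesDensity_mul_pow_of_lt hν (n + 1)).const_mul _),
      integral_const_mul, integral_const_mul] at h
    simp only [stieltjesMoment]
    linear_combination h
  · rw [norm_pow, norm_real, Real.norm_of_nonneg ht.le, pow_succ]
    have hn : (0 : ℝ) ≤ n := n.cast_nonneg
    have hp : 0 ≤ t ^ n := by positivity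
    calc t ^ n * t = 1 * (t * t ^ n) := by ring
      _ ≤ ((n : ℝ) + 1) * ((n : ℝ) + 1) * (t * (1 + t ^ n)) := by
        gcongr
        · nlinarith
        · linarith
  · have hn : (0 : ℝ) ≤ n := n.cast_nonneg
    have hp : 0 ≤ t ^ n := by positivity
    rw [norm_mul, norm_pow, norm_real, Real.norm_of_nonneg ht.le,
      show ((n : ℂ) + 1) = ((n + 1 : ℕ) : ℂ) by push_cast; rfl, Complex.norm_natCast]
    push_cast
    gcongr
    · nlinarith
    · linarith
  · have hn : (0 : ℝ) ≤ n := n.cast_nonneg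
    have hp : t ^ (n - 1) ≤ 1 + t ^ n := by
      rcases le_total t 1 with h1 | h1
      · have := pow_le_one₀ ht.le h1 (n := n - 1)
        have : 0 ≤ t ^ n := by positivity
        linarith
      · have := pow_le_pow_right₀ h1 (Nat.sub_le n 1)
        linarith
    rw [norm_mul, norm_mul, norm_pow, norm_real, Real.norm_of_nonneg ht.le,
      show ((n : ℂ) + 1) = ((n + 1 : ℕ) : ℂ) by push_cast; rfl, Complex.norm_natCast,
      Complex.norm_natCast]
    push_cast
    rw [mul_assoc ((n : ℝ) + 1)]
    gcongr
    linarith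

/-- The Stieltjes transforms `∫ √t e^{-t} K_ν(t) / (z + t)^j dt`; up to constants these are the
successive derivatives of the first one. -/
noncomputable def stieltjesTransform (ν : ℂ) (j : ℕ) (z : ℝ) : ℂ :=
  ∫ t in Ioi (0 : ℝ), stieltjesDensity ν t * t / ((z : ℂ) + t) ^ j

theorem norm_add_ofReal_inv_le {z t : ℝ} (hz : 0 < z) (ht : 0 < t) :
    ‖((z : ℂ) + t)⁻¹‖ ≤ z⁻¹ := by
  rw [← ofReal_add, ← ofReal_inv, norm_real, Real.norm_of_nonneg (by positivity)]
  gcongr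
  linarith

theorem add_ofReal_ne_zero {z t : ℝ} (hz : 0 < z) (ht : 0 < t) : ((z : ℂ) + t) ≠ 0 := by
  have : z + t ≠ 0 := by positivity
  exact_mod_cast this

theorem norm_stieltjesTransform_integrand_le (ν : ℂ) (j : ℕ) {z t : ℝ} (hz : 0 < z) (ht : 0 < t) :
    ‖stieltjesDensity ν t * t / ((z : ℂ) + t) ^ j‖ ≤ ‖stieltjesDensity ν t * t‖ * (z⁻¹) ^ j := by
  rw [div_eq_mul_inv, norm_mul, ← inv_pow, norm_pow]
  gcongr
  exact norm_add_ofReal_inv_le hz ht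

theorem aestronglyMeasurable_stieltjesTransform_integrand (ν : ℂ) (j : ℕ) {z : ℝ} (hz : 0 < z) :
    AEStronglyMeasurable (fun t : ℝ => stieltjesDensity ν t * t / ((z : ℂ) + t) ^ j)
      (volume.restrict (Ioi 0)) := by
  refine ContinuousOn.aestronglyMeasurable ?_ measurableSet_Ioi
  refine ((continuousOn_stieltjesDensity ν).mul continuous_ofReal.continuousOn).div
    (by fun_prop) fun t ht => pow_ne_zero _ (add_ofReal_ne_zero hz ht)

theorem integrableOn_stieltjesTransform_integrand {ν : ℂ} (hν : |ν.re| < 1 / 2) (j : ℕ) {z : ℝ}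
    (hz : 0 < z) :
    IntegrableOn (fun t : ℝ => stieltjesDensity ν t * t / ((z : ℂ) + t) ^ j) (Ioi 0) := by
  have hp := integrableOn_stieltjesDensity_mul_pow_of_lt hν 1
  simp only [pow_one] at hp
  refine (hp.norm.mul_const ((z⁻¹) ^ j)).mono'
    (aestronglyMeasurable_stieltjesTransform_integrand ν j hz) ?_
  filter_upwards [ae_restrict_mem measurableSet_Ioi] with t ht using
    norm_stieltjesTransform_integrand_le ν j hz ht

theorem norm_stieltjesTransform_le {ν : ℂ} (hν : |ν.re| < 1 / 2) (j : ℕ) {z : ℝ} (hz : 0 < z) :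
    ‖stieltjesTransform ν j z‖ ≤
      (∫ t in Ioi (0 : ℝ), ‖stieltjesDensity ν t * t‖) * (z⁻¹) ^ j := by
  have hp := integrableOn_stieltjesDensity_mul_pow_of_lt hν 1
  simp only [pow_one] at hp
  rw [← integral_mul_const]
  refine norm_integral_le_of_norm_le (hp.norm.mul_const _) ?_
  filter_upwards [ae_restrict_mem measurableSet_Ioi] with t ht using
    norm_stieltjesTransform_integrand_le ν j hz ht

theorem hasDerivAt_stieltjesTransform {ν : ℂ} (hν : |ν.re| < 1 / 2) (j : ℕ) {z : ℝ} (hz : 0 < z) :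
    HasDerivAt (stieltjesTransform ν j) (-j * stieltjesTransform ν (j + 1) z) z := by
  have hp := integrableOn_stieltjesDensity_mul_pow_of_lt hν 1
  simp only [pow_one] at hp
  have key := hasDerivAt_integral_of_dominated_loc_of_deriv_le (μ := volume.restrict (Ioi (0 : ℝ)))
    (x₀ := z) (F := fun (z t : ℝ) => stieltjesDensity ν t * t / ((z : ℂ) + t) ^ j)
    (F' := fun (z t : ℝ) => -j * (stieltjesDensity ν t * t / ((z : ℂ) + t) ^ (j + 1)))
    (s := Ioi (z / 2)) (Ioi_mem_nhds (by linarith))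
    (bound := fun t => j * (‖stieltjesDensity ν t * t‖ * ((z / 2)⁻¹) ^ (j + 1)))
    ?_ (integrableOn_stieltjesTransform_integrand hν j hz)
    ((aestronglyMeasurable_stieltjesTransform_integrand ν (j + 1) hz).const_mul _) ?_
    ((hp.norm.mul_const _).const_mul _) ?_
  · refine key.2.congr_deriv ?_
    rw [integral_const_mul, stieltjesTransform]
  · filter_upwards [Ioi_mem_nhds hz] with w hw using
      aestronglyMeasurable_stieltjesTransform_integrand ν j hw
  · filter_upwards [ae_restrict_mem measurableSet_Ioi] with t ht w hw
    have hz2 : 0 < z / 2 := by positivity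
    have hw' : z / 2 < w := hw
    rw [norm_mul, norm_neg, Complex.norm_natCast]
    gcongr
    refine (norm_stieltjesTransform_integrand_le ν (j + 1) (hz2.trans hw') ht).trans ?_
    have hw0 : 0 ≤ w⁻¹ := (inv_pos.2 (hz2.trans hw')).le
    gcongr
  · filter_upwards [ae_restrict_mem measurableSet_Ioi] with t ht w hw
    have hw' : 0 < w := lt_trans (by positivity) (mem_Ioi.1 hw)
    have hne := add_ofReal_ne_zero hw' ht
    have h1 : HasDerivAt (fun w : ℝ => (w : ℂ) + t) 1 w :=
      (hasDerivAt_id w).ofReal_comp.add_const _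
    have h2 := ((h1.pow j).inv (pow_ne_zero j hne)).const_mul (stieltjesDensity ν t * t)
    refine (h2.congr_deriv ?_).congr_of_eventuallyEq (Eventually.of_forall fun x => ?_)
    · rcases j with _ | j
      · simp
      · simp only [Nat.add_sub_cancel, Pi.pow_apply]
        field_simp
        ring
    · simp [div_eq_mul_inv]

/-- Writing `h` for the Stieltjes density, `m₀` for its integral and `G_j` for the transforms, the
function `S = m₀ - G₁`, that is `S(z) = ∫ z h(t) / (z + t) dt`, satisfies
`S'' = 2 S' + (ν² - 1/4) S / z²`, which is the equation of `√z e^z K_ν(z)`. The adjoint identity is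
applied to the test function `1 / z - 1 / (z + t)`. -/
theorem stieltjesTransform_ode {ν : ℂ} (hν : |ν.re| < 1 / 2) {z : ℝ} (hz : 0 < z) :
    -2 * stieltjesTransform ν 3 z - 2 * stieltjesTransform ν 2 z =
      (ν ^ 2 - 1 / 4) / z ^ 2 * (stieltjesMoment ν 0 - stieltjesTransform ν 1 z) := by
  have hz0 : (z : ℂ) ≠ 0 := by exact_mod_cast hz.ne'
  have hd1 : ∀ t : ℝ, 0 < t → HasDerivAt (fun t : ℝ => (z : ℂ) + t) 1 t := fun t _ => by
    have := (hasDerivAt_id t).ofReal_comp.const_add (z : ℂ)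
    simpa using this
  have hinv : ∀ t : ℝ, 0 < t → ∀ j : ℕ, ‖(((z : ℂ) + t) ^ j)⁻¹‖ ≤ (z⁻¹) ^ j := fun t ht j => by
    rw [← inv_pow, norm_pow]
    gcongr
    exact norm_add_ofReal_inv_le hz ht
  have hone : ∀ t : ℝ, 1 + t ^ 0 = (2 : ℝ) := fun t => by norm_num
  have hzi : 0 < z⁻¹ := by positivity
  have h := integral_stieltjesDensity_mul_adjoint hν
    (φ := fun t => (z : ℂ)⁻¹ - ((z : ℂ) + t)⁻¹) (φ₁ := fun t => (((z : ℂ) + t) ^ 2)⁻¹)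
    (φ₂ := fun t => -2 * (((z : ℂ) + t) ^ 3)⁻¹) (M := z⁻¹ ^ 2 + z⁻¹ ^ 3) (m := 0)
    (fun t ht => ?_) (fun t ht => ?_) ?_ (fun t ht => ?_) (fun t ht => ?_) (fun t ht => ?_)
  · have e : ∀ t ∈ Ioi (0 : ℝ), stieltjesDensity ν t *
        ((ν ^ 2 - 1 / 4) * ((z : ℂ)⁻¹ - ((z : ℂ) + t)⁻¹) / t -
          t * (-2 * (((z : ℂ) + t) ^ 3)⁻¹) + 2 * t * (((z : ℂ) + t) ^ 2)⁻¹) =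
        (ν ^ 2 - 1 / 4) / z ^ 2 * (stieltjesDensity ν t * (t : ℂ) ^ 0 -
          stieltjesDensity ν t * t / ((z : ℂ) + t) ^ 1) +
        (2 * (stieltjesDensity ν t * t / ((z : ℂ) + t) ^ 3) +
        2 * (stieltjesDensity ν t * t / ((z : ℂ) + t) ^ 2)) := by
      intro t ht
      have ht0 : (t : ℂ) ≠ 0 := by exact_mod_cast (ne_of_gt ht : t ≠ 0)
      have hne := add_ofReal_ne_zero hz ht
      field_simp
      ring
    have i0 := integrableOn_stieltjesDensity_mul_pow_of_lt hν 0
    have i1 := integrableOn_stieltjesTransform_integrand hν 1 hz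
    have i2 := integrableOn_stieltjesTransform_integrand hν 2 hz
    have i3 := integrableOn_stieltjesTransform_integrand hν 3 hz
    have i4 : IntegrableOn (fun t : ℝ => (ν ^ 2 - 1 / 4) / z ^ 2 * (stieltjesDensity ν t *
        (t : ℂ) ^ 0 - stieltjesDensity ν t * t / ((z : ℂ) + t) ^ 1)) (Ioi 0) :=
      (i0.sub i1).const_mul _
    have i5 : IntegrableOn (fun t : ℝ => 2 * (stieltjesDensity ν t * t / ((z : ℂ) + t) ^ 3) +
        2 * (stieltjesDensity ν t * t / ((z : ℂ) + t) ^ 2)) (Ioi 0) :=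
      (i3.const_mul 2).add (i2.const_mul 2)
    rw [setIntegral_congr_fun measurableSet_Ioi e, integral_add i4 i5, integral_const_mul,
      integral_sub i0 i1, integral_add (i3.const_mul 2) (i2.const_mul 2), integral_const_mul,
      integral_const_mul] at h
    simp only [stieltjesMoment, stieltjesTransform]
    linear_combination -h
  · have hne := add_ofReal_ne_zero hz ht
    refine (((hd1 t ht).inv hne).const_sub _).congr_deriv ?_
    field_simp
  · have hne := add_ofReal_ne_zero hz ht
    refine (((hd1 t ht).pow 2).inv (pow_ne_zero 2 hne)).congr_deriv ?_
    simp only [Pi.pow_apply]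
    field_simp
    push_cast
    ring
  · refine continuousOn_const.mul (ContinuousOn.inv₀ (by fun_prop) fun t ht =>
      pow_ne_zero _ (add_ofReal_ne_zero hz ht))
  · have hne := add_ofReal_ne_zero hz ht
    have e : (z : ℂ)⁻¹ - ((z : ℂ) + t)⁻¹ = t * ((z : ℂ)⁻¹ * ((z : ℂ) + t)⁻¹) := by
      field_simp
      ring
    rw [e, norm_mul, norm_mul, norm_inv, norm_real, norm_real, Real.norm_of_nonneg ht.le,
      Real.norm_of_nonneg hz.le, hone]
    have h1 := norm_add_ofReal_inv_le hz ht
    calc _ ≤ t * (z⁻¹ * z⁻¹) := by gcongr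
      _ ≤ _ := by
        have : 0 ≤ t * (z⁻¹ ^ 2 + 2 * z⁻¹ ^ 3) := by positivity
        nlinarith
  · rw [hone]
    refine (hinv t ht 2).trans ?_
    have : 0 ≤ z⁻¹ ^ 2 + 2 * z⁻¹ ^ 3 := by positivity
    linarith
  · rw [hone, norm_mul, norm_neg, Complex.norm_two]
    have h1 := hinv t ht 3
    have : 0 ≤ z⁻¹ ^ 2 := by positivity
    linarith

/-- The Stieltjes representation of `√z e^z K_ν(z)` for real orders `|ν| < 1/2`. Both sides solve
the same second-order equation and are bounded at infinity, where the solutions other than the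
multiples of one of them grow like `e^{2z}`; the limits at infinity determine the multiple. -/
theorem sqrt_mul_exp_mul_macdonald_eq {ν : ℝ} (hν : |ν| < 1 / 2) {z : ℝ} (hz : 0 < z) :
    ((Real.sqrt z * Real.exp z : ℝ) : ℂ) * macdonald ν z =
      Complex.cos (Real.pi * ν) / Real.pi *
        (stieltjesMoment ν 0 - stieltjesTransform ν 1 z) := by
  have hνc : |(ν : ℂ).re| < 1 / 2 := by simpa using hν
  set f : ℝ → ℂ := fun z => ((Real.sqrt z * Real.exp z : ℝ) : ℂ) * macdonald ν z with hf
  set f₁ : ℝ → ℂ := fun z => ((Real.sqrt z * Real.exp z : ℝ) : ℂ) *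
    ((1 / (2 * z) + 1) * macdonald ν z + macdonaldDeriv ν z) with hf₁
  set S : ℝ → ℂ := fun z => stieltjesMoment ν 0 - stieltjesTransform ν 1 z with hS
  set S₁ : ℝ → ℂ := stieltjesTransform ν 2 with hS₁
  have hw : ∀ z : ℝ, 0 < z → HasDerivAt (fun z : ℝ => ((Real.sqrt z * Real.exp z : ℝ) : ℂ))
      (((Real.sqrt z * Real.exp z : ℝ) : ℂ) * (1 / (2 * z) + 1)) z := fun z hz => by
    refine (((Real.hasDerivAt_sqrt hz.ne').mul (Real.hasDerivAt_exp z)).ofReal_comp).congr_deriv ?_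
    have hs : Real.sqrt z ≠ 0 := (Real.sqrt_pos.2 hz).ne'
    have e : 1 / (2 * Real.sqrt z) * Real.exp z + Real.sqrt z * Real.exp z =
        Real.sqrt z * Real.exp z * (1 / (2 * z) + 1) := by
      have : z = Real.sqrt z ^ 2 := (Real.sq_sqrt hz.le).symm
      rw [show (1 / (2 * z)) = 1 / (2 * Real.sqrt z ^ 2) by rw [← this]]
      field_simp
    rw [e]; push_cast; ring
  have hk : ∀ z : ℝ, 0 < z → HasDerivAt (macdonald ν) (macdonaldDeriv ν z) z :=
    fun z hz => hasDerivAt_macdonald_up ν hz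
  have hfd : ∀ z : ℝ, 0 < z → HasDerivAt f (f₁ z) z := fun z hz => by
    refine ((hw z hz).mul (hk z hz)).congr_deriv ?_
    simp only [hf₁]
    ring
  have hf₁d : ∀ z : ℝ, 0 < z →
      HasDerivAt f₁ (2 * f₁ z + ((ν : ℂ) ^ 2 - 1 / 4) / z ^ 2 * f z) z := fun z hz => by
    have hz0 : (z : ℂ) ≠ 0 := by exact_mod_cast hz.ne'
    have hinv : HasDerivAt (fun t : ℝ => (1 / (2 * (t : ℂ)) + 1)) (-1 / (2 * (z : ℂ) ^ 2)) z := by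
      have h := (((hasDerivAt_inv hz0).const_mul (1 / 2 : ℂ)).add_const 1).comp_ofReal
      refine (h.congr_deriv (by ring)).congr_of_eventuallyEq (Eventually.of_forall fun x => ?_)
      simp [mul_comm]
    refine ((hw z hz).mul ((hinv.mul (hk z hz)).add
      (hasDerivAt_macdonaldDeriv ν hz))).congr_deriv ?_
    simp only [hf₁, hf, Pi.add_apply, Pi.mul_apply]
    field_simp
    ring
  have hSd : ∀ z : ℝ, 0 < z → HasDerivAt S (S₁ z) z := fun z hz => by
    refine ((hasDerivAt_stieltjesTransform hνc 1 hz).const_sub _).congr_deriv ?_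
    simp [hS₁]
  have hS₁d : ∀ z : ℝ, 0 < z →
      HasDerivAt S₁ (2 * S₁ z + ((ν : ℂ) ^ 2 - 1 / 4) / z ^ 2 * S z) z := fun z hz => by
    refine (hasDerivAt_stieltjesTransform hνc 2 hz).congr_deriv ?_
    have h := stieltjesTransform_ode hνc hz
    simp only [hS, hS₁]
    push_cast
    linear_combination h
  have hflim : Tendsto f atTop (𝓝 (Real.sqrt (Real.pi / 2) : ℂ)) :=
    tendsto_sqrt_mul_exp_mul_macdonald ν
  have hf₁lim : Tendsto f₁ atTop (𝓝 0) := by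
    have h1 := tendsto_sqrt_mul_exp_mul_macdonald ((ν : ℂ) - 1)
    have h2 := tendsto_sqrt_mul_exp_mul_macdonald ((ν : ℂ) + 1)
    have h3 : Tendsto (fun z : ℝ => (1 / (2 * (z : ℂ)))) atTop (𝓝 0) := by
      have h4 : Tendsto (fun z : ℝ => 1 / (2 * z)) atTop (𝓝 0) :=
        tendsto_const_nhds.div_atTop (tendsto_id.const_mul_atTop two_pos)
      have := (continuous_ofReal.tendsto 0).comp h4
      simpa [Function.comp_def] using this
    have h5 := ((h3.add_const 1).mul hflim).sub ((h1.add h2).div_const 2)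
    have e : ((0 : ℂ) + 1) * (Real.sqrt (Real.pi / 2) : ℂ) -
        ((Real.sqrt (Real.pi / 2) : ℂ) + (Real.sqrt (Real.pi / 2) : ℂ)) / 2 = 0 := by ring
    rw [e] at h5
    refine h5.congr' ?_
    filter_upwards [eventually_gt_atTop 0] with z hz
    simp only [hf₁, hf]
    rw [macdonaldDeriv_eq _ hz]
    ring
  have hG : ∀ j : ℕ, 0 < j → Tendsto (stieltjesTransform ν j) atTop (𝓝 0) := fun j hj => by
    have h1 : Tendsto (fun z : ℝ => (∫ t in Ioi (0 : ℝ), ‖stieltjesDensity ν t * t‖) * (z⁻¹) ^ j)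
        atTop (𝓝 0) := by
      have := ((tendsto_inv_atTop_zero (𝕜 := ℝ)).pow j).const_mul
        (∫ t in Ioi (0 : ℝ), ‖stieltjesDensity ν t * t‖)
      rwa [zero_pow hj.ne', mul_zero] at this
    refine squeeze_zero_norm' ?_ h1
    filter_upwards [eventually_gt_atTop 0] with z hz using norm_stieltjesTransform_le hνc j hz
  have hSlim : Tendsto S atTop (𝓝 (stieltjesMoment ν 0)) := by
    simpa using (hG 1 one_pos).const_sub (stieltjesMoment ν 0)
  have hS₁lim : Tendsto S₁ atTop (𝓝 0) := hG 2 two_pos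
  -- the Wronskian is a multiple of `e^{2z}` and bounded, hence zero
  have hW : ∀ z : ℝ, 0 < z → S z * f₁ z - S₁ z * f z = 0 := by
    intro z hz
    have h := eq_of_hasDerivAt_zero_Ioi (l := atTop) (c := 0)
      (f := fun z : ℝ => ((Real.exp (-2 * z) : ℝ) : ℂ) * (S z * f₁ z - S₁ z * f z))
      (fun z hz => ?_) (eventually_gt_atTop 0) ?_ hz
    · exact (mul_eq_zero.1 h).resolve_left (by exact_mod_cast (Real.exp_pos _).ne')
    · have he : HasDerivAt (fun z : ℝ => ((Real.exp (-2 * z) : ℝ) : ℂ))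
          ((Real.exp (-2 * z) * -2 : ℝ) : ℂ) z := by
        have := ((hasDerivAt_id z).const_mul (-2)).exp.ofReal_comp
        simpa using this
      refine (he.mul (((hSd z hz).mul (hf₁d z hz)).sub
        ((hS₁d z hz).mul (hfd z hz)))).congr_deriv ?_
      simp only [Pi.sub_apply, Pi.mul_apply]
      push_cast
      ring
    · have he : Tendsto (fun z : ℝ => ((Real.exp (-2 * z) : ℝ) : ℂ)) atTop (𝓝 0) := by
        have h1 : Tendsto (fun z : ℝ => Real.exp (-2 * z)) atTop (𝓝 0) :=
          Real.tendsto_exp_atBot.comp (tendsto_id.const_mul_atTop_of_neg (by norm_num))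
        have h2 := (continuous_ofReal.tendsto 0).comp h1
        rwa [ofReal_zero] at h2
      simpa using he.mul ((hSlim.mul hf₁lim).sub (hS₁lim.mul hflim))
  have hfne : ∀ z : ℝ, 0 < z → f z ≠ 0 := fun z hz =>
    mul_ne_zero (by exact_mod_cast (mul_pos (Real.sqrt_pos.2 hz) (Real.exp_pos z)).ne')
      (macdonald_ne_zero_of_real ν hz)
  have hpi2 : (Real.sqrt (Real.pi / 2) : ℂ) ≠ 0 := by
    exact_mod_cast (Real.sqrt_pos.2 (by positivity)).ne'
  have hquot := eq_of_hasDerivAt_zero_Ioi (l := atTop) (f := fun z => S z / f z)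
    (fun z hz => (((hSd z hz).div (hfd z hz) (hfne z hz)).congr_deriv (by
      rw [div_eq_zero_iff]; left; linear_combination -hW z hz)))
    (eventually_gt_atTop 0) (hSlim.div hflim hpi2) hz
  rw [stieltjesMoment_zero hνc, mul_div_cancel_left₀ _ hpi2, div_eq_iff (hfne z hz)] at hquot
  have hpi : (Real.pi : ℂ) ≠ 0 := by exact_mod_cast Real.pi_ne_zero
  have hcos : Complex.cos (Real.pi * ν) ≠ 0 := by
    have hb := abs_lt.1 hν
    have := Real.cos_pos_of_mem_Ioo (x := Real.pi * ν)
      ⟨by nlinarith [Real.pi_pos], by nlinarith [Real.pi_pos]⟩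
    rw [← ofReal_mul, ← ofReal_cos]
    exact_mod_cast this.ne'
  change f z = _ * S z
  rw [hquot]
  field_simp

/-! ### The expansion of the Macdonald function with integral remainder -/

/-- The coefficients `a_n(ν) = (4ν² - 1²)(4ν² - 3²) ⋯ (4ν² - (2n-1)²) / (8ⁿ n!)` of the
large-argument expansion of `K_ν`. -/
noncomputable def besselA (n : ℕ) (ν : ℂ) : ℂ :=
  (∏ k ∈ Finset.range n, (4 * ν ^ 2 - (2 * (k : ℂ) + 1) ^ 2)) / (8 ^ n * (n.factorial : ℂ))

theorem besselA_zero (ν : ℂ) : besselA 0 ν = 1 := by simp [besselA]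

theorem besselA_succ (n : ℕ) (ν : ℂ) :
    8 * ((n : ℂ) + 1) * besselA (n + 1) ν = (4 * ν ^ 2 - (2 * (n : ℂ) + 1) ^ 2) * besselA n ν := by
  have hn : ((n : ℂ) + 1) ≠ 0 := by exact_mod_cast Nat.succ_ne_zero n
  have hf : (n.factorial : ℂ) ≠ 0 := by exact_mod_cast n.factorial_ne_zero
  rw [besselA, besselA, Finset.prod_range_succ, Nat.factorial_succ]
  push_cast
  field_simp
  ring

theorem besselA_neg (n : ℕ) (ν : ℂ) : besselA n (-ν) = besselA n ν := by
  simp [besselA]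

theorem prod_shift (n : ℕ) (ν : ℂ) :
    ∏ k ∈ Finset.range (n + 1), (4 * (ν + 1) ^ 2 - (2 * (k : ℂ) + 1) ^ 2) =
      (∏ k ∈ Finset.range n, (4 * ν ^ 2 - (2 * (k : ℂ) + 1) ^ 2)) *
        ((2 * ν + 2 * n + 1) * (2 * ν + 2 * n + 3)) := by
  induction n with
  | zero => simp; ring
  | succ n ih =>
    rw [Finset.prod_range_succ, ih, Finset.prod_range_succ]
    push_cast
    ring

/-- The coefficients of the expansion of `K'_ν` are those induced by
`K'_ν = -(K_{ν-1} + K_{ν+1}) / 2`. -/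
theorem besselB_eq (n : ℕ) (ν : ℂ) :
    besselB n ν = (besselA n (ν - 1) + besselA n (ν + 1)) / 2 := by
  rcases n with _ | n
  · simp [besselB, besselA_zero]
  · rw [← besselA_neg, show -(ν - 1) = -ν + 1 by ring, besselA, besselA, prod_shift, prod_shift,
      besselB]
    simp only [neg_sq]
    ring

/-- The integral `∫ t^{N-1/2} e^{-t} K_ν(t) / (1 + t/z) dt` in the remainder of the expansion of
`K_ν`. -/
noncomputable def stieltjesRemainder (N : ℕ) (ν z : ℂ) : ℂ :=
  ∫ t : ℝ in Ioi 0, ((t ^ ((N : ℝ) - 1 / 2) * Real.exp (-t) : ℝ) : ℂ) / (1 + (t : ℂ) / z) *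
    macdonald ν t

/-- The truncated large-argument expansion of `K_ν` with its remainder in integral form. -/
noncomputable def macdonaldExpansion (N : ℕ) (ν z : ℂ) : ℂ :=
  ((Real.pi : ℂ) / (2 * z)) ^ (1 / 2 : ℂ) * Complex.exp (-z) *
    (∑ n ∈ Finset.range N, besselA n ν / z ^ n +
      (-1) ^ N * (Real.sqrt (2 / Real.pi) : ℂ) * (Complex.cos (Real.pi * ν) / (Real.pi : ℂ)) *
        (1 / z ^ N) * stieltjesRemainder N ν z)

theorem one_add_div_ne_zero {z : ℂ} (hz : z ∈ slitPlane) {t : ℝ} (ht : 0 < t) :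
    1 + (t : ℂ) / z ≠ 0 := by
  intro h
  have hz0 := slitPlane_ne_zero hz
  have : z = ((-t : ℝ) : ℂ) := by
    field_simp at h
    push_cast
    linear_combination h
  rw [this, ofReal_mem_slitPlane] at hz
  linarith

/-- On a neighbourhood of a point of the cut plane, the Stieltjes kernel `1 / (1 + t / w)` is
bounded uniformly in `t`. -/
theorem exists_bound_stieltjesKernel {z : ℂ} (hz : z ∈ slitPlane) :
    ∃ r > 0, Metric.closedBall z r ⊆ slitPlane ∧ ∃ M : ℝ, 0 ≤ M ∧ ∀ w ∈ Metric.closedBall z r,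
      ∀ t : ℝ, 0 < t → ‖(1 + (t : ℂ) / w)⁻¹‖ ≤ M := by
  obtain ⟨ε, hε, hsub⟩ := Metric.isOpen_iff.1 isOpen_slitPlane z hz
  refine ⟨ε / 2, by positivity,
    (Metric.closedBall_subset_ball (by linarith)).trans hsub, (‖z‖ + ε) / (ε / 2), by positivity,
    fun w hw t ht => ?_⟩
  have hwε : dist w z ≤ ε / 2 := hw
  have hws : w ∈ slitPlane := hsub (Metric.mem_ball.2 (by linarith))
  have hw0 := slitPlane_ne_zero hws
  have hfar : ε / 2 ≤ ‖w + t‖ := by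
    by_contra hcon
    have hmem : ((-t : ℝ) : ℂ) ∈ Metric.ball z ε := by
      rw [Metric.mem_ball]
      refine (dist_triangle _ w _).trans_lt ?_
      have h1 : dist ((-t : ℝ) : ℂ) w = ‖w + t‖ := by
        rw [dist_comm, dist_eq_norm]
        congr 1
        push_cast
        ring
      rw [h1]
      linarith [not_le.1 hcon]
    have := ofReal_mem_slitPlane.1 (hsub hmem)
    linarith
  have e : (1 + (t : ℂ) / w)⁻¹ = w / (w + t) := by
    have := one_add_div_ne_zero hws ht
    have h3 : w + t ≠ 0 := fun h => by
      rw [h, norm_zero] at hfar; linarith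
    field_simp
  rw [e, norm_div]
  have hwn : ‖w‖ ≤ ‖z‖ + ε := by
    have := norm_sub_norm_le w z
    rw [dist_eq_norm] at hwε
    linarith
  gcongr

theorem aestronglyMeasurable_stieltjesRemainder_integrand (N : ℕ) (ν : ℂ) {z : ℂ}
    (hz : z ∈ slitPlane) :
    AEStronglyMeasurable (fun t : ℝ => ((t ^ ((N : ℝ) - 1 / 2) * Real.exp (-t) : ℝ) : ℂ) /
      (1 + (t : ℂ) / z) * macdonald ν t) (volume.restrict (Ioi 0)) := by
  refine ContinuousOn.aestronglyMeasurable ?_ measurableSet_Ioi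
  have h := (continuousOn_rpow_exp_macdonald ((N : ℝ) - 1 / 2) ν).div
    (by fun_prop : ContinuousOn (fun t : ℝ => 1 + (t : ℂ) / z) (Ioi 0))
    (fun t ht => one_add_div_ne_zero hz ht)
  exact h.congr fun t _ => by rw [Pi.div_apply]; ring

theorem norm_stieltjesRemainder_integrand_le (N : ℕ) (ν z : ℂ) {M : ℝ} (hM : 0 ≤ M) {t B : ℝ}
    (h : ‖(1 + (t : ℂ) / z)⁻¹‖ ≤ M)
    (hB : ‖((t ^ ((N : ℝ) - 1 / 2) * Real.exp (-t) : ℝ) : ℂ) * macdonald ν t‖ ≤ B) :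
    ‖((t ^ ((N : ℝ) - 1 / 2) * Real.exp (-t) : ℝ) : ℂ) / (1 + (t : ℂ) / z) * macdonald ν t‖ ≤
      M * B := by
  rw [div_eq_mul_inv, mul_right_comm, norm_mul, mul_comm]
  exact mul_le_mul h hB (norm_nonneg _) hM

theorem integrableOn_stieltjesRemainder_integrand {N : ℕ} {ν z : ℂ}
    (hν : |ν.re| < (N : ℝ) + 1 / 2) (hz : z ∈ slitPlane) :
    IntegrableOn (fun t : ℝ => ((t ^ ((N : ℝ) - 1 / 2) * Real.exp (-t) : ℝ) : ℂ) /
      (1 + (t : ℂ) / z) * macdonald ν t) (Ioi 0) := by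
  obtain ⟨r, hr, -, M, hM, hle⟩ := exists_bound_stieltjesKernel hz
  have h := integrableOn_rpow_exp_macdonald (r := (N : ℝ) - 1 / 2) (ν := ν) (by linarith)
  refine (h.norm.const_mul M).mono' (aestronglyMeasurable_stieltjesRemainder_integrand N ν hz) ?_
  filter_upwards [ae_restrict_mem measurableSet_Ioi] with t ht
  exact norm_stieltjesRemainder_integrand_le N ν z hM
    (hle z (Metric.mem_closedBall_self hr.le) t ht) le_rfl

theorem differentiableOn_stieltjesRemainder {N : ℕ} {ν : ℂ} (hν : |ν.re| < (N : ℝ) + 1 / 2) :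
    DifferentiableOn ℂ (stieltjesRemainder N ν) slitPlane := by
  have h := integrableOn_rpow_exp_macdonald (r := (N : ℝ) - 1 / 2) (ν := ν) (by linarith)
  refine differentiableOn_integral_of_dominated
    (fun w hw => aestronglyMeasurable_stieltjesRemainder_integrand N ν hw) ?_ fun z hz => ?_
  · filter_upwards [ae_restrict_mem measurableSet_Ioi] with t ht
    intro w hw
    have h0 := slitPlane_ne_zero hw
    have h1 := one_add_div_ne_zero hw ht
    exact DifferentiableAt.differentiableWithinAt (by fun_prop (disch := assumption))
  · obtain ⟨r, hr, hsub, M, hM, hle⟩ := exists_bound_stieltjesKernel hz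
    refine ⟨r, hr, hsub, _, h.norm.const_mul M, ?_⟩
    filter_upwards [ae_restrict_mem measurableSet_Ioi] with t ht w hw
    exact norm_stieltjesRemainder_integrand_le N ν w hM (hle w hw t ht) le_rfl

theorem isOpen_orderStrip (c : ℝ) : IsOpen {ν : ℂ | |ν.re| < c} :=
  isOpen_lt (by fun_prop) continuous_const

theorem isPreconnected_orderStrip (c : ℝ) : IsPreconnected {ν : ℂ | |ν.re| < c} := by
  have h : Convex ℝ (re ⁻¹' Ioo (-c) c) := (convex_Ioo (-c) c).is_linear_preimage reLm.isLinear
  have e : {ν : ℂ | |ν.re| < c} = re ⁻¹' Ioo (-c) c := by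
    ext ν; simp [abs_lt]
  rw [e]
  exact h.isPreconnected

theorem differentiableOn_stieltjesRemainder_order (N : ℕ) {z : ℂ} (hz : z ∈ slitPlane) :
    DifferentiableOn ℂ (fun ν => stieltjesRemainder N ν z) {ν : ℂ | |ν.re| < (N : ℝ) + 1 / 2} := by
  obtain ⟨r₁, hr₁, -, M, hM, hle⟩ := exists_bound_stieltjesKernel hz
  have hker := hle z (Metric.mem_closedBall_self hr₁.le)
  refine differentiableOn_integral_of_dominated
    (fun w _ => aestronglyMeasurable_stieltjesRemainder_integrand N w hz) ?_ fun ν hν => ?_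
  · filter_upwards [ae_restrict_mem measurableSet_Ioi] with t ht
    exact ((differentiable_macdonald ht).const_mul _).differentiableOn
  · obtain ⟨σ, hσ1, hσ2⟩ := exists_between (show |ν.re| < (N : ℝ) + 1 / 2 from hν)
    have hball : ∀ w ∈ Metric.closedBall ν (σ - |ν.re|), |w.re| ≤ σ := fun w hw => by
      have h1 : ‖w - ν‖ ≤ σ - |ν.re| := by simpa [dist_eq_norm] using hw
      have h2 := (Complex.abs_re_le_norm (w - ν)).trans h1
      rw [sub_re] at h2
      have h3 := abs_sub_abs_le_abs_sub w.re ν.re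
      linarith
    obtain ⟨B, hB, hBle⟩ := exists_bound_rpow_exp_macdonald (r := (N : ℝ) - 1 / 2)
      ((abs_nonneg _).trans hσ1.le) (by linarith)
    refine ⟨σ - |ν.re|, sub_pos.2 hσ1, fun w hw => lt_of_le_of_lt (hball w hw) hσ2,
      _, hB.const_mul M, ?_⟩
    filter_upwards [ae_restrict_mem measurableSet_Ioi] with t ht w hw
    exact norm_stieltjesRemainder_integrand_le N w z hM (hker t ht) (hBle w (hball w hw) t ht)

theorem pi_div_two_mul_mem_slitPlane {z : ℂ} (hz : z ∈ slitPlane) :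
    (Real.pi : ℂ) / (2 * z) ∈ slitPlane := by
  have h : (Real.pi : ℂ) / (2 * z) = ((Real.pi / 2 : ℝ) : ℂ) * z⁻¹ := by
    push_cast
    rw [div_mul_eq_div_div, div_eq_mul_inv]
  have h1 : z⁻¹ ∈ slitPlane := by
    have hn : 0 < normSq z := normSq_pos.2 (slitPlane_ne_zero hz)
    rw [mem_slitPlane_iff, inv_re, inv_im]
    rcases mem_slitPlane_iff.1 hz with h2 | h2
    · exact Or.inl (div_pos h2 hn)
    · exact Or.inr (div_ne_zero (neg_ne_zero.2 h2) hn.ne')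
  have hp : 0 < Real.pi / 2 := by positivity
  rw [h, mem_slitPlane_iff, re_ofReal_mul, im_ofReal_mul]
  rcases mem_slitPlane_iff.1 h1 with h2 | h2
  · exact Or.inl (mul_pos hp h2)
  · exact Or.inr (mul_ne_zero hp.ne' h2)

theorem differentiableOn_macdonaldExpansion {N : ℕ} {ν : ℂ} (hν : |ν.re| < (N : ℝ) + 1 / 2) :
    DifferentiableOn ℂ (macdonaldExpansion N ν) slitPlane := by
  intro z hz
  have h0 := slitPlane_ne_zero hz
  have h1 := pi_div_two_mul_mem_slitPlane hz
  have h2 : DifferentiableAt ℂ (stieltjesRemainder N ν) z :=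
    (differentiableOn_stieltjesRemainder hν).differentiableAt (isOpen_slitPlane.mem_nhds hz)
  have h3 : (2 * z) ≠ 0 := mul_ne_zero two_ne_zero h0
  have h4 : DifferentiableAt ℂ (fun z : ℂ => ((Real.pi : ℂ) / (2 * z)) ^ (1 / 2 : ℂ)) z :=
    DifferentiableAt.cpow_const (by fun_prop (disch := assumption)) h1
  have h5 : ∀ n : ℕ, z ^ n ≠ 0 := fun n => pow_ne_zero n h0
  have h6 : DifferentiableAt ℂ (fun z : ℂ => ∑ n ∈ Finset.range N, besselA n ν / z ^ n) z :=
    DifferentiableAt.fun_sum fun n _ => (differentiableAt_const _).div (by fun_prop) (h5 n)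
  have h7 : DifferentiableAt ℂ (fun z : ℂ => 1 / z ^ N) z :=
    (differentiableAt_const _).div (by fun_prop) (h5 N)
  exact ((h4.mul (by fun_prop)).mul (h6.add ((h7.const_mul _).mul h2))).differentiableWithinAt

theorem differentiable_besselA (n : ℕ) : Differentiable ℂ (besselA n) := by
  unfold besselA
  fun_prop

theorem differentiableOn_macdonaldExpansion_order (N : ℕ) {z : ℂ} (hz : z ∈ slitPlane) :
    DifferentiableOn ℂ (fun ν => macdonaldExpansion N ν z) {ν : ℂ | |ν.re| < (N : ℝ) + 1 / 2} := by
  have h1 := differentiableOn_stieltjesRemainder_order N hz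
  have h2 : Differentiable ℂ (fun ν : ℂ => ∑ n ∈ Finset.range N, besselA n ν / z ^ n) :=
    Differentiable.fun_sum fun n _ => (differentiable_besselA n).div_const _
  have h3 : Differentiable ℂ (fun ν : ℂ => (-1) ^ N * (Real.sqrt (2 / Real.pi) : ℂ) *
      (Complex.cos (Real.pi * ν) / (Real.pi : ℂ)) * (1 / z ^ N)) := by fun_prop
  exact (h2.differentiableOn.add (h3.differentiableOn.mul h1)).const_mul _

/-- The moments reproduce the coefficients of the expansion: both satisfy the same recursion. -/
theorem cos_mul_stieltjesMoment {ν : ℝ} (hν : |ν| < 1 / 2) (n : ℕ) :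
    (-1) ^ n * (Complex.cos (Real.pi * ν) / Real.pi) * stieltjesMoment ν n =
      (Real.sqrt (Real.pi / 2) : ℂ) * besselA n ν := by
  have hνc : |(ν : ℂ).re| < 1 / 2 := by simpa using hν
  have hpi : (Real.pi : ℂ) ≠ 0 := by exact_mod_cast Real.pi_ne_zero
  induction n with
  | zero =>
    have hcos : Complex.cos (Real.pi * ν) ≠ 0 := by
      have hb := abs_lt.1 hν
      have := Real.cos_pos_of_mem_Ioo (x := Real.pi * ν)
        ⟨by nlinarith [Real.pi_pos], by nlinarith [Real.pi_pos]⟩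
      rw [← ofReal_mul, ← ofReal_cos]
      exact_mod_cast this.ne'
    rw [stieltjesMoment_zero hνc, besselA_zero]
    field_simp
  | succ n ih =>
    have h1 := stieltjesMoment_succ hνc n
    have h2 := besselA_succ n (ν : ℂ)
    have hn : 8 * ((n : ℂ) + 1) ≠ 0 :=
      mul_ne_zero (by norm_num) (by exact_mod_cast Nat.succ_ne_zero n)
    apply mul_left_cancel₀ hn
    rw [pow_succ]
    linear_combination (4 * (-1) ^ n * (-1) * (Complex.cos (Real.pi * ν) / Real.pi)) * h1 -
      (Real.sqrt (Real.pi / 2) : ℂ) * h2 + (4 * (ν : ℂ) ^ 2 - (2 * (n : ℂ) + 1) ^ 2) * ih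

theorem stieltjesRemainder_integrand_eq (N : ℕ) (ν : ℂ) (z : ℂ) {t : ℝ} (ht : 0 < t) :
    ((t ^ ((N : ℝ) - 1 / 2) * Real.exp (-t) : ℝ) : ℂ) / (1 + (t : ℂ) / z) * macdonald ν t =
      stieltjesDensity ν t * (t : ℂ) ^ N / (1 + (t : ℂ) / z) := by
  rw [stieltjesDensity_mul_pow ν N ht]
  ring

/-- Expanding the Stieltjes kernel by one more term. -/
theorem stieltjesRemainder_step {ν : ℂ} (hν : |ν.re| < 1 / 2) (N : ℕ) {z : ℂ}
    (hz : z ∈ slitPlane) :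
    stieltjesRemainder N ν z = stieltjesMoment ν N - 1 / z * stieltjesRemainder (N + 1) ν z := by
  have hz0 := slitPlane_ne_zero hz
  have hN : (0 : ℝ) ≤ N := N.cast_nonneg
  have i1 := integrableOn_stieltjesDensity_mul_pow_of_lt hν N
  have i2 := integrableOn_stieltjesRemainder_integrand (N := N + 1) (ν := ν)
    (by push_cast; linarith) hz
  rw [stieltjesRemainder, stieltjesRemainder, stieltjesMoment, ← integral_const_mul,
    ← integral_sub i1 (i2.const_mul _)]
  refine setIntegral_congr_fun measurableSet_Ioi fun t ht => ?_
  have h1 := one_add_div_ne_zero hz ht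
  rw [stieltjesRemainder_integrand_eq N ν z ht, stieltjesRemainder_integrand_eq (N + 1) ν z ht]
  have e : (1 + (t : ℂ) / z) * (1 + (t : ℂ) / z)⁻¹ = 1 := mul_inv_cancel₀ h1
  rw [div_eq_mul_inv, div_eq_mul_inv, pow_succ]
  linear_combination (stieltjesDensity ν t * (t : ℂ) ^ N) * e

theorem stieltjesRemainder_zero {ν : ℂ} (hν : |ν.re| < 1 / 2) {z : ℝ} (hz : 0 < z) :
    stieltjesRemainder 0 ν z = stieltjesMoment ν 0 - stieltjesTransform ν 1 z := by
  rw [stieltjesRemainder, stieltjesMoment, stieltjesTransform,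
    ← integral_sub (integrableOn_stieltjesDensity_mul_pow_of_lt hν 0)
      (integrableOn_stieltjesTransform_integrand hν 1 hz)]
  refine setIntegral_congr_fun measurableSet_Ioi fun t ht => ?_
  have hz0 : (z : ℂ) ≠ 0 := by exact_mod_cast hz.ne'
  have h1 := one_add_div_ne_zero (ofReal_mem_slitPlane.2 hz) ht
  have h2 := add_ofReal_ne_zero hz ht
  rw [stieltjesRemainder_integrand_eq 0 ν z ht]
  field_simp
  ring

theorem macdonald_eq_expansion_of_real {ν : ℝ} (hν : |ν| < 1 / 2) (N : ℕ) {z : ℝ} (hz : 0 < z) :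
    macdonald ν z = macdonaldExpansion N ν z := by
  have hνc : |(ν : ℂ).re| < 1 / 2 := by simpa using hν
  have hzs : (z : ℂ) ∈ slitPlane := ofReal_mem_slitPlane.2 hz
  have hz0 : (z : ℂ) ≠ 0 := slitPlane_ne_zero hzs
  have hf : ((Real.sqrt z * Real.exp z : ℝ) : ℂ) * macdonald ν z =
      (Real.sqrt (Real.pi / 2) : ℂ) * ∑ n ∈ Finset.range N, besselA n ν / (z : ℂ) ^ n +
      (-1) ^ N * (Complex.cos (Real.pi * ν) / Real.pi) * (1 / (z : ℂ) ^ N) *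
        stieltjesRemainder N ν z := by
    induction N with
    | zero =>
      rw [sqrt_mul_exp_mul_macdonald_eq hν hz, stieltjesRemainder_zero hνc hz]
      simp
    | succ N ih =>
      rw [ih, Finset.sum_range_succ, stieltjesRemainder_step hνc N hzs, pow_succ, pow_succ]
      have h := cos_mul_stieltjesMoment hν N
      rw [mul_sub]
      have e : (-1) ^ N * (Complex.cos (Real.pi * ν) / Real.pi) * (1 / (z : ℂ) ^ N) *
          stieltjesMoment ν N = (Real.sqrt (Real.pi / 2) : ℂ) * (besselA N ν / (z : ℂ) ^ N) := by
        linear_combination (1 / (z : ℂ) ^ N) * h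
      rw [e]
      field_simp
      ring
  have hs : 0 < Real.sqrt z := Real.sqrt_pos.2 hz
  have hw : ((Real.sqrt z * Real.exp z : ℝ) : ℂ) ≠ 0 := by
    exact_mod_cast (mul_pos hs (Real.exp_pos z)).ne'
  have hpow : ((Real.pi : ℂ) / (2 * z)) ^ (1 / 2 : ℂ) =
      ((Real.sqrt (Real.pi / 2) / Real.sqrt z : ℝ) : ℂ) := by
    rw [← Real.sqrt_div (by positivity), Real.sqrt_eq_rpow, ofReal_cpow (by positivity)]
    push_cast
    rw [div_mul_eq_div_div]
  have hone : (Real.sqrt (Real.pi / 2) : ℂ) * (Real.sqrt (2 / Real.pi) : ℂ) = 1 := by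
    rw [← ofReal_mul, ← Real.sqrt_mul (by positivity), div_mul_div_comm, mul_comm Real.pi 2,
      div_self (by positivity), Real.sqrt_one, ofReal_one]
  have hexp : Complex.exp (-z) * (Real.exp z : ℝ) = 1 := by
    rw [ofReal_exp, ← Complex.exp_add, neg_add_cancel, Complex.exp_zero]
  have hsq : ((Real.sqrt z : ℝ) : ℂ) ≠ 0 := by exact_mod_cast hs.ne'
  apply mul_left_cancel₀ hw
  rw [hf, macdonaldExpansion, hpow]
  push_cast
  set A : ℂ := ∑ n ∈ Finset.range N, besselA n ν / (z : ℂ) ^ n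
  set T : ℂ := Complex.cos (Real.pi * ν) / Real.pi * (1 / (z : ℂ) ^ N) * stieltjesRemainder N ν z
    with hT
  have e1 : ((Real.sqrt z : ℝ) : ℂ) * cexp z *
      ((Real.sqrt (Real.pi / 2) : ℂ) / (Real.sqrt z : ℂ) * cexp (-z) *
      (A + (-1) ^ N * (Real.sqrt (2 / Real.pi) : ℂ) * (Complex.cos (Real.pi * ν) / Real.pi) *
        (1 / (z : ℂ) ^ N) * stieltjesRemainder N ν z)) =
      (Complex.exp (-z) * (Real.exp z : ℝ)) * ((Real.sqrt (Real.pi / 2) : ℂ) * A + (-1) ^ N *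
        ((Real.sqrt (Real.pi / 2) : ℂ) * (Real.sqrt (2 / Real.pi) : ℂ)) * T) := by
    rw [hT, ofReal_exp]
    field_simp
  rw [e1, hexp, hone, hT]
  ring

/-- The expansion of `K_ν` on the positive axis, from real orders `0 < ν < 1/2` to the whole strip
by analytic continuation in the order. -/
theorem macdonald_eq_expansion {N : ℕ} {ν : ℂ} (hν : |ν.re| < (N : ℝ) + 1 / 2) {z : ℝ}
    (hz : 0 < z) : macdonald ν z = macdonaldExpansion N ν z := by
  have hN : (0 : ℝ) ≤ N := N.cast_nonneg
  refine eqOn_of_eq_on_real_interval (isOpen_orderStrip ((N : ℝ) + 1 / 2))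
    (isPreconnected_orderStrip _) (f := fun ν => macdonald ν z)
    (g := fun ν => macdonaldExpansion N ν z) (differentiable_macdonald hz).differentiableOn
    (differentiableOn_macdonaldExpansion_order N (ofReal_mem_slitPlane.2 hz))
    (by norm_num : (0 : ℝ) < 1 / 2) (fun x hx => ?_) (fun x hx => ?_) hν
  · have h : |(x : ℂ).re| < (N : ℝ) + 1 / 2 := by
      rw [ofReal_re, abs_of_pos hx.1]
      linarith [hx.2]
    exact h
  · exact macdonald_eq_expansion_of_real (by rw [abs_of_pos hx.1]; exact hx.2) N hz

/-! ### The function `K_ν` and its derivative on the cut plane -/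

/-- Away from a given order, all nearby orders are non-integral. -/
theorem eventually_not_int (ν : ℂ) : ∀ᶠ μ in 𝓝[≠] ν, ¬ ∃ n : ℤ, μ = (n : ℂ) := by
  have hd : DifferentiableOn ℂ (fun μ : ℂ => Complex.sin (Real.pi * μ)) univ := by fun_prop
  have han := hd.analyticOnNhd isOpen_univ
  rcases (han ν (mem_univ _)).eventually_eq_zero_or_eventually_ne_zero with h | h
  · have hz := han.eqOn_zero_of_preconnected_of_eventuallyEq_zero isPreconnected_univ
      (mem_univ ν) h (mem_univ (1 / 2 : ℂ))
    have h1 : Complex.sin (Real.pi * (1 / 2)) = 1 := by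
      rw [mul_one_div, Complex.sin_pi_div_two]
    simp only [h1, Pi.zero_apply] at hz
    exact absurd hz one_ne_zero
  · filter_upwards [h] with μ hμ
    rintro ⟨n, rfl⟩
    apply hμ
    rw [mul_comm]
    exact Complex.sin_int_mul_pi n

theorem besselK_of_not_int {ν : ℂ} (h : ¬ ∃ n : ℤ, ν = (n : ℂ)) (z : ℂ) :
    besselK ν z =
      (Real.pi : ℂ) / 2 * (besselI (-ν) z - besselI ν z) / Complex.sin (Real.pi * ν) := by
  rw [besselK, if_neg h]

theorem besselK_eq_expansion_of_not_int {N : ℕ} {ν : ℂ} (hν : |ν.re| < (N : ℝ) + 1 / 2)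
    (h : ¬ ∃ n : ℤ, ν = (n : ℂ)) {z : ℂ} (hz : z ∈ slitPlane) :
    besselK ν z = macdonaldExpansion N ν z := by
  have hI : ∀ μ : ℂ, DifferentiableOn ℂ (besselI μ) slitPlane := fun μ w hw =>
    (hasDerivAt_besselI μ hw).differentiableAt.differentiableWithinAt
  refine eqOn_of_eq_on_real_interval isOpen_slitPlane isPreconnected_slitPlane
    (f := besselK ν) (g := macdonaldExpansion N ν) ?_ (differentiableOn_macdonaldExpansion hν)
    (zero_lt_one' ℝ) (fun x hx => ofReal_mem_slitPlane.2 hx.1) (fun x hx => ?_) hz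
  · exact ((((hI (-ν)).sub (hI ν)).const_mul _).div_const _).congr
      fun w _ => besselK_of_not_int h w
  · rw [besselK_of_not_int h, ← sin_mul_macdonald ν hx.1,
      mul_div_cancel_left₀ _ (sin_pi_mul_ne_zero fun ⟨n, hn⟩ => h ⟨n, hn.symm⟩),
      macdonald_eq_expansion hν hx.1]

/-- The expansion of `K_ν` on the cut plane. For integral orders the limit in the definition of
`K_ν` is evaluated by continuity of the expansion in the order. -/
theorem besselK_eq_expansion {N : ℕ} {ν : ℂ} (hν : |ν.re| < (N : ℝ) + 1 / 2) {z : ℂ}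
    (hz : z ∈ slitPlane) : besselK ν z = macdonaldExpansion N ν z := by
  by_cases h : ∃ n : ℤ, ν = (n : ℂ)
  · rw [besselK, if_pos h]
    apply Tendsto.limUnder_eq
    have hnhds := (isOpen_orderStrip ((N : ℝ) + 1 / 2)).mem_nhds (show ν ∈ _ from hν)
    have hc : Tendsto (fun μ => macdonaldExpansion N μ z) (𝓝[≠] ν)
        (𝓝 (macdonaldExpansion N ν z)) :=
      (((differentiableOn_macdonaldExpansion_order N hz).differentiableAt
        hnhds).continuousAt.tendsto).mono_left nhdsWithin_le_nhds
    refine hc.congr' ?_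
    filter_upwards [eventually_not_int ν, nhdsWithin_le_nhds hnhds] with μ hμ hμs
    rw [← besselK_of_not_int hμ, besselK_eq_expansion_of_not_int hμs hμ hz]
  · exact besselK_eq_expansion_of_not_int hν h hz

theorem exists_nat_orderStrip (ν : ℂ) : ∃ N : ℕ, |ν.re| < (N : ℝ) + 1 / 2 := by
  obtain ⟨N, hN⟩ := exists_nat_gt |ν.re|
  exact ⟨N, by linarith⟩

theorem besselK_ofReal (ν : ℂ) {t : ℝ} (ht : 0 < t) : besselK ν t = macdonald ν t := by
  obtain ⟨N, hN⟩ := exists_nat_orderStrip ν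
  rw [besselK_eq_expansion hN (ofReal_mem_slitPlane.2 ht), macdonald_eq_expansion hN ht]

theorem differentiableOn_besselK (ν : ℂ) : DifferentiableOn ℂ (besselK ν) slitPlane := by
  obtain ⟨N, hN⟩ := exists_nat_orderStrip ν
  exact (differentiableOn_macdonaldExpansion hN).congr fun z hz => besselK_eq_expansion hN hz

theorem continuous_besselK_order {z : ℂ} (hz : z ∈ slitPlane) :
    Continuous (fun ν => besselK ν z) := by
  refine continuous_iff_continuousAt.2 fun ν => ?_
  obtain ⟨N, hN⟩ := exists_nat_orderStrip ν
  have hnhds := (isOpen_orderStrip ((N : ℝ) + 1 / 2)).mem_nhds (show ν ∈ _ from hN)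
  refine (((differentiableOn_macdonaldExpansion_order N hz).differentiableAt
    hnhds).continuousAt).congr ?_
  filter_upwards [hnhds] with μ hμ using (besselK_eq_expansion hμ hz).symm

/-- `K'_ν = -(K_{ν-1} + K_{ν+1}) / 2` on the cut plane. -/
theorem besselK'_eq (ν : ℂ) {z : ℂ} (hz : z ∈ slitPlane) :
    besselK' ν z = -(besselK (ν - 1) z + besselK (ν + 1) z) / 2 := by
  refine eqOn_of_eq_on_real_interval isOpen_slitPlane isPreconnected_slitPlane
    (f := besselK' ν) (g := fun z => -(besselK (ν - 1) z + besselK (ν + 1) z) / 2)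
    ((differentiableOn_besselK ν).deriv isOpen_slitPlane)
    ((((differentiableOn_besselK _).add (differentiableOn_besselK _)).neg).div_const _)
    (zero_lt_one' ℝ) (fun x hx => ofReal_mem_slitPlane.2 hx.1) (fun x hx => ?_) hz
  have h1 : HasDerivAt (besselK ν) (besselK' ν x) (x : ℂ) :=
    ((differentiableOn_besselK ν).differentiableAt
      (isOpen_slitPlane.mem_nhds (ofReal_mem_slitPlane.2 hx.1))).hasDerivAt
  have h2 : HasDerivAt (macdonald ν) (besselK' ν x) x := by
    refine h1.comp_ofReal.congr_of_eventuallyEq ?_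
    filter_upwards [Ioi_mem_nhds hx.1] with t ht using (besselK_ofReal ν ht).symm
  rw [h2.unique (hasDerivAt_macdonald ν hx.1), besselK_ofReal _ hx.1, besselK_ofReal _ hx.1]

theorem mem_slitPlane_of_abs_arg_lt {z : ℂ} (hz : z ≠ 0) (h : |z.arg| < Real.pi) :
    z ∈ slitPlane :=
  mem_slitPlane_iff_arg.2 ⟨fun h' => by rw [h', abs_of_pos Real.pi_pos] at h; exact lt_irrefl _ h,
    hz⟩

theorem abs_re_sub_one_lt {N : ℕ} {ν : ℂ} (hν : |ν.re| < (N : ℝ) - 1 / 2) :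
    |(ν - 1).re| < (N : ℝ) + 1 / 2 := by
  rw [sub_re, one_re]
  have := abs_lt.1 hν
  exact abs_lt.2 ⟨by linarith, by linarith⟩

theorem abs_re_add_one_lt {N : ℕ} {ν : ℂ} (hν : |ν.re| < (N : ℝ) - 1 / 2) :
    |(ν + 1).re| < (N : ℝ) + 1 / 2 := by
  rw [add_re, one_re]
  have := abs_lt.1 hν
  exact abs_lt.2 ⟨by linarith, by linarith⟩

theorem remK'_integrand_eq (N : ℕ) (ν z : ℂ) {t : ℝ} (ht : 0 < t) :
    ((t ^ ((N : ℝ) - 1 / 2) * Real.exp (-t) : ℝ) : ℂ) / (1 + (t : ℂ) / z) * besselK' ν (t : ℂ) =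
      -(1 / 2) * (((t ^ ((N : ℝ) - 1 / 2) * Real.exp (-t) : ℝ) : ℂ) / (1 + (t : ℂ) / z) *
        macdonald (ν - 1) t + ((t ^ ((N : ℝ) - 1 / 2) * Real.exp (-t) : ℝ) : ℂ) /
        (1 + (t : ℂ) / z) * macdonald (ν + 1) t) := by
  rw [besselK'_eq ν (ofReal_mem_slitPlane.2 ht), besselK_ofReal _ ht, besselK_ofReal _ ht]
  ring

theorem integrableOn_remK'_integrand {N : ℕ} {ν z : ℂ} (hν : |ν.re| < (N : ℝ) - 1 / 2)
    (hz : z ∈ slitPlane) :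
    IntegrableOn (fun t : ℝ => ((t ^ ((N : ℝ) - 1 / 2) * Real.exp (-t) : ℝ) : ℂ) /
      (1 + (t : ℂ) / z) * besselK' ν (t : ℂ)) (Ioi 0) := by
  have i1 := integrableOn_stieltjesRemainder_integrand (abs_re_sub_one_lt hν) hz
  have i2 := integrableOn_stieltjesRemainder_integrand (abs_re_add_one_lt hν) hz
  exact IntegrableOn.congr_fun ((i1.add i2).const_mul (-(1 / 2 : ℂ)))
    (fun t ht => (remK'_integrand_eq N ν z ht).symm) measurableSet_Ioi

theorem integral_remK'_integrand {N : ℕ} {ν z : ℂ} (hν : |ν.re| < (N : ℝ) - 1 / 2)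
    (hz : z ∈ slitPlane) :
    ∫ t : ℝ in Ioi 0, ((t ^ ((N : ℝ) - 1 / 2) * Real.exp (-t) : ℝ) : ℂ) /
      (1 + (t : ℂ) / z) * besselK' ν (t : ℂ) =
      -(1 / 2) * (stieltjesRemainder N (ν - 1) z + stieltjesRemainder N (ν + 1) z) := by
  have i1 := integrableOn_stieltjesRemainder_integrand (abs_re_sub_one_lt hν) hz
  have i2 := integrableOn_stieltjesRemainder_integrand (abs_re_add_one_lt hν) hz
  rw [setIntegral_congr_fun measurableSet_Ioi fun t ht => remK'_integrand_eq N ν z ht,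
    integral_const_mul, integral_add i1 i2, stieltjesRemainder, stieltjesRemainder]

/-- The remainder of the expansion of `K'_ν`, from those of `K_{ν-1}` and `K_{ν+1}`. The hypothesis
`|Re ν| < N - 1/2` is what places both shifted orders in the strip `|Re| < N + 1/2`. -/
theorem remK'_eq {N : ℕ} {ν z : ℂ} (hν : |ν.re| < (N : ℝ) - 1 / 2) (hz : z ∈ slitPlane) :
    remK' N z ν = (-1) ^ N * (Real.sqrt (2 / Real.pi) : ℂ) *
      (Complex.cos (Real.pi * ν) / (Real.pi : ℂ)) * (1 / z ^ N) *
      ∫ t : ℝ in Ioi 0, ((t ^ ((N : ℝ) - 1 / 2) * Real.exp (-t) : ℝ) : ℂ) /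
        (1 + (t : ℂ) / z) * besselK' ν (t : ℂ) := by
  have hz0 := slitPlane_ne_zero hz
  have hpi : (Real.pi : ℂ) ≠ 0 := by exact_mod_cast Real.pi_ne_zero
  have hpre : ((Real.pi : ℂ) / (2 * z)) ^ (1 / 2 : ℂ) * Complex.exp (-z) ≠ 0 := by
    refine mul_ne_zero ?_ (Complex.exp_ne_zero _)
    simp [Complex.cpow_eq_zero_iff, hz0, hpi]
  have hc1 : Complex.cos (Real.pi * (ν - 1)) = -Complex.cos (Real.pi * ν) := by
    rw [mul_sub, mul_one, Complex.cos_sub_pi]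
  have hc2 : Complex.cos (Real.pi * (ν + 1)) = -Complex.cos (Real.pi * ν) := by
    rw [mul_add, mul_one, Complex.cos_add_pi]
  have hsum : ∑ n ∈ Finset.range N, besselB n ν / z ^ n =
      (∑ n ∈ Finset.range N, besselA n (ν - 1) / z ^ n +
        ∑ n ∈ Finset.range N, besselA n (ν + 1) / z ^ n) / 2 := by
    rw [← Finset.sum_add_distrib, Finset.sum_div]
    refine Finset.sum_congr rfl fun n _ => ?_
    rw [besselB_eq]
    ring
  rw [remK', integral_remK'_integrand hν hz, hsum, besselK'_eq ν hz,
    besselK_eq_expansion (abs_re_sub_one_lt hν) hz, besselK_eq_expansion (abs_re_add_one_lt hν) hz,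
    macdonaldExpansion, macdonaldExpansion, hc1, hc2]
  generalize ((Real.pi : ℂ) / (2 * z)) ^ (1 / 2 : ℂ) * Complex.exp (-z) = c at *
  field_simp
  ring

/-! ### Rotation to the functions `J_ν` and `Y_ν` -/

/-- Rotation by a quarter turn of the right half-plane, in either direction, does not cross the cut
of the logarithm. -/
theorem log_rotate {σ : ℝ} (hσ : σ = 1 ∨ σ = -1) {w : ℂ} (hw : 0 < w.re) :
    Complex.log (σ * I * w) = Complex.log w + σ * (Real.pi / 2 * I) := by
  have hw0 : w ≠ 0 := fun h => by rw [h] at hw; simp at hw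
  have harg := abs_lt.1 (abs_arg_lt_pi_div_two_iff.2 (Or.inl hw))
  have hpi := Real.pi_pos
  rcases hσ with rfl | rfl
  · have h : Complex.log (I * w) = Complex.log I + Complex.log w :=
      Complex.log_mul (x := I) (y := w) I_ne_zero hw0 (by
        rw [arg_I]; constructor <;> linarith)
    rw [ofReal_one, one_mul, h, Complex.log_I]
    ring
  · have h : Complex.log (-I * w) = Complex.log (-I) + Complex.log w :=
      Complex.log_mul (x := -I) (y := w) (neg_ne_zero.2 I_ne_zero) hw0 (by
        rw [arg_neg_I]; constructor <;> linarith)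
    rw [ofReal_neg, ofReal_one, neg_one_mul, h, Complex.log_neg_I]
    ring

theorem rotate_mem_slitPlane {σ : ℝ} (hσ : σ = 1 ∨ σ = -1) {z : ℂ} (hz : 0 < z.re) :
    σ * I * z ∈ slitPlane := by
  rw [mem_slitPlane_iff]
  right
  rcases hσ with rfl | rfl <;> simp <;> exact hz.ne'

theorem sign_mul_I_sq {σ : ℝ} (hσ : σ = 1 ∨ σ = -1) : ((σ : ℂ) * I) ^ 2 = -1 := by
  rcases hσ with rfl | rfl <;> simp

theorem ne_zero_of_zero_lt_re {z : ℂ} (hz : 0 < z.re) : z ≠ 0 := fun h => by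
  rw [h] at hz; simp at hz

theorem div_two_re_pos {z : ℂ} (hz : 0 < z.re) : 0 < (z / 2).re := by
  have h1 : (z / 2).re = z.re / 2 := by simp
  rw [h1]; positivity

/-- `I_ν(±i z) = e^{±iπν/2} J_ν(z)` in the right half-plane. -/
theorem besselI_rotate {σ : ℝ} (hσ : σ = 1 ∨ σ = -1) (ν : ℂ) {z : ℂ} (hz : 0 < z.re) :
    besselI ν (σ * I * z) = cexp (σ * I * (Real.pi / 2) * ν) * besselJ ν z := by
  have h2 := div_two_re_pos hz
  have h20 := ne_zero_of_zero_lt_re h2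
  have hσI : (σ : ℂ) * I ≠ 0 := by
    refine mul_ne_zero ?_ I_ne_zero
    rcases hσ with rfl | rfl <;> norm_num
  rw [besselI_eq_besselSeries, besselJ_eq_besselSeries, mul_pow, sign_mul_I_sq hσ, mul_div_assoc,
    Complex.cpow_def_of_ne_zero (mul_ne_zero hσI h20), log_rotate hσ h2,
    Complex.cpow_def_of_ne_zero h20, ← mul_assoc (cexp _), ← Complex.exp_add]
  ring_nf

theorem besselY_of_not_int {ν : ℂ} (h : ¬ ∃ n : ℤ, ν = (n : ℂ)) (z : ℂ) :
    besselY ν z = (besselJ ν z * Complex.cos (Real.pi * ν) - besselJ (-ν) z) /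
      Complex.sin (Real.pi * ν) := by
  rw [besselY, if_neg h]

theorem besselY_eq_of_not_int {σ : ℝ} (hσ : σ = 1 ∨ σ = -1) {ν : ℂ}
    (h : ¬ ∃ n : ℤ, ν = (n : ℂ)) {z : ℂ} (hz : 0 < z.re) :
    besselY ν z = σ * I * (σ * I * (2 / Real.pi) * cexp (σ * I * (Real.pi / 2) * ν) *
      besselK ν (σ * I * z) - besselJ ν z) := by
  have hsin := sin_pi_mul_ne_zero fun ⟨n, hn⟩ => h ⟨n, hn.symm⟩
  have hpi : (Real.pi : ℂ) ≠ 0 := by exact_mod_cast Real.pi_ne_zero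
  have hsq := sign_mul_I_sq hσ
  have hexp : cexp (σ * I * (Real.pi / 2) * ν) * cexp (σ * I * (Real.pi / 2) * ν) =
      Complex.cos (Real.pi * ν) + σ * I * Complex.sin (Real.pi * ν) := by
    rw [← Complex.exp_add,
      show σ * I * (Real.pi / 2) * ν + σ * I * (Real.pi / 2) * ν = (σ * (Real.pi * ν)) * I by ring,
      Complex.exp_mul_I]
    rcases hσ with rfl | rfl
    · simp; ring
    · simp; ring
  have hexp2 : cexp (σ * I * (Real.pi / 2) * ν) * cexp (σ * I * (Real.pi / 2) * -ν) = 1 := by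
    rw [← Complex.exp_add, ← Complex.exp_zero]
    ring_nf
  rw [besselY_of_not_int h, besselK_of_not_int h, besselI_rotate hσ _ hz, besselI_rotate hσ _ hz]
  have e : ∀ p X J : ℂ, σ * I * (σ * I * (2 / Real.pi) * p *
      (Real.pi / 2 * X / Complex.sin (Real.pi * ν)) - J) * Complex.sin (Real.pi * ν) =
      σ * I * (σ * I * p * X - J * Complex.sin (Real.pi * ν)) := fun p X J => by
    field_simp
  rw [div_eq_iff hsin, e]
  linear_combination (cexp (σ * I * (Real.pi / 2) * ν) * cexp (σ * I * (Real.pi / 2) * ν) *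
    besselJ ν z - cexp (σ * I * (Real.pi / 2) * ν) * cexp (σ * I * (Real.pi / 2) * -ν) *
    besselJ (-ν) z) * hsq - besselJ ν z * hexp + besselJ (-ν) z * hexp2

/-- In the right half-plane `J_ν ∓ i Y_ν`, a Hankel function, is a multiple of `K_ν(±i z)`; here
`σ = ±1` is the sign, and the relation is solved for `Y_ν`. For integral
orders the limit in the definition of `Y_ν` is evaluated by continuity in the order. -/
theorem besselY_eq {σ : ℝ} (hσ : σ = 1 ∨ σ = -1) (ν : ℂ) {z : ℂ} (hz : 0 < z.re) :
    besselY ν z = σ * I * (σ * I * (2 / Real.pi) * cexp (σ * I * (Real.pi / 2) * ν) *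
      besselK ν (σ * I * z) - besselJ ν z) := by
  by_cases h : ∃ n : ℤ, ν = (n : ℂ)
  · rw [besselY, if_pos h]
    apply Tendsto.limUnder_eq
    have hK := continuous_besselK_order (rotate_mem_slitPlane hσ hz)
    have hJ := (differentiable_besselJ_order (ne_zero_of_zero_lt_re hz)).continuous
    have hc : Continuous fun μ : ℂ => σ * I * (σ * I * (2 / Real.pi) *
        cexp (σ * I * (Real.pi / 2) * μ) * besselK μ (σ * I * z) - besselJ μ z) := by
      fun_prop
    refine ((hc.tendsto ν).mono_left nhdsWithin_le_nhds).congr' ?_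
    filter_upwards [eventually_not_int ν] with μ hμ
    rw [← besselY_of_not_int hμ, besselY_eq_of_not_int hσ hμ hz]
  · exact besselY_eq_of_not_int hσ h hz

theorem besselJ_eq_besselK (ν : ℂ) {z : ℂ} (hz : 0 < z.re) :
    besselJ ν z = I / Real.pi * (cexp (I * (Real.pi / 2) * ν) * besselK ν (I * z) -
      cexp (-I * (Real.pi / 2) * ν) * besselK ν (-I * z)) := by
  have h1 := besselY_eq (Or.inl rfl) ν hz
  have h2 := besselY_eq (Or.inr rfl) ν hz
  push_cast at h1 h2
  simp only [one_mul, neg_one_mul] at h1 h2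
  linear_combination (-(I / 2)) * h1 + (I / 2) * h2 + (besselJ ν z - I / Real.pi *
    (cexp (I * (Real.pi / 2) * ν) * besselK ν (I * z) -
      cexp (-I * (Real.pi / 2) * ν) * besselK ν (-I * z))) * I_sq

theorem besselY_eq_besselK (ν : ℂ) {z : ℂ} (hz : 0 < z.re) :
    besselY ν z = -(1 / Real.pi) * (cexp (I * (Real.pi / 2) * ν) * besselK ν (I * z) +
      cexp (-I * (Real.pi / 2) * ν) * besselK ν (-I * z)) := by
  have h1 := besselY_eq (Or.inl rfl) ν hz
  have h2 := besselY_eq (Or.inr rfl) ν hz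
  push_cast at h1 h2
  simp only [one_mul, neg_one_mul] at h1 h2
  linear_combination (1 / 2) * h1 + (1 / 2) * h2 + (1 / Real.pi *
    (cexp (I * (Real.pi / 2) * ν) * besselK ν (I * z) +
      cexp (-I * (Real.pi / 2) * ν) * besselK ν (-I * z))) * I_sq

theorem hasDerivAt_besselK_rotate (ν c : ℂ) {z : ℂ} (hc : c * z ∈ slitPlane) :
    HasDerivAt (fun z => besselK ν (c * z)) (c * besselK' ν (c * z)) z := by
  have h1 : HasDerivAt (besselK ν) (besselK' ν (c * z)) (c * z) :=
    ((differentiableOn_besselK ν).differentiableAt (isOpen_slitPlane.mem_nhds hc)).hasDerivAt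
  have h2 : HasDerivAt (fun z => c * z) (c * 1) z := (hasDerivAt_id z).const_mul c
  exact (h1.comp z h2).congr_deriv (by ring)

theorem I_mul_mem_slitPlane {z : ℂ} (hz : 0 < z.re) : I * z ∈ slitPlane := by
  simpa using rotate_mem_slitPlane (Or.inl rfl) hz

theorem neg_I_mul_mem_slitPlane {z : ℂ} (hz : 0 < z.re) : -I * z ∈ slitPlane := by
  simpa using rotate_mem_slitPlane (Or.inr rfl) hz

theorem besselJ'_eq (ν : ℂ) {z : ℂ} (hz : 0 < z.re) :
    besselJ' ν z = -(1 / Real.pi) * (cexp (I * (Real.pi / 2) * ν) * besselK' ν (I * z) +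
      cexp (-I * (Real.pi / 2) * ν) * besselK' ν (-I * z)) := by
  have h := (((hasDerivAt_besselK_rotate ν I (I_mul_mem_slitPlane hz)).const_mul
    (cexp (I * (Real.pi / 2) * ν))).sub ((hasDerivAt_besselK_rotate ν (-I)
    (neg_I_mul_mem_slitPlane hz)).const_mul (cexp (-I * (Real.pi / 2) * ν)))).const_mul
    (I / Real.pi)
  have hev : besselJ ν =ᶠ[𝓝 z] fun z => I / Real.pi *
      (cexp (I * (Real.pi / 2) * ν) * besselK ν (I * z) -
      cexp (-I * (Real.pi / 2) * ν) * besselK ν (-I * z)) := by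
    filter_upwards [(isOpen_lt continuous_const Complex.continuous_re).mem_nhds hz] with w hw
      using besselJ_eq_besselK ν hw
  rw [besselJ', (h.congr_of_eventuallyEq hev).deriv]
  linear_combination (1 / Real.pi * (cexp (I * (Real.pi / 2) * ν) * besselK' ν (I * z) +
      cexp (-I * (Real.pi / 2) * ν) * besselK' ν (-I * z))) * I_sq

theorem besselY'_eq (ν : ℂ) {z : ℂ} (hz : 0 < z.re) :
    besselY' ν z = -(I / Real.pi) * (cexp (I * (Real.pi / 2) * ν) * besselK' ν (I * z) -
      cexp (-I * (Real.pi / 2) * ν) * besselK' ν (-I * z)) := by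
  have h := (((hasDerivAt_besselK_rotate ν I (I_mul_mem_slitPlane hz)).const_mul
    (cexp (I * (Real.pi / 2) * ν))).add ((hasDerivAt_besselK_rotate ν (-I)
    (neg_I_mul_mem_slitPlane hz)).const_mul (cexp (-I * (Real.pi / 2) * ν)))).const_mul
    (-(1 / Real.pi) : ℂ)
  have hev : besselY ν =ᶠ[𝓝 z] fun z => -(1 / Real.pi) *
      (cexp (I * (Real.pi / 2) * ν) * besselK ν (I * z) +
      cexp (-I * (Real.pi / 2) * ν) * besselK ν (-I * z)) := by
    filter_upwards [(isOpen_lt continuous_const Complex.continuous_re).mem_nhds hz] with w hw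
      using besselY_eq_besselK ν hw
  rw [besselY', (h.congr_of_eventuallyEq hev).deriv]
  ring

theorem pi_div_two_mul_re_pos {z : ℂ} (hz : 0 < z.re) : 0 < ((Real.pi : ℂ) / (2 * z)).re := by
  have h : (Real.pi : ℂ) / (2 * z) = ((Real.pi / 2 : ℝ) : ℂ) * z⁻¹ := by
    push_cast
    rw [div_mul_eq_div_div, div_eq_mul_inv]
  have hn : 0 < normSq z := normSq_pos.2 (ne_zero_of_zero_lt_re hz)
  have hp : 0 < Real.pi / 2 := by positivity
  rw [h, re_ofReal_mul, inv_re]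
  positivity

theorem besselAmp_eq {z : ℂ} (hz : z ≠ 0) :
    besselAmp z = 2 / Real.pi * ((Real.pi : ℂ) / (2 * z)) ^ (1 / 2 : ℂ) := by
  have hpi : (Real.pi : ℂ) ≠ 0 := by exact_mod_cast Real.pi_ne_zero
  have hw : (Real.pi : ℂ) / (2 * z) ≠ 0 := div_ne_zero hpi (mul_ne_zero two_ne_zero hz)
  have e : 2 / ((Real.pi : ℂ) * z) =
      (((2 / Real.pi) ^ 2 : ℝ) : ℂ) * ((Real.pi : ℂ) / (2 * z)) := by
    push_cast
    field_simp
  have hp : 0 < (2 / Real.pi) ^ 2 := by positivity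
  have hr : (((2 / Real.pi) ^ 2 : ℝ) : ℂ) ≠ 0 := by exact_mod_cast hp.ne'
  rw [besselAmp, e, Complex.cpow_def_of_ne_zero (mul_ne_zero hr hw),
    Complex.log_ofReal_mul hp hw, add_mul, Complex.exp_add, Complex.cpow_def_of_ne_zero hw,
    Real.log_pow]
  congr 1
  have : (((2 : ℕ) * Real.log (2 / Real.pi) : ℝ) : ℂ) * (1 / 2) =
      ((Real.log (2 / Real.pi) : ℝ) : ℂ) := by push_cast; ring
  rw [this, ← ofReal_exp, Real.exp_log (by positivity)]
  push_cast
  rfl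

/-- The truncated expansion of `K'_ν` on the imaginary rays, with the phase split off. -/
theorem exp_mul_besselK'_rotate {σ : ℝ} (hσ : σ = 1 ∨ σ = -1) (N : ℕ) (ν : ℂ) {z : ℂ}
    (hz : 0 < z.re) :
    cexp (σ * I * (Real.pi / 2) * ν) * besselK' ν (σ * I * z) =
      σ * I * (Real.pi / 2) * besselAmp z * cexp (-(σ * I * besselOmega z ν)) *
        (∑ n ∈ Finset.range N, besselB n ν / (σ * I * z) ^ n + remK' N (σ * I * z) ν) := by
  have hz0 := ne_zero_of_zero_lt_re hz
  have hpi : (Real.pi : ℂ) ≠ 0 := by exact_mod_cast Real.pi_ne_zero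
  have hsq := sign_mul_I_sq hσ
  have hσI : (σ : ℂ) * I ≠ 0 := fun h => by rw [h] at hsq; norm_num at hsq
  have hσ' : -σ = 1 ∨ -σ = -1 := by rcases hσ with rfl | rfl <;> simp
  have hw := pi_div_two_mul_re_pos hz
  have hw0 := ne_zero_of_zero_lt_re hw
  have hinv : (Real.pi : ℂ) / (2 * (σ * I * z)) =
      ((-σ : ℝ) : ℂ) * I * ((Real.pi : ℂ) / (2 * z)) := by
    rw [div_eq_iff (mul_ne_zero two_ne_zero (mul_ne_zero hσI hz0)),
      show ((-σ : ℝ) : ℂ) * I * ((Real.pi : ℂ) / (2 * z)) * (2 * (σ * I * z)) =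
        -(σ * I) ^ 2 * ((Real.pi : ℂ) / (2 * z) * (2 * z)) by push_cast; ring, hsq,
      div_mul_cancel₀ _ (mul_ne_zero two_ne_zero hz0), neg_neg, one_mul]
  have hroot : ((Real.pi : ℂ) / (2 * (σ * I * z))) ^ (1 / 2 : ℂ) =
      cexp (-(σ * (Real.pi / 4) * I)) * ((Real.pi : ℂ) / (2 * z)) ^ (1 / 2 : ℂ) := by
    have hne : ((-σ : ℝ) : ℂ) * I * ((Real.pi : ℂ) / (2 * z)) ≠ 0 := by
      rw [← hinv]
      exact div_ne_zero hpi (mul_ne_zero two_ne_zero (mul_ne_zero hσI hz0))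
    rw [hinv, Complex.cpow_def_of_ne_zero hne, log_rotate hσ' hw, Complex.cpow_def_of_ne_zero hw0,
      ← Complex.exp_add]
    push_cast
    ring_nf
  have hquarter : cexp (-(σ * (Real.pi / 4) * I)) =
      -(σ * I) * cexp (σ * I * (Real.pi / 4)) := by
    have h1 : cexp (-(σ * (Real.pi / 2) * I)) = -(σ * I) := by
      rcases hσ with rfl | rfl
      · rw [ofReal_one, one_mul, one_mul, ← neg_mul, ← neg_div, Complex.exp_neg_pi_div_two_mul_I]
      · push_cast
        rw [neg_one_mul, neg_mul, neg_neg, Complex.exp_pi_div_two_mul_I]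
        ring
    rw [← h1, ← Complex.exp_add]
    ring_nf
  have hphase : cexp (-(σ * I * besselOmega z ν)) = cexp (σ * I * (Real.pi / 2) * ν) *
      cexp (-(σ * I * z)) * cexp (σ * I * (Real.pi / 4)) := by
    rw [← Complex.exp_add, ← Complex.exp_add, besselOmega]
    ring_nf
  rw [besselK'_expansion N (mul_ne_zero hσI hz0), hroot, hquarter, hphase, besselAmp_eq hz0]
  field_simp

/-! ### The remainders for `J'_ν` and `Y'_ν` -/

/-- The quotient of `K'_ν(z)` by `-(π / (2z))^{1/2} e^{-z}`, written as the truncated expansion plus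
its remainder; the value for `z ≠ 0` does not depend on `N`. -/
noncomputable def scaledBesselK' (N : ℕ) (z ν : ℂ) : ℂ :=
  ∑ n ∈ Finset.range N, besselB n ν / z ^ n + remK' N z ν

theorem besselJ'_eq_scaled (N : ℕ) (ν : ℂ) {z : ℂ} (hz : 0 < z.re) :
    besselJ' ν z = -(besselAmp z / 2) * I *
      (cexp (-(I * besselOmega z ν)) * scaledBesselK' N (I * z) ν -
        cexp (I * besselOmega z ν) * scaledBesselK' N (-I * z) ν) := by
  have hpi : (Real.pi : ℂ) ≠ 0 := by exact_mod_cast Real.pi_ne_zero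
  have h1 := exp_mul_besselK'_rotate (Or.inl rfl) N ν hz
  have h2 := exp_mul_besselK'_rotate (Or.inr rfl) N ν hz
  push_cast at h1 h2
  simp only [one_mul, neg_one_mul, ← scaledBesselK'.eq_1] at h1 h2
  rw [besselJ'_eq ν hz, h1, h2, neg_mul I (besselOmega z ν), neg_neg]
  field_simp
  ring

theorem besselY'_eq_scaled (N : ℕ) (ν : ℂ) {z : ℂ} (hz : 0 < z.re) :
    besselY' ν z = besselAmp z / 2 *
      (cexp (-(I * besselOmega z ν)) * scaledBesselK' N (I * z) ν +
        cexp (I * besselOmega z ν) * scaledBesselK' N (-I * z) ν) := by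
  have hpi : (Real.pi : ℂ) ≠ 0 := by exact_mod_cast Real.pi_ne_zero
  have h1 := exp_mul_besselK'_rotate (Or.inl rfl) N ν hz
  have h2 := exp_mul_besselK'_rotate (Or.inr rfl) N ν hz
  push_cast at h1 h2
  simp only [one_mul, neg_one_mul, ← scaledBesselK'.eq_1] at h1 h2
  rw [besselY'_eq ν hz, h1, h2, neg_mul I (besselOmega z ν), neg_neg]
  generalize scaledBesselK' N (I * z) ν = P
  generalize scaledBesselK' N (-I * z) ν = Q
  field_simp
  linear_combination (-(besselAmp z * (cexp (-(I * besselOmega z ν)) * P +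
    cexp (I * besselOmega z ν) * Q))) * I_sq

theorem cos_add_sin_mul_I (w : ℂ) :
    cexp (I * w) = Complex.cos w + Complex.sin w * I := by
  rw [mul_comm, Complex.exp_mul_I]

theorem cos_sub_sin_mul_I (w : ℂ) :
    cexp (-(I * w)) = Complex.cos w - Complex.sin w * I := by
  rw [← mul_neg, cos_add_sin_mul_I, Complex.cos_neg, Complex.sin_neg, neg_mul, sub_eq_add_neg]

theorem sin_mul_besselJ'_sub (N : ℕ) (ν : ℂ) {z : ℂ} (hz : 0 < z.re) :
    -(Complex.sin (besselOmega z ν) * besselJ' ν z -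
        Complex.cos (besselOmega z ν) * besselY' ν z) / besselAmp z =
      (scaledBesselK' N (I * z) ν + scaledBesselK' N (-I * z) ν) / 2 := by
  have hsc := Complex.sin_sq_add_cos_sq (besselOmega z ν)
  rw [div_eq_iff (besselAmp_ne_zero (ne_zero_of_zero_lt_re hz)), besselJ'_eq_scaled N ν hz,
    besselY'_eq_scaled N ν hz, cos_add_sin_mul_I, cos_sub_sin_mul_I]
  generalize Complex.sin (besselOmega z ν) = s at *
  generalize Complex.cos (besselOmega z ν) = c at *
  generalize scaledBesselK' N (I * z) ν = P at *
  generalize scaledBesselK' N (-I * z) ν = Q at *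
  linear_combination (besselAmp z / 2 * (P + Q)) * hsc - (besselAmp z / 2 * (P + Q) * s ^ 2) * I_sq

theorem cos_mul_besselJ'_add (N : ℕ) (ν : ℂ) {z : ℂ} (hz : 0 < z.re) :
    (Complex.cos (besselOmega z ν) * besselJ' ν z +
        Complex.sin (besselOmega z ν) * besselY' ν z) / besselAmp z =
      -(I / 2) * (scaledBesselK' N (I * z) ν - scaledBesselK' N (-I * z) ν) := by
  have hsc := Complex.sin_sq_add_cos_sq (besselOmega z ν)
  rw [div_eq_iff (besselAmp_ne_zero (ne_zero_of_zero_lt_re hz)), besselJ'_eq_scaled N ν hz,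
    besselY'_eq_scaled N ν hz, cos_add_sin_mul_I, cos_sub_sin_mul_I]
  generalize Complex.sin (besselOmega z ν) = s at *
  generalize Complex.cos (besselOmega z ν) = c at *
  generalize scaledBesselK' N (I * z) ν = P at *
  generalize scaledBesselK' N (-I * z) ν = Q at *
  linear_combination (-(besselAmp z / 2 * I * (P - Q))) * hsc +
    (besselAmp z / 2 * s * c * (P + Q)) * I_sq

theorem I_pow_two_mul (k : ℕ) : I ^ (2 * k) = (-1) ^ k := by
  rw [pow_mul, I_sq]

theorem neg_I_pow_two_mul (k : ℕ) : (-I) ^ (2 * k) = (-1) ^ k := by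
  rw [pow_mul, neg_sq, I_sq]

/-- The sum over the two rotated arguments keeps the terms of even index. -/
theorem sum_rotate_add (ν z : ℂ) (m : ℕ) :
    ∑ n ∈ Finset.range (2 * m), besselB n ν / (I * z) ^ n +
        ∑ n ∈ Finset.range (2 * m), besselB n ν / (-I * z) ^ n =
      2 * ∑ n ∈ Finset.range m, (-1) ^ n * besselB (2 * n) ν / z ^ (2 * n) := by
  induction m with
  | zero => simp
  | succ m ih =>
    have hs : ((-1 : ℂ) ^ m)⁻¹ = (-1) ^ m := by rw [← inv_pow]; norm_num
    have e : besselB (2 * m + 1) ν / (-I * z) ^ (2 * m + 1) =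
        -(besselB (2 * m + 1) ν / (I * z) ^ (2 * m + 1)) := by
      rw [neg_mul, Odd.neg_pow ⟨m, rfl⟩, div_neg]
    have e1 : besselB (2 * m) ν / (I * z) ^ (2 * m) =
        (-1) ^ m * besselB (2 * m) ν / z ^ (2 * m) := by
      rw [mul_pow, I_pow_two_mul, div_mul_eq_div_div, div_eq_mul_inv _ ((-1) ^ m), hs, mul_comm]
    have e2 : besselB (2 * m) ν / (-I * z) ^ (2 * m) =
        (-1) ^ m * besselB (2 * m) ν / z ^ (2 * m) := by
      rw [mul_pow, neg_I_pow_two_mul, div_mul_eq_div_div, div_eq_mul_inv _ ((-1) ^ m), hs,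
        mul_comm]
    rw [show 2 * (m + 1) = 2 * m + 1 + 1 by ring]
    simp only [Finset.sum_range_succ, e, e1, e2]
    linear_combination ih

/-- The difference over the two rotated arguments keeps the terms of odd index. -/
theorem sum_rotate_sub (ν z : ℂ) (m : ℕ) :
    ∑ n ∈ Finset.range (2 * m + 1), besselB n ν / (I * z) ^ n -
        ∑ n ∈ Finset.range (2 * m + 1), besselB n ν / (-I * z) ^ n =
      -(2 * I) * ∑ n ∈ Finset.range m, (-1) ^ n * besselB (2 * n + 1) ν / z ^ (2 * n + 1) := by
  induction m with
  | zero => simp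
  | succ m ih =>
    have hs : ((-1 : ℂ) ^ m)⁻¹ = (-1) ^ m := by rw [← inv_pow]; norm_num
    have e : besselB (2 * m + 1) ν / (-I * z) ^ (2 * m + 1) =
        -(besselB (2 * m + 1) ν / (I * z) ^ (2 * m + 1)) := by
      rw [neg_mul, Odd.neg_pow ⟨m, rfl⟩, div_neg]
    have e1 : besselB (2 * m + 1) ν / (I * z) ^ (2 * m + 1) =
        -I * ((-1) ^ m * besselB (2 * m + 1) ν / z ^ (2 * m + 1)) := by
      have h : (I ^ (2 * m + 1))⁻¹ = -I * (-1) ^ m := by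
        rw [pow_succ, mul_inv, I_pow_two_mul, hs, inv_I, mul_comm]
      rw [mul_pow, div_mul_eq_div_div, div_eq_mul_inv _ (I ^ (2 * m + 1)), h]
      ring
    have e2 : besselB (2 * m + 1 + 1) ν / (-I * z) ^ (2 * m + 1 + 1) =
        besselB (2 * m + 1 + 1) ν / (I * z) ^ (2 * m + 1 + 1) := by
      rw [neg_mul, Even.neg_pow ⟨m + 1, by ring⟩]
    rw [show 2 * (m + 1) + 1 = 2 * m + 1 + 1 + 1 by ring,
      Finset.sum_range_succ _ (2 * m + 1 + 1), Finset.sum_range_succ _ (2 * m + 1),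
      Finset.sum_range_succ (fun n => besselB n ν / (-I * z) ^ n) (2 * m + 1 + 1),
      Finset.sum_range_succ (fun n => besselB n ν / (-I * z) ^ n) (2 * m + 1),
      Finset.sum_range_succ _ m, e, e2, e1]
    linear_combination ih

theorem remJ'_even (m : ℕ) (ν : ℂ) {z : ℂ} (hz : 0 < z.re) :
    remJ' (2 * m) z ν = (remK' (2 * m) (I * z) ν + remK' (2 * m) (-I * z) ν) / 2 := by
  have h := sum_rotate_add ν z m
  rw [remJ', if_pos (even_two_mul m), sin_mul_besselJ'_sub (2 * m) ν hz, scaledBesselK',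
    scaledBesselK', Nat.mul_div_cancel_left m two_pos]
  linear_combination h / 2

theorem remJ'_odd (m : ℕ) (ν : ℂ) {z : ℂ} (hz : 0 < z.re) :
    remJ' (2 * m + 1) z ν =
      -(I / 2) * (remK' (2 * m + 1) (I * z) ν - remK' (2 * m + 1) (-I * z) ν) := by
  have h := sum_rotate_sub ν z m
  have e2 : (2 * m + 1) / 2 = m := by omega
  rw [remJ', if_neg (by simp), cos_mul_besselJ'_add (2 * m + 1) ν hz, scaledBesselK',
    scaledBesselK', e2]
  linear_combination (-(I / 2)) * h +
    (∑ n ∈ Finset.range m, (-1) ^ n * besselB (2 * n + 1) ν / z ^ (2 * n + 1)) * I_sq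

/-- Partial fractions for the kernel of the integral for `R_N^{(J')}`. -/
theorem kernel_partial_fractions {z : ℂ} (hz : 0 < z.re) {t : ℝ} (ht : 0 < t) (a k : ℂ) :
    a / (1 + ((t : ℂ) / z) ^ 2) * k =
      (a / (1 + (t : ℂ) / (I * z)) * k + a / (1 + (t : ℂ) / (-I * z)) * k) / 2 := by
  have h1 := one_add_div_ne_zero (I_mul_mem_slitPlane hz) ht
  have h2 := one_add_div_ne_zero (neg_I_mul_mem_slitPlane hz) ht
  have e1 : (t : ℂ) / (I * z) = -I * (t / z) := by
    rw [div_mul_eq_div_div, div_eq_mul_inv (t : ℂ), inv_I]; ring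
  have e2 : (t : ℂ) / (-I * z) = I * (t / z) := by
    rw [neg_mul, div_neg, e1]; ring
  rw [e1] at h1 ⊢
  rw [e2] at h2 ⊢
  have e3 : 1 + ((t : ℂ) / z) ^ 2 = (1 + -I * (t / z)) * (1 + I * (t / z)) := by
    linear_combination ((t : ℂ) / z) ^ 2 * I_sq
  have e4 : ∀ u v : ℂ, u ≠ 0 → v ≠ 0 → u + v = 2 →
      a / (u * v) * k = (a / u * k + a / v * k) / 2 := fun u v hu hv h => by
    field_simp
    linear_combination (-(a * k)) * h
  rw [e3]
  exact e4 _ _ h1 h2 (by ring)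

theorem integrableOn_remJ'_integrand {N : ℕ} {ν z : ℂ} (hν : |ν.re| < (N : ℝ) - 1 / 2)
    (hz : 0 < z.re) :
    IntegrableOn (fun t : ℝ => ((t ^ ((N : ℝ) - 1 / 2) * Real.exp (-t) : ℝ) : ℂ) /
      (1 + ((t : ℂ) / z) ^ 2) * besselK' ν (t : ℂ)) (Ioi 0) := by
  have i1 := integrableOn_remK'_integrand hν (I_mul_mem_slitPlane hz)
  have i2 := integrableOn_remK'_integrand hν (neg_I_mul_mem_slitPlane hz)
  exact IntegrableOn.congr_fun ((i1.add i2).div_const 2)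
    (fun t ht => (kernel_partial_fractions hz ht _ _).symm) measurableSet_Ioi

theorem integral_remJ'_integrand {N : ℕ} {ν z : ℂ} (hν : |ν.re| < (N : ℝ) - 1 / 2)
    (hz : 0 < z.re) :
    ∫ t : ℝ in Ioi 0, ((t ^ ((N : ℝ) - 1 / 2) * Real.exp (-t) : ℝ) : ℂ) /
      (1 + ((t : ℂ) / z) ^ 2) * besselK' ν (t : ℂ) =
      ((∫ t : ℝ in Ioi 0, ((t ^ ((N : ℝ) - 1 / 2) * Real.exp (-t) : ℝ) : ℂ) /
          (1 + (t : ℂ) / (I * z)) * besselK' ν (t : ℂ)) +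
        ∫ t : ℝ in Ioi 0, ((t ^ ((N : ℝ) - 1 / 2) * Real.exp (-t) : ℝ) : ℂ) /
          (1 + (t : ℂ) / (-I * z)) * besselK' ν (t : ℂ)) / 2 := by
  have i1 := integrableOn_remK'_integrand hν (I_mul_mem_slitPlane hz)
  have i2 := integrableOn_remK'_integrand hν (neg_I_mul_mem_slitPlane hz)
  rw [← integral_add i1 i2, ← integral_div]
  exact setIntegral_congr_fun measurableSet_Ioi fun t ht => kernel_partial_fractions hz ht _ _

/-- The integral representation of `R_N^{(J')}`: by the parity of `N`, the remainder is a half-sum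
or a half-difference of `R_N^{(K')}(±i z)`, and the powers of `±i` in front of the two integrals
always turn it into a half-sum of integrals. -/
theorem remJ'_eq {N : ℕ} {ν z : ℂ} (hν : |ν.re| < (N : ℝ) - 1 / 2) (hz : 0 < z.re) :
    remJ' N z ν = (-1) ^ (N / 2) * (Real.sqrt (2 / Real.pi) : ℂ) *
      (Complex.cos (Real.pi * ν) / (Real.pi : ℂ)) * (1 / z ^ N) *
      ∫ t : ℝ in Ioi 0, ((t ^ ((N : ℝ) - 1 / 2) * Real.exp (-t) : ℝ) : ℂ) /
        (1 + ((t : ℂ) / z) ^ 2) * besselK' ν (t : ℂ) := by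
  have h1 := remK'_eq hν (I_mul_mem_slitPlane hz)
  have h2 := remK'_eq hν (neg_I_mul_mem_slitPlane hz)
  rw [integral_remJ'_integrand hν hz]
  generalize (∫ t : ℝ in Ioi 0, ((t ^ ((N : ℝ) - 1 / 2) * Real.exp (-t) : ℝ) : ℂ) /
    (1 + (t : ℂ) / (I * z)) * besselK' ν (t : ℂ)) = A at *
  generalize (∫ t : ℝ in Ioi 0, ((t ^ ((N : ℝ) - 1 / 2) * Real.exp (-t) : ℝ) : ℂ) /
    (1 + (t : ℂ) / (-I * z)) * besselK' ν (t : ℂ)) = B at *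
  have hs : ∀ m : ℕ, ((-1 : ℂ) ^ m)⁻¹ = (-1) ^ m := fun m => by rw [← inv_pow]; norm_num
  obtain ⟨m, rfl | rfl⟩ := N.even_or_odd'
  · rw [remJ'_even m ν hz, h1, h2, mul_pow, mul_pow, I_pow_two_mul, neg_I_pow_two_mul,
      Nat.mul_div_cancel_left m two_pos, Even.neg_one_pow (even_two_mul m), one_div, mul_inv, hs]
    ring
  · have e : (2 * m + 1) / 2 = m := by omega
    have e1 : 1 / (I * z) ^ (2 * m + 1) = -I * (-1) ^ m * (1 / z ^ (2 * m + 1)) := by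
      rw [one_div, mul_pow, mul_inv, pow_succ, mul_inv, I_pow_two_mul, hs, inv_I, one_div]
      ring
    have e2 : 1 / (-I * z) ^ (2 * m + 1) = I * (-1) ^ m * (1 / z ^ (2 * m + 1)) := by
      rw [neg_mul, Odd.neg_pow ⟨m, rfl⟩, div_neg, e1]
      ring
    rw [remJ'_odd m ν hz, h1, h2, e1, e2, e, Odd.neg_one_pow ⟨m, rfl⟩]
    generalize (1 / z ^ (2 * m + 1)) = w
    generalize (-1 : ℂ) ^ m = s
    generalize Complex.cos (Real.pi * ν) / (Real.pi : ℂ) = c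
    linear_combination (-((s * (Real.sqrt (2 / Real.pi) : ℂ) * c * w * (A + B)) / 2)) * I_sq

end

theorem theorem9 (N : ℕ) (hN : 1 ≤ N) (ν : ℂ) (hν : |ν.re| < (N : ℝ) - 1 / 2) :
    (∀ z : ℂ, z ≠ 0 → |z.arg| < Real.pi →
      MeasureTheory.IntegrableOn
          (fun t : ℝ => ((t ^ ((N : ℝ) - 1 / 2) * Real.exp (-t) : ℝ) : ℂ) /
            (1 + (t : ℂ) / z) * besselK' ν (t : ℂ)) (Set.Ioi 0) ∧
        remK' N z ν =
          (-1) ^ N * (Real.sqrt (2 / Real.pi) : ℂ) *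
            (Complex.cos (Real.pi * ν) / (Real.pi : ℂ)) * (1 / z ^ N) *
            ∫ t : ℝ in Set.Ioi 0, ((t ^ ((N : ℝ) - 1 / 2) * Real.exp (-t) : ℝ) : ℂ) /
              (1 + (t : ℂ) / z) * besselK' ν (t : ℂ)) ∧
    (∀ z : ℂ, z ≠ 0 → |z.arg| < Real.pi / 2 →
      MeasureTheory.IntegrableOn
          (fun t : ℝ => ((t ^ ((N : ℝ) - 1 / 2) * Real.exp (-t) : ℝ) : ℂ) /
            (1 + ((t : ℂ) / z) ^ 2) * besselK' ν (t : ℂ)) (Set.Ioi 0) ∧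
        remJ' N z ν =
          (-1) ^ (N / 2) * (Real.sqrt (2 / Real.pi) : ℂ) *
            (Complex.cos (Real.pi * ν) / (Real.pi : ℂ)) * (1 / z ^ N) *
            ∫ t : ℝ in Set.Ioi 0, ((t ^ ((N : ℝ) - 1 / 2) * Real.exp (-t) : ℝ) : ℂ) /
              (1 + ((t : ℂ) / z) ^ 2) * besselK' ν (t : ℂ)) := by
  refine ⟨fun z hz h => ?_, fun z hz h => ?_⟩
  · have hz' := mem_slitPlane_of_abs_arg_lt hz h
    exact ⟨integrableOn_remK'_integrand hν hz', remK'_eq hν hz'⟩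
  · have hz' := (Complex.abs_arg_lt_pi_div_two_iff.1 h).resolve_right hz
    exact ⟨integrableOn_remJ'_integrand hν hz', remJ'_eq hν hz'⟩
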